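/- Fix an integer $k\ge 1$. **Weyl group and partitions.** $\widetilde W_\infty$ is the group of signed permutations $w=(w_1,w_2,\dots)$ moving finitely many integers and with an even number of negative entries (a bar denotes a minus sign). Its simple reflections are $s_i=(i,i+1)$ for $i\ge1$, and $s_0$, which sends $1\mapsto-2$, $2\mapsto-1$. A typed $k$-strict partition is a partition $\lambda=(\lambda_1\ge\dots\ge\lambda_\ell>0)$ in which no part $>k$ is repeated, with a number $\mathrm{type}(\lambda)\in\{0,1,2\}$ which is positive if and only if some $\lambda_j=k$. To $\lambda$ corresponds the element $w=w_\lambda\in\widetilde W_\infty$ with $|w_1|<w_2<\dots<w_k$ and $w_{k+1}<w_{k+2}<\cdots$ such that $\lambda_j=k-1+|w_{k+j}|$ if $w_{k+j}<0$, $\lambda_j=\#\{p\le k:|w_p|>w_{k+j}\}$ if $w_{k+j}>0$, $\mathrm{type}(\lambda)>0$ if and only if $|w_1|>1$, and in this case $\mathrm{type}(\lambda)$ is $1$ or $2$ according as $w_1>0$ or $w_1<0$. Put $\mathcal C(\lambda)=\{(i,j):1\le i<j,\ w_{k+i}+w_{k+j}<0\}$, and $\beta_j(\lambda)=w_{k+j}+1$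 if $w_{k+j}<0$, $\beta_j(\lambda)=w_{k+j}$ if $w_{k+j}>0$. Let $\ell_k(\lambda)$ be the number of parts $>k$. **Rings.** Let $\mathbb Z[b]=\mathbb Z[\tilde b_k,b_1,b_2,\dots]$, $b_0=1$, $b_p=0$ for $p<0$, and $c_p=b_p$ for $p<k$, $c_k=b_k+\tilde b_k$, $c_p=2b_p$ for $p>k$. Let $J^{(k)}\subset\mathbb Z[b]$ be the ideal generated by $b_p^2+\sum_{i=1}^p(-1)^ib_{p+i}c_{p-i}$ for $p>k$ and by $\rho_k:=b_k\tilde b_k+\sum_{i=1}^k(-1)^ib_{k+i}b_{k-i}$, and let $B^{(k)}=\mathbb Z[b]/J^{(k)}$. Let $t=(t_1,t_2,\dots)$. For $r\ge0$ let $h^r_j(-t)$ and $e^r_j(-t)$ be the complete and elementary symmetric polynomials of degree $j$ in $-t_1,\dots,-t_r$, and $h^{-r}_j(-t)=e^{r}_j(-t)$. Set $$c^r_p=\sum_{j=0}^pc_{p-j}h^r_j(-t),\quad a^s_p=\tfrac12c_p+\sum_{j=1}^pc_{p-j}h^s_j(-t),$$ $$b^s_k=b_k+\sum_{j=1}^kc_{k-j}h^s_j(-t),\quad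 \tilde b^s_k=\tilde b_k+\sum_{j=1}^kc_{k-j}h^s_j(-t).$$ In the $i$-th factor of a product, $\hat c^r_p=c^r_p$ unless $r=k-p<0$, in which case $\hat c^r_p=c^r_p+(2f-c_k)\,e^{p-k}_{p-k}(-t)$ with $f=\tilde b_k$ for $i$ odd and $f=b_k$ for $i$ even. **Divided differences.** For $i\ge1$, $s_i$ acts on $\mathbb Z[b,t]$ by exchanging $t_i,t_{i+1}$; $s_0$ sends $(t_1,t_2)$ to $(-t_2,-t_1)$, fixes $t_j$ for $j\ge3$, and $s_0(b_p)=b_p-\epsilon_p(t_1+t_2)c^2_{p-1}$ with $\epsilon_p=2$ for $p<k$ and $\epsilon_p=1$ for $p\ge k$, $s_0(\tilde b_k)=\tilde b_k-(t_1+t_2)c^2_{k-1}$. Put $\partial_0f=\frac{f-s_0f}{t_1+t_2}$ and $\partial_if=\frac{f-s_if}{t_{i+1}-t_i}$ for $i\ge1$. **Double eta polynomials.** Let $\lambda$ have length $\ell$, $m=\ell_k(\lambda)+1$, $\beta=\beta(\lambda)$. For $i<j$ the operator $R_{ij}$ adds $1$ to the $i$-th entry and subtracts $1$ from the $j$-th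 entry of an integer sequence. Expand $R^\lambda=\prod_{i<j}(1-R_{ij})\prod_{(i,j)\in\mathcal C(\lambda)}(1+R_{ij})^{-1}$, with $1\le i<j\le\ell$, as a power series in the $R_{ij}$. For a monomial $R$ let $\nu=R\lambda$, and let $\mathrm{supp}_m(R)$ be the set of all indices $i,j$ of factors $R_{ij}$ of $R$ with $j<m$. Put $\bar c_{\nu_i}^{\beta_i}=c_{\nu_i}^{\beta_i}$ if $i\in\mathrm{supp}_m(R)$ and $\bar c_{\nu_i}^{\beta_i}=\hat c_{\nu_i}^{\beta_i}$ otherwise. If $\mathrm{type}(\lambda)=0$, let $R\star\hat c^\beta_\lambda=\prod_{i=1}^{\ell}\bar c^{\beta_i}_{\nu_i}$. If $\mathrm{type}(\lambda)>0$, let $R\star\hat c^\beta_\lambda=\bar c^{\beta_1}_{\nu_1}\cdots\bar c^{\beta_{m-1}}_{\nu_{m-1}}\;g\;c^{\beta_{m+1}}_{\nu_{m+1}}\cdots c^{\beta_\ell}_{\nu_\ell}$, where $g=a^{\beta_m}_{\nu_m}$ if $R$ has a factor $R_{ij}$ with $i=m$ or $j=m$, and otherwise $g=b_k^{\beta_m}$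 for type $1$ and $g=\tilde b_k^{\beta_m}$ for type $2$. Extend linearly and set $H_\lambda(c\,|\,t)=2^{-\ell_k(\lambda)}R^\lambda\star\hat c^{\beta}_\lambda$. **Proposition.** Let $\lambda,\mu$ be typed $k$-strict partitions with $|\lambda|=|\mu|+1$ and $w_\lambda=s_iw_\mu$ for some simple reflection $s_i$, $i\ge0$. Then $H_\lambda(c\,|\,t)$ and $H_\mu(c\,|\,t)$ lie in $\mathbb Z[b,t]$, and $$\partial_iH_\lambda(c\,|\,t)=H_\mu(c\,|\,t)\quad\text{in } B^{(k)}[t].$$ Moreover, this equality holds already in $\mathbb Z[b,t]$, except possibly in the two subcases in which $\mathrm{type}(\lambda)$ and $\mathrm{type}(\mu)$ are both positive and $i=1$ or $i=0$ (that is, $w_\lambda=(\cdots\bar2\,1\cdots)$ with $i=1$, or $w_\lambda=(\cdots\bar2\,\bar1\cdots)$ with $i=0$, the displayed entries being in positions $>k$). For $\lambda=(k+1,k)$ and $\mu=(k,k)$ the equality fails in $\mathbb Z[b,t]$, but it holds there modulo the quadratic relation $\rho_k=0$. -/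

import Mathlib

open scoped BigOperators

namespace DoubleEta

/-! ### Typed strict partitions and the Weyl group of type D -/

/-- A typed `k`-strict partition: a weakly decreasing list of positive parts, in which no part
greater than `k` is repeated, with a type in `{0, 1, 2}` which is positive exactly when some part
equals `k`. -/
@[ext]
structure TypedPartition (k : ℕ) where
  parts : List ℕ
  sorted : parts.Pairwise (fun x y => y ≤ x)
  parts_pos : ∀ x ∈ parts, 0 < x
  strict : ∀ x ∈ parts, k < x → parts.count x = 1
  type : ℕ
  type_le : type ≤ 2
  type_pos_iff : 0 < type ↔ k ∈ parts

namespace TypedPartition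

variable {k : ℕ}

/-- The `j`-th part for `j ≥ 1`, with value `0` beyond the length. -/
def part (lam : TypedPartition k) (j : ℕ) : ℕ := lam.parts.getD (j - 1) 0

/-- The sum of the parts. -/
def size (lam : TypedPartition k) : ℕ := lam.parts.sum

/-- The number of nonzero parts. -/
def length (lam : TypedPartition k) : ℕ := lam.parts.length

/-- The number of parts strictly greater than `k`. -/
def numLarge (lam : TypedPartition k) : ℕ := (lam.parts.filter (fun x => k < x)).length

end TypedPartition

/-- The infinite Weyl group of type D, as the set of permutations `w` of `ℤ` with
`w (-a) = -(w a)` which move only finitely many integers and have an even number of sign changes.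
The entry `w_j` of the signed permutation `w` is `w j`. -/
def IsWeylD (w : Equiv.Perm ℤ) : Prop :=
  (∀ a, w (-a) = -(w a)) ∧ {a : ℤ | w a ≠ a}.Finite ∧ Even {a : ℤ | 0 < a ∧ w a < 0}.ncard

/-- The simple reflections: `s_0` exchanges `1 ↔ -2` and `2 ↔ -1`, while `s_i` for `i ≥ 1` is the
transposition of `i` and `i + 1` (extended to the negative integers). -/
def simpleReflection (i : ℕ) : Equiv.Perm ℤ :=
  if i = 0 then Equiv.swap 1 (-2) * Equiv.swap 2 (-1)
  else Equiv.swap (i : ℤ) (i + 1) * Equiv.swap (-i : ℤ) (-(i + 1))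

/-- `|w_1| < w_2 < ⋯ < w_k` and `w_{k+1} < w_{k+2} < ⋯`. -/
def IsGrassmannian (k : ℕ) (w : Equiv.Perm ℤ) : Prop :=
  (2 ≤ k → |w 1| < w 2) ∧ (∀ i : ℕ, 2 ≤ i → i < k → w i < w (i + 1)) ∧
    ∀ i : ℕ, k + 1 ≤ i → w i < w (i + 1)

/-- The correspondence between `k`-Grassmannian elements and typed `k`-strict partitions. -/
def Corresponds {k : ℕ} (lam : TypedPartition k) (w : Equiv.Perm ℤ) : Prop :=
  IsWeylD w ∧ IsGrassmannian k w ∧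
    (∀ j : ℕ, 1 ≤ j → w (k + j : ℕ) < 0 → (lam.part j : ℤ) = k - 1 + |w (k + j : ℕ)|) ∧
    (∀ j : ℕ, 1 ≤ j → 0 < w (k + j : ℕ) →
      lam.part j = ((Finset.Icc 1 k).filter (fun p : ℕ => w (k + j : ℕ) < |w p|)).card) ∧
    (0 < lam.type ↔ 1 < |w 1|) ∧
    (0 < lam.type → lam.type = if 0 < w 1 then 1 else 2)

/-! #### Every typed partition corresponds to some element -/

theorem surj_of_eventually_id (f : ℕ → ℕ) (hf : Function.Injective f) (N : ℕ)
    (hN : ∀ n, N ≤ n → f n = n) : Function.Surjective f := by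
  have hlt : ∀ n, n < N → f n < N := by
    intro n hn
    by_contra h
    have h1 := hN (f n) (by omega)
    have := hf h1
    omega
  have hmaps : Set.MapsTo f (Finset.range N : Set ℕ) (Finset.range N : Set ℕ) := by
    intro n hn
    simpa using hlt n (by simpa using hn)
  have hs := Finset.surjOn_of_injOn_of_card_le f hmaps hf.injOn le_rfl
  intro m
  by_cases hm : m < N
  · obtain ⟨n, -, hn⟩ := hs (by simpa using hm : m ∈ (Finset.range N : Set ℕ))
    exact ⟨n, hn⟩
  · exact ⟨m, hN m (by omega)⟩

theorem exists_signed_perm (f : ℕ → ℕ) (hf : Function.Injective f) (N : ℕ)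
    (hN : ∀ n, N ≤ n → f n = n) (S : Finset ℕ) (hS : Even S.card) :
    ∃ w : Equiv.Perm ℤ, IsWeylD w ∧
      ∀ n : ℕ, w ((n : ℤ) + 1) = (if n ∈ S then -1 else 1) * ((f n : ℤ) + 1) := by
  classical
  let s : ℕ → ℤ := fun n => if n ∈ S then -1 else 1
  have hs : ∀ n, s n = 1 ∨ s n = -1 := by
    intro n; by_cases h : n ∈ S <;> simp [s, h]
  let W : ℤ → ℤ := fun a =>
    if 0 < a then s (a.natAbs - 1) * ((f (a.natAbs - 1) : ℤ) + 1)
    else if a < 0 then -(s (a.natAbs - 1) * ((f (a.natAbs - 1) : ℤ) + 1))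
    else 0
  have Wpos : ∀ n : ℕ, W ((n : ℤ) + 1) = s n * ((f n : ℤ) + 1) := by
    intro n
    have h1 : (0 : ℤ) < (n : ℤ) + 1 := by omega
    have h2 : ((n : ℤ) + 1).natAbs - 1 = n := by omega
    simp only [W, h1, if_true, h2]
  have Wneg : ∀ n : ℕ, W (-((n : ℤ) + 1)) = -(s n * ((f n : ℤ) + 1)) := by
    intro n
    have h1 : ¬ (0 : ℤ) < -((n : ℤ) + 1) := by omega
    have h1' : -((n : ℤ) + 1) < 0 := by omega
    have h2 : (-((n : ℤ) + 1)).natAbs - 1 = n := by omega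
    simp only [W, h1, h1', if_true, if_false, h2]
  have Wzero : W 0 = 0 := by simp [W]
  have cases3 : ∀ a : ℤ, a = 0 ∨ (∃ n : ℕ, a = (n : ℤ) + 1) ∨ ∃ n : ℕ, a = -((n : ℤ) + 1) := by
    intro a
    rcases lt_trichotomy a 0 with h | h | h
    · exact Or.inr (Or.inr ⟨a.natAbs - 1, by omega⟩)
    · exact Or.inl h
    · exact Or.inr (Or.inl ⟨a.natAbs - 1, by omega⟩)
  have Wodd : ∀ a, W (-a) = -(W a) := by
    intro a
    rcases cases3 a with rfl | ⟨n, rfl⟩ | ⟨n, rfl⟩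
    · simp [Wzero]
    · rw [Wneg, Wpos]
    · rw [neg_neg, Wpos, Wneg, neg_neg]
  have Winj : Function.Injective W := by
    intro a b hab
    rcases cases3 a with rfl | ⟨n, rfl⟩ | ⟨n, rfl⟩ <;>
      rcases cases3 b with rfl | ⟨m, rfl⟩ | ⟨m, rfl⟩ <;>
      simp only [Wpos, Wneg, Wzero] at hab
    · rfl
    all_goals
      first
      | (rcases hs m with h | h <;> rw [h] at hab <;> omega)
      | (rcases hs n with h | h <;> rw [h] at hab <;> omega)
      | (have hfn : f n = f m := by
           rcases hs m with h | h <;> rcases hs n with h' | h' <;> rw [h, h'] at hab <;> omega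
         have hnm := hf hfn
         subst hnm
         rcases hs n with h | h <;> rw [h] at hab <;> omega)
  have Wsurj : Function.Surjective W := by
    have hsurj := surj_of_eventually_id f hf N hN
    intro a
    rcases cases3 a with rfl | ⟨n, rfl⟩ | ⟨n, rfl⟩
    · exact ⟨0, Wzero⟩
    · obtain ⟨m, rfl⟩ := hsurj n
      rcases hs m with h | h
      · exact ⟨m + 1, by rw [Wpos, h]; ring⟩
      · exact ⟨-(m + 1), by rw [Wneg, h]; ring⟩
    · obtain ⟨m, rfl⟩ := hsurj n
      rcases hs m with h | h
      · exact ⟨-(m + 1), by rw [Wneg, h]; ring⟩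
      · exact ⟨m + 1, by rw [Wpos, h]; ring⟩
  obtain ⟨w, hw⟩ : ∃ w : Equiv.Perm ℤ, ∀ a, w a = W a :=
    ⟨Equiv.ofBijective W ⟨Winj, Wsurj⟩, fun _ => rfl⟩
  refine ⟨w, ⟨fun a => by rw [hw, hw, Wodd], ?_, ?_⟩, fun n => by rw [hw, Wpos]⟩
  · obtain ⟨B, hB⟩ := S.bddAbove
    refine (Set.finite_Icc (-((N + B + 1 : ℕ) : ℤ)) ((N + B + 1 : ℕ) : ℤ)).subset ?_
    have key : ∀ n : ℕ, N + B + 1 ≤ n → s n = 1 ∧ f n = n := by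
      intro n hn
      refine ⟨?_, hN n (by omega)⟩
      have : n ∉ S := fun h => by have := hB h; omega
      simp [s, this]
    intro a ha
    change w a ≠ a at ha
    rw [hw] at ha
    rw [Set.mem_Icc]
    by_contra hcon
    apply ha
    rcases cases3 a with rfl | ⟨n, rfl⟩ | ⟨n, rfl⟩
    · exact Wzero
    · obtain ⟨h1, h2⟩ := key n (by omega)
      rw [Wpos, h1, h2, one_mul]
    · obtain ⟨h1, h2⟩ := key n (by omega)
      rw [Wneg, h1, h2, one_mul]
  · have : {a : ℤ | 0 < a ∧ w a < 0} = (fun n : ℕ => (n : ℤ) + 1) '' (S : Set ℕ) := by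
      ext a
      change (0 < a ∧ w a < 0) ↔ _
      rw [hw]
      simp only [Set.mem_image, Finset.mem_coe]
      constructor
      · rintro ⟨h0, h1⟩
        rcases cases3 a with rfl | ⟨n, rfl⟩ | ⟨n, rfl⟩
        · omega
        · refine ⟨n, ?_, rfl⟩
          by_contra hn
          rw [Wpos] at h1
          simp only [s, hn, if_false] at h1
          omega
        · omega
      · rintro ⟨n, hn, rfl⟩
        refine ⟨by omega, ?_⟩
        rw [Wpos]
        simp only [s, hn, if_true]
        omega
    rw [this, Set.ncard_image_of_injective _ (fun a b h => by simpa using h), Set.ncard_coe_finset]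
    exact hS

theorem filter_append_filter (k : ℕ) (l : List ℕ) (hl : l.Pairwise (fun x y => y ≤ x)) :
    l = l.filter (fun x => k < x) ++ l.filter (fun x => x ≤ k) := by
  induction l with
  | nil => rfl
  | cons a l ih =>
    rw [List.pairwise_cons] at hl
    have ih' := ih hl.2
    by_cases h : k < a
    · rw [List.filter_cons_of_pos (by simpa using h),
        List.filter_cons_of_neg (by simpa using h), List.cons_append, ← ih']
    · have h1 : ∀ x ∈ a :: l, x ≤ k := by
        intro x hx
        rcases List.mem_cons.1 hx with rfl | hx
        · omega
        · have := hl.1 x hx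
          omega
      have h2 : (a :: l).filter (fun x => k < x) = [] := by
        rw [List.filter_eq_nil_iff]
        intro x hx
        have := h1 x hx
        simp only [decide_eq_true_eq]
        omega
      have h3 : (a :: l).filter (fun x => x ≤ k) = a :: l := by
        rw [List.filter_eq_self]
        intro x hx
        simpa using h1 x hx
      rw [h2, h3, List.nil_append]

theorem exists_corresponds {k : ℕ} [NeZero k] (lam : TypedPartition k) :
    ∃ w : Equiv.Perm ℤ, Corresponds lam w := by
  classical
  have hk : 0 < k := Nat.pos_of_ne_zero (NeZero.ne k)
  obtain ⟨L, hLdef⟩ : ∃ L, L = lam.parts.filter (fun x => k < x) := ⟨_, rfl⟩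
  obtain ⟨M, hMdef⟩ : ∃ M, M = lam.parts.filter (fun x => x ≤ k) := ⟨_, rfl⟩
  have hLM : lam.parts = L ++ M := by
    rw [hLdef, hMdef]; exact filter_append_filter k _ lam.sorted
  have hLk : ∀ x ∈ L, k < x := by
    intro x hx; rw [hLdef] at hx; simpa using (List.mem_filter.1 hx).2
  have hMk : ∀ x ∈ M, x ≤ k := by
    intro x hx; rw [hMdef] at hx; simpa using (List.mem_filter.1 hx).2
  have hLs : L.Pairwise (fun x y => y < x) := by
    have h1 : L.Pairwise (fun x y => y ≤ x) := by rw [hLdef]; exact lam.sorted.filter _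
    have h2 : L.Nodup := by
      rw [List.nodup_iff_count_le_one]
      intro a
      by_cases ha : a ∈ L
      · have hap : a ∈ lam.parts := by rw [hLM]; exact List.mem_append_left _ ha
        have h3 := lam.strict a hap (hLk a ha)
        rw [hLM, List.count_append] at h3
        omega
      · rw [List.count_eq_zero_of_not_mem ha]; omega
    exact (h1.and h2).imp (fun h => by omega)
  have hMs : M.Pairwise (fun x y => y ≤ x) := by rw [hMdef]; exact lam.sorted.filter _
  obtain ⟨d, hd⟩ : ∃ d, d = L.length := ⟨_, rfl⟩
  -- the small parts, as a function
  obtain ⟨m, hm⟩ : ∃ m : ℕ → ℕ, m = fun i => M.getD i 0 := ⟨_, rfl⟩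
  have hm_anti : ∀ i j, i ≤ j → m j ≤ m i := by
    intro i j hij
    by_cases hj : j < M.length
    · rcases hij.eq_or_lt with rfl | hlt
      · exact le_rfl
      · have := (List.pairwise_iff_getElem.1 hMs) i j (by omega) hj hlt
        simpa [hm, List.getD_eq_getElem?_getD, List.getElem?_eq_getElem hj,
          List.getElem?_eq_getElem (show i < M.length by omega)] using this
    · have : m j = 0 := by
        simp [hm, List.getD_eq_getElem?_getD, List.getElem?_eq_none (show M.length ≤ j by omega)]
      omega
  have hm_zero : ∀ i, M.length ≤ i → m i = 0 := by
    intro i hi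
    simp [hm, List.getD_eq_getElem?_getD, List.getElem?_eq_none hi]
  have hm_le : ∀ i, m i ≤ k := by
    intro i
    by_cases hi : i < M.length
    · have := hMk M[i] (List.getElem_mem hi)
      simpa [hm, List.getD_eq_getElem?_getD, List.getElem?_eq_getElem hi] using this
    · rw [hm_zero i (by omega)]; omega
  have hm0 : k ≤ m 0 ↔ 0 < lam.type := by
    rw [lam.type_pos_iff]
    constructor
    · intro h
      have hi : 0 < M.length := by
        by_contra hcon
        have := hm_zero 0 (by omega)
        omega
      have h1 : m 0 = M[0] := by
        simp [hm, List.getD_eq_getElem?_getD, List.getElem?_eq_getElem hi]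
      have h2 : M[0] = k := by have := hm_le 0; omega
      rw [hLM, ← h2]
      exact List.mem_append_right _ (List.getElem_mem hi)
    · intro h
      rw [hLM, List.mem_append] at h
      rcases h with h | h
      · exact absurd (hLk k h) (lt_irrefl k)
      · obtain ⟨i, hi, hik⟩ := List.getElem_of_mem h
        have h1 : m i = k := by
          rw [← hik]
          simp [hm, List.getD_eq_getElem?_getD, List.getElem?_eq_getElem hi]
        have := hm_anti 0 i (by omega)
        omega
  -- the values different from those of the large parts
  obtain ⟨D, hD⟩ : ∃ D : Finset ℕ, D = (L.map (fun x => x - k)).toFinset := ⟨_, rfl⟩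
  have hDmem : ∀ v, v ∈ D ↔ ∃ x ∈ L, x - k = v := by
    intro v; rw [hD, List.mem_toFinset, List.mem_map]
  have hD0 : 0 ∉ D := by
    rw [hDmem]; rintro ⟨x, hx, h⟩; have := hLk x hx; omega
  have hDcard : D.card = d := by
    rw [hD, List.toFinset_card_of_nodup, List.length_map, hd]
    rw [List.Nodup, List.pairwise_map]
    refine List.Pairwise.imp_of_mem ?_ hLs
    intro a b ha hb hab
    have := hLk a ha
    have := hLk b hb
    omega
  have hinf : {v | v ∉ D}.Infinite := D.finite_toSet.infinite_compl
  obtain ⟨u, hu⟩ : ∃ u : ℕ → ℕ, u = Nat.nth (fun v => v ∉ D) := ⟨_, rfl⟩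
  have hu_mono : StrictMono u := by rw [hu]; exact Nat.nth_strictMono hinf
  have hu_mem : ∀ n, u n ∉ D := by
    intro n; rw [hu]; exact Nat.nth_mem_of_infinite hinf n
  have hu0 : u 0 = 0 := by
    have h1 : Nat.nth (fun v => v ∉ D) (Nat.count (fun v => v ∉ D) 0) = 0 := Nat.nth_count hD0
    rw [Nat.count_zero] at h1
    rw [hu]; exact h1
  obtain ⟨B, hB⟩ := D.bddAbove
  have hu_large : ∀ n, B < n → u (n - d) = n := by
    intro n hn
    have hnD : n ∉ D := fun h => by have := hB h; omega
    have h1 : Nat.nth (fun v => v ∉ D) (Nat.count (fun v => v ∉ D) n) = n := Nat.nth_count hnD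
    have h2 : Nat.count (fun v => v ∉ D) n = n - d := by
      rw [Nat.count_eq_card_filter_range]
      have h3 : (Finset.range n).filter (fun v => v ∉ D) = Finset.range n \ D := by
        ext v; simp
      have h4 : D ⊆ Finset.range n := by
        intro v hv; have := hB hv; rw [Finset.mem_range]; omega
      rw [h3, Finset.card_sdiff_of_subset h4, Finset.card_range, hDcard]
    rw [h2] at h1
    rw [hu]; exact h1
  -- positions of the first `k` values and of the remaining ones
  obtain ⟨cnt, hcnt⟩ : ∃ cnt : ℕ → ℕ,
      cnt = fun c => ((Finset.range M.length).filter (fun i => c ≤ m i)).card := ⟨_, rfl⟩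
  have cnt_ge : ∀ c i, 0 < c → c ≤ m i → i + 1 ≤ cnt c := by
    intro c i hc h
    have : Finset.range (i + 1) ⊆ (Finset.range M.length).filter (fun i => c ≤ m i) := by
      intro j hj
      rw [Finset.mem_range] at hj
      have h1 := hm_anti j i (by omega)
      rw [Finset.mem_filter, Finset.mem_range]
      refine ⟨?_, by omega⟩
      by_contra hcon
      have := hm_zero j (by omega)
      omega
    have := Finset.card_le_card this
    rw [Finset.card_range] at this
    rw [hcnt]; exact this
  have cnt_le : ∀ c i, m i < c → cnt c ≤ i := by
    intro c i h
    have : (Finset.range M.length).filter (fun i => c ≤ m i) ⊆ Finset.range i := by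
      intro j hj
      rw [Finset.mem_filter] at hj
      rw [Finset.mem_range]
      by_contra hcon
      have := hm_anti i j (by omega)
      omega
    have := Finset.card_le_card this
    rw [Finset.card_range] at this
    rw [hcnt]; exact this
  have cnt_anti : ∀ c c', c ≤ c' → cnt c' ≤ cnt c := by
    intro c c' h
    rw [hcnt]
    refine Finset.card_le_card ?_
    intro j hj
    rw [Finset.mem_filter] at hj ⊢
    exact ⟨hj.1, by omega⟩
  obtain ⟨x, hx⟩ : ∃ x : ℕ → ℕ, ∀ p, x p = p + cnt (k - p) := ⟨_, fun _ => rfl⟩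
  obtain ⟨y, hy⟩ : ∃ y : ℕ → ℕ, ∀ i, y i = i + (k - m i) := ⟨_, fun _ => rfl⟩
  have hx_mono : ∀ p q, p < q → x p < x q := by
    intro p q h
    have := cnt_anti (k - q) (k - p) (by omega)
    rw [hx, hx]; omega
  have hy_mono : ∀ i j, i < j → y i < y j := by
    intro i j h
    have := hm_anti i j (by omega)
    rw [hy, hy]; omega
  have hxy : ∀ p i, p < k → (k - p ≤ m i → y i < x p) ∧ (m i < k - p → x p < y i) := by
    intro p i hp
    constructor
    · intro h
      have := cnt_ge (k - p) i (by omega) h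
      rw [hx, hy]; omega
    · intro h
      have := cnt_le (k - p) i h
      rw [hx, hy]; omega
  have hx0 : x 0 = 0 ↔ ¬ 0 < lam.type := by
    rw [← hm0, hx]
    constructor
    · intro h hcon
      have := cnt_ge (k - 0) 0 (by omega) (by omega)
      omega
    · intro h
      have := cnt_le (k - 0) 0 (by omega)
      omega
  -- absolute values
  obtain ⟨f, hf⟩ : ∃ f : ℕ → ℕ, ∀ n, f n = if n < k then u (x n)
      else if n < k + d then L.getD (n - k) 0 - k else u (y (n - k - d)) := ⟨_, fun _ => rfl⟩
  have hf1 : ∀ n, n < k → f n = u (x n) := by intro n h; rw [hf, if_pos h]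
  have hf2 : ∀ n, n < d → ∃ z ∈ L, L.getD n 0 = z ∧ f (k + n) = z - k := by
    intro n h
    have hn : n < L.length := by omega
    refine ⟨L[n], List.getElem_mem hn, ?_, ?_⟩
    · simp [List.getD_eq_getElem?_getD, List.getElem?_eq_getElem hn]
    · rw [hf, if_neg (by omega), if_pos (by omega), show k + n - k = n by omega]
      simp [List.getD_eq_getElem?_getD, List.getElem?_eq_getElem hn]
  have hf2' : ∀ a b, a < b → b < d → f (k + b) < f (k + a) := by
    intro a b hab hb
    obtain ⟨z, hz, hz1, hz2⟩ := hf2 a (by omega)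
    obtain ⟨z', hz', hz1', hz2'⟩ := hf2 b hb
    have := (List.pairwise_iff_getElem.1 hLs) a b (by omega) (by omega) hab
    rw [List.getD_eq_getElem?_getD, List.getElem?_eq_getElem (by omega), Option.getD_some] at hz1
    rw [List.getD_eq_getElem?_getD, List.getElem?_eq_getElem (by omega), Option.getD_some] at hz1'
    have := hLk z hz
    have := hLk z' hz'
    omega
  have hf2D : ∀ n, n < d → f (k + n) ∈ D := by
    intro n h
    obtain ⟨z, hz, -, hz2⟩ := hf2 n h
    rw [hDmem]; exact ⟨z, hz, hz2.symm⟩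
  have hf3 : ∀ i, f (k + d + i) = u (y i) := by
    intro i
    rw [hf, if_neg (by omega), if_neg (by omega), show k + d + i - k - d = i by omega]
  have pos3 : ∀ n, n < k ∨ (∃ j, j < d ∧ n = k + j) ∨ ∃ i, n = k + d + i := by
    intro n
    by_cases h : n < k
    · exact Or.inl h
    · by_cases h' : n < k + d
      · exact Or.inr (Or.inl ⟨n - k, by omega, by omega⟩)
      · exact Or.inr (Or.inr ⟨n - (k + d), by omega⟩)
  have hxy_ne : ∀ p i, p < k → x p ≠ y i := by
    intro p i hp
    by_cases h : k - p ≤ m i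
    · exact ((hxy p i hp).1 h).ne'
    · exact ((hxy p i hp).2 (by omega)).ne
  have hf_lt : ∀ a b, a < b → f a ≠ f b := by
    intro a b hab
    rcases pos3 a with ha | ⟨j, hj, rfl⟩ | ⟨i, rfl⟩ <;>
      rcases pos3 b with hb | ⟨j', hj', rfl⟩ | ⟨i', rfl⟩
    · rw [hf1 a ha, hf1 b hb]
      exact (hu_mono (hx_mono a b hab)).ne
    · rw [hf1 a ha]
      exact fun h => hu_mem _ (h ▸ hf2D j' hj')
    · rw [hf1 a ha, hf3]
      exact fun h => hxy_ne a i' ha (hu_mono.injective h)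
    · omega
    · exact (hf2' j j' (by omega) hj').ne'
    · rw [hf3]
      exact fun h => hu_mem _ (h ▸ hf2D j hj)
    · omega
    · omega
    · rw [hf3, hf3]
      exact (hu_mono (hy_mono i i' (by omega))).ne
  have hf_inj : Function.Injective f := by
    intro a b h
    rcases lt_trichotomy a b with h' | h' | h'
    · exact absurd h (hf_lt a b h')
    · exact h'
    · exact absurd h.symm (hf_lt b a h')
  have hf_large : ∀ n, k + d + M.length + B + 1 ≤ n → f n = n := by
    intro n hn
    obtain ⟨i, rfl⟩ : ∃ i, n = k + d + i := ⟨n - (k + d), by omega⟩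
    rw [hf3, hy, hm_zero i (by omega)]
    have := hu_large (k + d + i) (by omega)
    rwa [show k + d + i - d = i + (k - 0) by omega] at this
  -- signs
  obtain ⟨T, hTeven, hT0, hTd, hTt⟩ : ∃ T : Finset ℕ, Even (T.card + d) ∧
      (0 < lam.type → (0 ∈ T ↔ lam.type = 2)) ∧ (∀ n ∈ T, n = 0 ∨ n = k + d) ∧
      (k + d ∈ T → 0 < lam.type) := by
    have h2 := lam.type_le
    rcases Nat.even_or_odd d with hd' | hd' <;>
      obtain h | h | h : lam.type = 0 ∨ lam.type = 1 ∨ lam.type = 2 := by omega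
    · exact ⟨∅, by simpa using hd', by omega, by simp, by simp⟩
    · exact ⟨∅, by simpa using hd', by simp [h], by simp, by simp⟩
    · refine ⟨{0, k + d}, ?_, by simp [h], by simp, by simp [h]⟩
      rw [Finset.card_pair (by omega)]
      exact even_two.add hd'
    · refine ⟨{0}, ?_, by omega, by simp, ?_⟩
      · rw [Finset.card_singleton]; exact odd_one.add_odd hd'
      · rw [Finset.mem_singleton]; omega
    · refine ⟨{k + d}, ?_, ?_, by simp, by simp [h]⟩
      · rw [Finset.card_singleton]; exact odd_one.add_odd hd'
      · rw [Finset.mem_singleton]; omega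
    · refine ⟨{0}, ?_, by simp [h], by simp, ?_⟩
      · rw [Finset.card_singleton]; exact odd_one.add_odd hd'
      · rw [Finset.mem_singleton]; omega
  obtain ⟨S, hSdef⟩ : ∃ S : Finset ℕ, S = T ∪ Finset.Ico k (k + d) := ⟨_, rfl⟩
  have hSeven : Even S.card := by
    rw [hSdef, Finset.card_union_of_disjoint, Nat.card_Ico, show k + d - k = d by omega]
    · exact hTeven
    · rw [Finset.disjoint_left]
      intro n hn
      rw [Finset.mem_Ico]
      rcases hTd n hn with rfl | rfl <;> omega
  have hSmem : ∀ n, n ∈ S ↔ n ∈ T ∨ (k ≤ n ∧ n < k + d) := by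
    intro n; rw [hSdef, Finset.mem_union, Finset.mem_Ico]
  obtain ⟨w, hw, hwf⟩ := exists_signed_perm f hf_inj _ hf_large S hSeven
  have wneg : ∀ n : ℕ, n ∈ S → w ((n : ℤ) + 1) = -((f n : ℤ) + 1) := by
    intro n h; rw [hwf, if_pos h]; ring
  have wpos : ∀ n : ℕ, n ∉ S → w ((n : ℤ) + 1) = (f n : ℤ) + 1 := by
    intro n h; rw [hwf, if_neg h]; ring
  have wabs : ∀ n : ℕ, |w ((n : ℤ) + 1)| = (f n : ℤ) + 1 := by
    intro n
    by_cases h : n ∈ S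
    · rw [wneg n h, abs_neg, abs_of_nonneg (by omega)]
    · rw [wpos n h, abs_of_nonneg (by omega)]
  have hSsmall : ∀ n, 0 < n → n < k → n ∉ S := by
    intro n h0 h1
    rw [hSmem]
    rintro (h | h)
    · rcases hTd n h with h | h <;> omega
    · omega
  have hSlarge : ∀ i, 0 < i → k + d + i ∉ S := by
    intro i h0
    rw [hSmem]
    rintro (h | h)
    · rcases hTd _ h with h | h <;> omega
    · omega
  have hSd : k + d ∈ S → 0 < lam.type ∧ f (k + d) = 0 := by
    rw [hSmem]
    rintro (h | h)
    · have ht := hTt h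
      refine ⟨ht, ?_⟩
      have h1 := hm0.2 ht
      have h2 := hf3 0
      rw [add_zero, hy, show 0 + (k - m 0) = 0 by omega, hu0] at h2
      exact h2
    · omega
  have hf1_mono : ∀ a b, a < b → b < k → f a < f b := by
    intro a b hab hb
    rw [hf1 a (by omega), hf1 b hb]
    exact hu_mono (hx_mono a b hab)
  have hpart1 : ∀ j, j < d → lam.part (j + 1) = L.getD j 0 := by
    intro j hj
    rw [TypedPartition.part, hLM, Nat.add_sub_cancel]
    exact List.getD_append _ _ _ _ (by omega)
  have hpart2 : ∀ i, lam.part (d + i + 1) = m i := by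
    intro i
    rw [TypedPartition.part, hLM, Nat.add_sub_cancel, hm]
    rw [List.getD_append_right _ _ _ _ (by omega), show d + i - L.length = i by omega]
  refine ⟨w, hw, ⟨?_, ?_, ?_⟩, ?_, ?_, ?_, ?_⟩
  · intro h2
    have h1 := wabs 0
    have h3 := wpos 1 (hSsmall 1 (by omega) (by omega))
    have h4 := hf1_mono 0 1 (by omega) (by omega)
    norm_num at h1 h3
    omega
  · intro i hi hik
    have h1 := wpos (i - 1) (hSsmall _ (by omega) (by omega))
    have h2 := wpos i (hSsmall _ (by omega) (by omega))
    have h3 := hf1_mono (i - 1) i (by omega) (by omega)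
    rw [show ((i - 1 : ℕ) : ℤ) + 1 = i by omega] at h1
    omega
  · intro i hi
    obtain ⟨n, rfl⟩ : ∃ n, i = n + 1 := ⟨i - 1, by omega⟩
    push_cast
    rcases pos3 n with h | ⟨j, hj, rfl⟩ | ⟨i, rfl⟩
    · omega
    · have h1 := wneg (k + j) ((hSmem _).2 (Or.inr ⟨by omega, by omega⟩))
      push_cast at h1
      by_cases hj' : j + 1 < d
      · have h2 := wneg (k + (j + 1)) ((hSmem _).2 (Or.inr ⟨by omega, by omega⟩))
        have h3 := hf2' j (j + 1) (by omega) hj'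
        push_cast at h2 ⊢
        rw [h1, show (k : ℤ) + j + 1 + 1 = k + (j + 1) + 1 by ring, h2]
        omega
      · have hjd : d = j + 1 := by omega
        obtain ⟨z, hz, -, hz2⟩ := hf2 j hj
        have hzk := hLk z hz
        have h2 : -1 ≤ w (((k + d : ℕ) : ℤ) + 1) := by
          by_cases h : k + d ∈ S
          · rw [wneg _ h, (hSd h).2]; norm_num
          · rw [wpos _ h]; omega
        rw [hjd] at h2
        push_cast at h2 ⊢
        rw [show (k : ℤ) + j + 1 + 1 = k + (j + 1) + 1 by ring, h1]
        omega
    · have h1 : w (((k + d + i : ℕ) : ℤ) + 1) ≤ (f (k + d + i) : ℤ) + 1 := by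
        rw [← wabs]; exact le_abs_self _
      have h2 := wpos (k + d + (i + 1)) (hSlarge _ (by omega))
      have h3 : f (k + d + i) < f (k + d + (i + 1)) := by
        rw [hf3, hf3]; exact hu_mono (hy_mono _ _ (by omega))
      push_cast at h1 h2 ⊢
      rw [show (k : ℤ) + d + i + 1 + 1 = k + d + (i + 1) + 1 by ring, h2]
      omega
  · intro j hj hneg
    obtain ⟨n, rfl⟩ : ∃ n, j = n + 1 := ⟨j - 1, by omega⟩
    have e : ((k + (n + 1) : ℕ) : ℤ) = ((k + n : ℕ) : ℤ) + 1 := by push_cast; ring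
    rw [e] at hneg ⊢
    rw [wabs]
    have hS : k + n ∈ S := by
      by_contra h
      rw [wpos _ h] at hneg
      omega
    by_cases hn : n < d
    · obtain ⟨z, hz, hz1, hz2⟩ := hf2 n hn
      have hzk := hLk z hz
      rw [hpart1 n hn, hz1, hz2]
      omega
    · have hnd : n = d := by
        rcases (hSmem _).1 hS with h | h
        · rcases hTd _ h with h | h <;> omega
        · omega
      subst hnd
      obtain ⟨ht, hf0⟩ := hSd hS
      have h1 := hpart2 0
      rw [add_zero] at h1
      have h2 := hm0.2 ht
      have h3 := hm_le 0
      rw [h1, hf0]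
      push_cast
      omega
  · intro j hj hposj
    obtain ⟨n, rfl⟩ : ∃ n, j = n + 1 := ⟨j - 1, by omega⟩
    have e : ((k + (n + 1) : ℕ) : ℤ) = ((k + n : ℕ) : ℤ) + 1 := by push_cast; ring
    rw [e] at hposj ⊢
    have hS : k + n ∉ S := by
      intro h
      rw [wneg _ h] at hposj
      omega
    have hn : d ≤ n := by
      by_contra h
      exact hS ((hSmem _).2 (Or.inr ⟨by omega, by omega⟩))
    obtain ⟨i, rfl⟩ : ∃ i, n = d + i := ⟨n - d, by omega⟩
    rw [wpos _ hS, hpart2, ← add_assoc k d i, hf3]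
    have : (Finset.Icc 1 k).filter (fun p : ℕ => ((u (y i) : ℕ) : ℤ) + 1 < |w p|)
        = Finset.Icc (k + 1 - m i) k := by
      ext p
      rw [Finset.mem_filter, Finset.mem_Icc, Finset.mem_Icc]
      have hmi := hm_le i
      constructor
      · rintro ⟨⟨hp1, hp2⟩, h⟩
        have hwp := wabs (p - 1)
        rw [show ((p - 1 : ℕ) : ℤ) + 1 = p by omega, hf1 _ (by omega)] at hwp
        rw [hwp] at h
        have h' : u (y i) < u (x (p - 1)) := by omega
        rw [hu_mono.lt_iff_lt] at h'
        refine ⟨?_, hp2⟩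
        by_contra hcon
        have := (hxy (p - 1) i (by omega)).2 (by omega)
        omega
      · rintro ⟨hp1, hp2⟩
        refine ⟨⟨by omega, hp2⟩, ?_⟩
        have hwp := wabs (p - 1)
        rw [show ((p - 1 : ℕ) : ℤ) + 1 = p by omega, hf1 _ (by omega)] at hwp
        rw [hwp]
        have := hu_mono ((hxy (p - 1) i (by omega)).1 (by omega))
        omega
    rw [this, Nat.card_Icc]
    have hmi := hm_le i
    omega
  · have h1 := wabs 0
    rw [hf1 0 hk] at h1
    norm_num at h1
    rw [h1]
    constructor
    · intro ht
      have h2 : 0 < x 0 := by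
        by_contra h
        exact (hx0.1 (by omega)) ht
      have := hu_mono h2
      omega
    · intro h
      by_contra ht
      rw [hx0.2 ht, hu0] at h
      norm_num at h
  · intro ht
    have h2 := lam.type_le
    have h3 : 0 ∈ S ↔ lam.type = 2 := by
      rw [hSmem, ← hT0 ht]
      constructor
      · rintro (h | h)
        · exact h
        · omega
      · exact Or.inl
    by_cases h : lam.type = 2
    · have h4 := wneg 0 (h3.2 h)
      norm_num at h4
      rw [if_neg (by omega), h]
    · have h4 := wpos 0 (fun hh => h (h3.1 hh))
      norm_num at h4
      rw [if_pos (by omega)]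
      omega

/-- The `k`-Grassmannian element `w_λ` corresponding to the typed `k`-strict partition `λ`. -/
noncomputable def TypedPartition.weyl {k : ℕ} [NeZero k] (lam : TypedPartition k) :
    Equiv.Perm ℤ :=
  (exists_corresponds lam).choose

theorem TypedPartition.corresponds_weyl {k : ℕ} [NeZero k] (lam : TypedPartition k) :
    Corresponds lam lam.weyl :=
  (exists_corresponds lam).choose_spec

/-! ### The rings -/

/-- The variables `b̃_k` and `b_1, b_2, …`; the constructor `b n` stands for `b_{n+1}`. -/
inductive Gen : Type
  | bTilde : Gen
  | b (n : ℕ) : Gen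

/-- `R[b]`. -/
abbrev PolyB (R : Type) [CommRing R] := MvPolynomial Gen R

/-- `R[b, t]`, as polynomials in `t_1, t_2, …` over `R[b]`; the variable with index `n : ℕ` is
`t_{n+1}`. -/
abbrev PolyBT (R : Type) [CommRing R] := MvPolynomial ℕ (PolyB R)

section Polynomials

variable (R : Type) [CommRing R]

/-- `b_p` for `p ∈ ℤ`, with `b_0 = 1` and `b_p = 0` for `p < 0`. -/
noncomputable def bPoly : ℤ → PolyB R
  | Int.ofNat 0 => 1
  | Int.ofNat (n + 1) => MvPolynomial.X (Gen.b n)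
  | Int.negSucc _ => 0

/-- `b̃_k`. -/
noncomputable def bTildePoly : PolyB R := MvPolynomial.X Gen.bTilde

/-- `c_p` for `p ∈ ℤ`. -/
noncomputable def cPoly (k : ℕ) (p : ℤ) : PolyB R :=
  if p < k then bPoly R p
  else if p = k then bPoly R k + bTildePoly R
  else 2 * bPoly R p

/-- `t_i` for `i ≥ 1`. -/
noncomputable def tVar (i : ℕ) : PolyBT R := MvPolynomial.X (i - 1)

/-- `e_j(-t_1, …, -t_r)` for `r ≥ 0`. -/
noncomputable def eNeg (r j : ℕ) : PolyBT R :=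
  MvPolynomial.aeval (fun a : Fin r => -tVar R ((a : ℕ) + 1)) (MvPolynomial.esymm (Fin r) R j)

/-- `h^r_j(-t)` for `r ∈ ℤ`: the complete symmetric polynomial in `-t_1, …, -t_r` if `r ≥ 0`, the
elementary symmetric polynomial in `-t_1, …, -t_{-r}` if `r < 0`. -/
noncomputable def hNeg (r : ℤ) (j : ℕ) : PolyBT R :=
  if 0 ≤ r then
    MvPolynomial.aeval (fun a : Fin r.toNat => -tVar R ((a : ℕ) + 1))
      (MvPolynomial.hsymm (Fin r.toNat) R j)
  else eNeg R (-r).toNat j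

/-- `c^r_p = ∑_{j=0}^p c_{p-j} h^r_j(-t)`. -/
noncomputable def cUp (k : ℕ) (r p : ℤ) : PolyBT R :=
  ∑ j ∈ Finset.range (p + 1).toNat, MvPolynomial.C (cPoly R k (p - j)) * hNeg R r j

/-- `∑_{j=1}^p c_{p-j} h^s_j(-t)`. -/
noncomputable def cTail (k : ℕ) (s p : ℤ) : PolyBT R :=
  ∑ j ∈ Finset.Icc 1 p.toNat, MvPolynomial.C (cPoly R k (p - j)) * hNeg R s j

/-- `b^s_k`. -/
noncomputable def bUp (k : ℕ) (s : ℤ) : PolyBT R :=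
  MvPolynomial.C (bPoly R k) + cTail R k s k

/-- `b̃^s_k`. -/
noncomputable def bTildeUp (k : ℕ) (s : ℤ) : PolyBT R :=
  MvPolynomial.C (bTildePoly R) + cTail R k s k

/-- The `i`-th factor `ĉ_p^r` of a monomial `ĉ_α^ρ`; it depends on the parity of `i`. -/
noncomputable def cHat (k i : ℕ) (r p : ℤ) : PolyBT R :=
  cUp R k r p +
    if r = k - p ∧ r < 0 then
      MvPolynomial.C (2 * (if Odd i then bTildePoly R else bPoly R k) - cPoly R k k) *
        eNeg R (p - k).toNat (p - k).toNat
    else 0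

end Polynomials

/-- `a^s_p = (1/2) c_p + ∑_{j=1}^p c_{p-j} h^s_j(-t)`. -/
noncomputable def aUp (k : ℕ) (s p : ℤ) : PolyBT ℚ :=
  MvPolynomial.C (MvPolynomial.C (1 / 2) * cPoly ℚ k p) + cTail ℚ k s p

/-- The left hand side of the quadratic relation
`b_k b̃_k + ∑_{i=1}^k (-1)^i b_{k+i} b_{k-i} = 0`. -/
noncomputable def relMiddle (k : ℕ) : PolyB ℤ :=
  bPoly ℤ k * bTildePoly ℤ +
    ∑ i ∈ Finset.Icc 1 k, (-1) ^ i * (bPoly ℤ (k + i) * bPoly ℤ (k - i))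

/-- The left hand side of the relation `b_p b_p + ∑_{i=1}^p (-1)^i b_{p+i} c_{p-i} = 0`. -/
noncomputable def relLarge (k p : ℕ) : PolyB ℤ :=
  bPoly ℤ p * bPoly ℤ p +
    ∑ i ∈ Finset.Icc 1 p, (-1) ^ i * (bPoly ℤ (p + i) * cPoly ℤ k (p - i))

/-- The ideal `J^{(k)}` of `ℤ[b]`. -/
noncomputable def idealJ (k : ℕ) : Ideal (PolyB ℤ) :=
  Ideal.span ({x | ∃ p : ℕ, k < p ∧ x = relLarge k p} ∪ {relMiddle k})

/-- `B^{(k)} = ℤ[b] / J^{(k)}`. -/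
abbrev RingB (k : ℕ) := PolyB ℤ ⧸ idealJ k

/-- The quotient map `ℤ[b, t] → B^{(k)}[t]`. -/
noncomputable def toRingBT (k : ℕ) : PolyBT ℤ →+* MvPolynomial ℕ (RingB k) :=
  MvPolynomial.map (Ideal.Quotient.mk (idealJ k))

/-- The inclusion `ℤ[b, t] → ℚ[b, t]`. -/
noncomputable def toRat : PolyBT ℤ →+* PolyBT ℚ :=
  MvPolynomial.map (MvPolynomial.map (Int.castRingHom ℚ))

/-! ### Simple reflections and divided differences on `ℤ[b, t]` -/

/-- The images of the variables `b̃_k, b_1, b_2, …` under `s_0`. -/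
noncomputable def s0Gen (k : ℕ) : Gen → PolyBT ℤ
  | Gen.bTilde =>
      MvPolynomial.C (bTildePoly ℤ) - (tVar ℤ 1 + tVar ℤ 2) * cUp ℤ k 2 (k - 1)
  | Gen.b n =>
      MvPolynomial.C (MvPolynomial.X (Gen.b n)) -
        (if n + 1 < k then 2 else 1) * ((tVar ℤ 1 + tVar ℤ 2) * cUp ℤ k 2 n)

/-- The images of the variables `t_1, t_2, …` under `s_0`. -/
noncomputable def s0T : ℕ → PolyBT ℤ
  | 0 => -tVar ℤ 2
  | 1 => -tVar ℤ 1
  | n + 2 => MvPolynomial.X (n + 2)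

/-- The action of the simple reflection `s_i` on `ℤ[b, t]`. -/
noncomputable def reflect (k : ℕ) : ℕ → (PolyBT ℤ →+* PolyBT ℤ)
  | 0 => MvPolynomial.eval₂Hom (MvPolynomial.eval₂Hom (Int.castRingHom (PolyBT ℤ)) (s0Gen k)) s0T
  | i + 1 => (MvPolynomial.rename (Equiv.swap i (i + 1))).toRingHom

/-- The denominator of `∂_i`: `t_1 + t_2` for `i = 0` and `t_{i+1} - t_i` for `i ≥ 1`. -/
noncomputable def denom (i : ℕ) : PolyBT ℤ :=
  if i = 0 then tVar ℤ 1 + tVar ℤ 2 else tVar ℤ (i + 1) - tVar ℤ i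

theorem denom_dvd (k i : ℕ) (f : PolyBT ℤ) : denom i ∣ f - reflect k i f := by
  have hmul : ∀ p q : PolyBT ℤ, denom i ∣ p - reflect k i p → denom i ∣ q - reflect k i q →
      denom i ∣ p * q - reflect k i (p * q) := by
    intro p q hp hq
    rw [map_mul, show p * q - reflect k i p * reflect k i q
      = (p - reflect k i p) * q + reflect k i p * (q - reflect k i q) by ring]
    exact dvd_add (hp.mul_right _) (hq.mul_left _)
  have hadd : ∀ p q : PolyBT ℤ, denom i ∣ p - reflect k i p → denom i ∣ q - reflect k i q →
      denom i ∣ p + q - reflect k i (p + q) := by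
    intro p q hp hq
    rw [map_add, show p + q - (reflect k i p + reflect k i q)
      = (p - reflect k i p) + (q - reflect k i q) by ring]
    exact dvd_add hp hq
  induction f using MvPolynomial.induction_on with
  | C a =>
    cases i with
    | succ i => simp [reflect]
    | zero =>
      induction a using MvPolynomial.induction_on with
      | C z => simp [reflect]
      | add p q hp hq => rw [map_add]; exact hadd _ _ hp hq
      | mul_X p v hp =>
        rw [map_mul]
        refine hmul _ _ hp ?_
        cases v with
        | bTilde => simp [reflect, s0Gen, denom, bTildePoly]
        | b n =>
          simp only [reflect, s0Gen, denom, MvPolynomial.coe_eval₂Hom, MvPolynomial.eval₂_C,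
            MvPolynomial.eval₂_X, sub_sub_cancel, if_true]
          exact (dvd_mul_right _ _).mul_left _
  | add p q hp hq => exact hadd p q hp hq
  | mul_X p n hp =>
    refine hmul _ _ hp ?_
    cases i with
    | zero =>
      match n with
      | 0 => simp [reflect, s0T, denom, tVar]
      | 1 => simp [reflect, s0T, denom, tVar, add_comm]
      | n + 2 => simp [reflect, s0T]
    | succ i =>
      simp only [reflect, denom, tVar, AlgHom.toRingHom_eq_coe, RingHom.coe_coe,
        MvPolynomial.rename_X, Nat.add_eq_zero_iff, one_ne_zero, and_false, if_false,
        Nat.add_sub_cancel]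
      by_cases h1 : n = i
      · subst h1
        rw [Equiv.swap_apply_left]
        exact ⟨-1, by ring⟩
      · by_cases h2 : n = i + 1
        · subst h2
          rw [Equiv.swap_apply_right]
        · rw [Equiv.swap_apply_of_ne_of_ne h1 h2, sub_self]
          exact dvd_zero _

/-- The divided difference `∂_i f = (f - s_i f) / (t_{i+1} - t_i)` for `i ≥ 1`, and
`∂_0 f = (f - s_0 f) / (t_1 + t_2)`. -/
noncomputable def dividedDiff (k i : ℕ) (f : PolyBT ℤ) : PolyBT ℤ := (denom_dvd k i f).choose

theorem denom_mul_dividedDiff (k i : ℕ) (f : PolyBT ℤ) :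
    denom i * dividedDiff k i f = f - reflect k i f :=
  (denom_dvd k i f).choose_spec.symm

/-! ### Double eta polynomials -/

namespace TypedPartition

variable {k : ℕ} [NeZero k] (lam : TypedPartition k)

/-- `(i, j) ∈ C(λ)`, for `1 ≤ i < j`. -/
def InC (i j : ℕ) : Prop := lam.weyl (k + i : ℕ) + lam.weyl (k + j : ℕ) < 0

/-- `β_j(λ)`, for `j ≥ 1`. -/
noncomputable def beta (j : ℕ) : ℤ :=
  if lam.weyl (k + j : ℕ) < 0 then lam.weyl (k + j : ℕ) + 1 else lam.weyl (k + j : ℕ)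

/-- The pairs `(i, j)` with `1 ≤ i < j ≤ ℓ(λ)`. -/
def pairs : Finset (ℕ × ℕ) :=
  (Finset.Icc 1 lam.length ×ˢ Finset.Icc 1 lam.length).filter (fun p => p.1 < p.2)

open Classical in
/-- The coefficient of `∏ R_{ij}^{n_{ij}}` in the power series
`∏_{i<j} (1 - R_{ij}) ∏_{(i,j) ∈ C(λ)} (1 + R_{ij})⁻¹`. -/
noncomputable def raisingCoeff (n : ℕ × ℕ →₀ ℕ) : ℚ :=
  ∏ p ∈ lam.pairs, PowerSeries.coeff (n p)
    (if lam.InC p.1 p.2 then (1 - PowerSeries.X) * (1 + PowerSeries.X)⁻¹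
      else 1 - PowerSeries.X : PowerSeries ℚ)

/-- The `i`-th entry of `R λ`, where `R = ∏ R_{ij}^{n_{ij}}`. -/
def raised (n : ℕ × ℕ →₀ ℕ) (i : ℕ) : ℤ :=
  lam.part i + ∑ j ∈ Finset.Icc 1 lam.length, ((n (i, j) : ℤ) - n (j, i))

/-- `m = ℓ_k(λ) + 1`. -/
def mid : ℕ := lam.numLarge + 1

/-- `i ∈ supp_m(R)`, where `R = ∏ R_{ij}^{n_{ij}}`. -/
def InSupp (n : ℕ × ℕ →₀ ℕ) (i : ℕ) : Prop :=
  ∃ p : ℕ × ℕ, 0 < n p ∧ p.2 < lam.mid ∧ (i = p.1 ∨ i = p.2)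

/-- `R = ∏ R_{ij}^{n_{ij}}` involves a factor `R_{ij}` with `i = m` or `j = m`. -/
def InvolvesMid (n : ℕ × ℕ →₀ ℕ) : Prop :=
  ∃ p : ℕ × ℕ, 0 < n p ∧ (p.1 = lam.mid ∨ p.2 = lam.mid)

open Classical in
/-- The factor `c̄_{ν_i}^{β_i}`, where `ν = R λ`. -/
noncomputable def cBar (n : ℕ × ℕ →₀ ℕ) (i : ℕ) : PolyBT ℚ :=
  if lam.InSupp n i then cUp ℚ k (lam.beta i) (lam.raised n i)
  else cHat ℚ k i (lam.beta i) (lam.raised n i)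

open Classical in
/-- The `i`-th factor of `R ⋆ ĉ^β_λ`. -/
noncomputable def starFactor (n : ℕ × ℕ →₀ ℕ) (i : ℕ) : PolyBT ℚ :=
  if lam.type = 0 ∨ i < lam.mid then lam.cBar n i
  else if i = lam.mid then
    if lam.InvolvesMid n then aUp k (lam.beta i) (lam.raised n i)
    else if lam.type = 1 then bUp ℚ k (lam.beta i)
    else bTildeUp ℚ k (lam.beta i)
  else cUp ℚ k (lam.beta i) (lam.raised n i)

/-- `R ⋆ ĉ^β_λ`, where `R = ∏ R_{ij}^{n_{ij}}`. -/
noncomputable def star (n : ℕ × ℕ →₀ ℕ) : PolyBT ℚ :=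
  ∏ i ∈ Finset.Icc 1 lam.length, lam.starFactor n i

/-- The double eta polynomial `H_λ(c | t) = 2^{-ℓ_k(λ)} R^λ ⋆ ĉ^{β(λ)}_λ`, a sum over the raising
operators `R = ∏ R_{ij}^{n_{ij}}` with `1 ≤ i < j ≤ ℓ(λ)`, of which only finitely many contribute.
(Raising operators involving some `R_{ij}` with `j > ℓ(λ)` contribute zero, as they produce a
negative last nonzero entry.) -/
noncomputable def doubleEta : PolyBT ℚ :=
  ∑ᶠ (n : ℕ × ℕ →₀ ℕ) (_ : n.support ⊆ lam.pairs),
    MvPolynomial.C (MvPolynomial.C ((2 : ℚ)⁻¹ ^ lam.numLarge * lam.raisingCoeff n)) * lam.star n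

end TypedPartition

end DoubleEta

/-!
The double eta polynomial `H_λ` is a coefficient of a generating series, and the divided difference
of that series is computed factor by factor.

Let `u_i = y_1 ⋯ y_i`. On the coefficients of `∏ u_i^{λ_i}` the raising operator `R_{ij}` acts as
multiplication by `u_j / u_i = y_{i+1} ⋯ y_j`, so `∏ (1 - R_{ij}) ∏ (1 + R_{ij})⁻¹` becomes a product
of power series in monomials. After the power `2^{-ℓ_k(λ)}` is distributed over the factors, the
factor in row `i` depends only on the entry `v_i = w_{k+i}` and the parity of `i`: it is a coefficient
of `entrySer`, plus a term `entryCorr` for those raising operators which do not involve `i`. Sorting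
the raising operators by the rows which carry the correction gives a sum over subsets of rows,
`etaSer`, and `H_λ` is one coefficient of it (`doubleEta_eq_coeff`).

Let `w_λ = s_i w_μ` with one box added. Then `s_i` moves one of the entries `v_j`, or two of them
(`reflection_cases`).

* If it moves one entry, only one factor of the series changes, and its divided difference is the
  corresponding factor for `μ`, shifted by one degree (`EntryStep`).
* If it moves two entries and `i ≥ 2`, the factors in both rows change, and so does the pair factor
  which joins them; an identity of polynomials in these factors gives the claim
  (`pair_step_identity`).
* If it moves two entries and `i ≤ 1`, the same calculation leaves a deviation: `∂_i H_λ` is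
  `H_μ + excess` (`doubleEta_step`).

The deviation is a sum over subsets of the other rows. Its terms linear in the correction cancel.
The term without correction is `(1 - z) / (1 + z)`, with `z = u_{p+1} / u_p`, times two factors which
are substitutions (`twist`) of a single series `g`. Since the coefficients of `(1 - z) / (1 + z)` at
opposite exponents add up to `± 2`, symmetrization replaces the product by `g` times the same series
with two variables negated (`coeff_cayley_mul_twist`). There the pair factors of the preceding rows
cancel, and there remain the coefficients of `c(X) c(-X)`, where `c(X) = ∑ c_p X^p`; the following
rows contribute only together with those of degree greater than `2k`. The latter lie in `J^{(k)}`;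
the one of degree `2k` is `± (d² + 4 ρ_k)`, with `d = b̃_k - b_k`, and its part `d²` cancels against
the term quadratic in the correction. Hence the deviation vanishes in `B^{(k)}[t]`
(`map_excess_eq_zero`), and for `λ = (k+1, k)` it is `-ρ_k` (`excess_one_two`).

These calculations take place over `ℚ`. They imply the statement in `B^{(k)}[t]` because each
generator of `J^{(k)}` can be solved for one variable `b_{2p}` with `p ≥ k`, over the integers
(`elimHom`): after this elimination an equality can be tested in a polynomial ring
(`toRingBT_eq_of_elimRat`). The polynomials `H_λ` are integral because `R_{ij}` occurs only with even
coefficients if `(i, j) ∈ C(λ)`, and these compensate the halves in the rows which are lowered; in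
the other rows the halves are compensated by the correction, or by `c_p = 2 b_p` for `p > k`
(`exists_toRat_eq_doubleEta`).
-/

namespace DoubleEta

/-! ### Products over pairs and sums over subsets -/

section Pairs

variable {M : Type*} [CommRing M]

/-- The product of `F x y` over the pairs `x < y` of elements of `T`. -/
def pairProd (F : ℕ → ℕ → M) (T : Finset ℕ) : M :=
  ∏ x ∈ T, ∏ y ∈ T, if x < y then F x y else 1

/-- The product of the pair factors which join `p` to the elements of `T`. -/
def linkProd (F : ℕ → ℕ → M) (p : ℕ) (T : Finset ℕ) : M :=
  ∏ j ∈ T, F (min p j) (max p j)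

theorem pairProd_insert (F : ℕ → ℕ → M) {p : ℕ} {T : Finset ℕ} (hp : p ∉ T) :
    pairProd F (insert p T) = linkProd F p T * pairProd F T := by
  unfold pairProd linkProd
  rw [Finset.prod_insert hp, Finset.prod_insert hp]
  simp only [lt_self_iff_false, if_false, one_mul]
  rw [Finset.prod_congr rfl (fun x (_ : x ∈ T) => Finset.prod_insert (s := T) hp),
    Finset.prod_mul_distrib, ← mul_assoc, ← Finset.prod_mul_distrib]
  congr 1
  refine Finset.prod_congr rfl fun j hj => ?_
  have hne : p ≠ j := fun h => hp (h ▸ hj)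
  rcases lt_or_gt_of_ne hne with h | h
  · rw [if_pos h, if_neg (by omega), mul_one, min_eq_left h.le, max_eq_right h.le]
  · rw [if_neg (by omega), if_pos h, one_mul, min_eq_right h.le, max_eq_left h.le]

/-- The contribution of a subset `T` of the positions `I`: the positions outside `T` carry their
correction term `κ`, those in `T` their series `g`, and the pair factors are those within `T`. -/
def subsetTerm (I : Finset ℕ) (κ g : ℕ → M) (F : ℕ → ℕ → M) (T : Finset ℕ) : M :=
  (∏ i ∈ I \ T, κ i) * (∏ i ∈ T, g i) * pairProd F T

/-- The sum of the contributions of all subsets of `I`. -/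
def subsetSum (I : Finset ℕ) (κ g : ℕ → M) (F : ℕ → ℕ → M) : M :=
  ∑ T ∈ I.powerset, subsetTerm I κ g F T

theorem subsetTerm_insert_left (κ g : ℕ → M) (F : ℕ → ℕ → M) {p : ℕ} {I T : Finset ℕ}
    (hp : p ∉ I) (hT : T ⊆ I) :
    subsetTerm (insert p I) κ g F T = κ p * subsetTerm I κ g F T := by
  unfold subsetTerm
  rw [Finset.insert_sdiff_of_notMem _ (fun h => hp (hT h)),
    Finset.prod_insert (fun h => hp (Finset.mem_sdiff.1 h).1)]
  ring

theorem subsetTerm_insert_both (κ g : ℕ → M) (F : ℕ → ℕ → M) {p : ℕ} {I T : Finset ℕ}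
    (hp : p ∉ I) (hT : T ⊆ I) :
    subsetTerm (insert p I) κ g F (insert p T)
      = g p * linkProd F p T * subsetTerm I κ g F T := by
  unfold subsetTerm
  have hpT : p ∉ T := fun h => hp (hT h)
  rw [pairProd_insert F hpT, Finset.prod_insert hpT, Finset.insert_sdiff_insert,
    Finset.sdiff_insert_of_notMem hp]
  ring

theorem subsetSum_insert (κ g : ℕ → M) (F : ℕ → ℕ → M) {p : ℕ} {I : Finset ℕ} (hp : p ∉ I) :
    subsetSum (insert p I) κ g F
      = ∑ T ∈ I.powerset, subsetTerm I κ g F T * (κ p + g p * linkProd F p T) := by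
  unfold subsetSum
  rw [Finset.sum_powerset_insert hp, ← Finset.sum_add_distrib]
  refine Finset.sum_congr rfl fun T hT => ?_
  rw [Finset.mem_powerset] at hT
  rw [subsetTerm_insert_left κ g F hp hT, subsetTerm_insert_both κ g F hp hT]
  ring

theorem linkProd_insert (F : ℕ → ℕ → M) (p : ℕ) {q : ℕ} {T : Finset ℕ} (hq : q ∉ T) :
    linkProd F p (insert q T) = F (min p q) (max p q) * linkProd F p T :=
  Finset.prod_insert hq

theorem subsetSum_insert_insert (κ g : ℕ → M) (F : ℕ → ℕ → M) {p q : ℕ} {I : Finset ℕ}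
    (hpq : p < q) (hp : p ∉ I) (hq : q ∉ I) :
    subsetSum (insert p (insert q I)) κ g F
      = ∑ T ∈ I.powerset, subsetTerm I κ g F T *
          (κ p * κ q + κ p * g q * linkProd F q T + κ q * g p * linkProd F p T
            + g p * g q * linkProd F p T * linkProd F q T * F p q) := by
  have hp' : p ∉ insert q I := by
    rw [Finset.mem_insert]
    rintro (h | h)
    · omega
    · exact hp h
  rw [subsetSum_insert κ g F hp', Finset.sum_powerset_insert hq, ← Finset.sum_add_distrib]
  refine Finset.sum_congr rfl fun T hT => ?_
  rw [Finset.mem_powerset] at hT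
  rw [subsetTerm_insert_left κ g F hq hT, subsetTerm_insert_both κ g F hq hT,
    linkProd_insert F p (fun h => hq (hT h)), min_eq_left hpq.le, max_eq_right hpq.le]
  ring

theorem subsetTerm_congr {κ κ' g g' : ℕ → M} {F F' : ℕ → ℕ → M} {I T : Finset ℕ} (hT : T ⊆ I)
    (hκ : ∀ i ∈ I, κ i = κ' i) (hg : ∀ i ∈ I, g i = g' i)
    (hF : ∀ i ∈ I, ∀ j ∈ I, i < j → F i j = F' i j) :
    subsetTerm I κ g F T = subsetTerm I κ' g' F' T := by
  unfold subsetTerm pairProd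
  congr 1
  · congr 1
    · exact Finset.prod_congr rfl fun i hi => hκ i (Finset.mem_sdiff.1 hi).1
    · exact Finset.prod_congr rfl fun i hi => hg i (hT hi)
  · refine Finset.prod_congr rfl fun i hi => Finset.prod_congr rfl fun j hj => ?_
    split_ifs with h
    · exact hF i (hT hi) j (hT hj) h
    · rfl

theorem linkProd_congr {F F' : ℕ → ℕ → M} {p : ℕ} {T : Finset ℕ}
    (hF : ∀ j ∈ T, F (min p j) (max p j) = F' (min p j) (max p j)) :
    linkProd F p T = linkProd F' p T :=
  Finset.prod_congr rfl hF

theorem map_pairProd {N : Type*} [CommRing N] (φ : M →+* N) (F : ℕ → ℕ → M) (T : Finset ℕ) :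
    φ (pairProd F T) = pairProd (fun i j => φ (F i j)) T := by
  simp only [pairProd, map_prod, apply_ite φ, map_one]

theorem map_linkProd {N : Type*} [CommRing N] (φ : M →+* N) (F : ℕ → ℕ → M) (p : ℕ)
    (T : Finset ℕ) : φ (linkProd F p T) = linkProd (fun i j => φ (F i j)) p T := by
  simp only [linkProd, map_prod]

theorem map_subsetTerm {N : Type*} [CommRing N] (φ : M →+* N) (κ g : ℕ → M) (F : ℕ → ℕ → M)
    (I T : Finset ℕ) : φ (subsetTerm I κ g F T)
      = subsetTerm I (fun i => φ (κ i)) (fun i => φ (g i)) (fun i j => φ (F i j)) T := by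
  simp only [subsetTerm, map_mul, map_prod, map_pairProd]

end Pairs

/-! ### Evaluation of power series at monomials -/

/-- The exponent of `y_{i+1} ⋯ y_j`. -/
noncomputable def wt (i j : ℕ) : ℕ →₀ ℕ := ∑ a ∈ Finset.Ioc i j, Finsupp.single a 1

theorem wt_apply (i j a : ℕ) : wt i j a = if i < a ∧ a ≤ j then 1 else 0 := by
  simp [wt, Finsupp.finsetSum_apply, Finsupp.single_apply, Finset.sum_ite_eq', Finset.mem_Ioc]

theorem wt_ne_zero {i j : ℕ} (h : i < j) : wt i j ≠ 0 := by
  intro h0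
  have := DFunLike.congr_fun h0 j
  rw [wt_apply, if_pos ⟨h, le_rfl⟩] at this
  simp at this

theorem wt_add {i j l : ℕ} (h : i ≤ j) (h' : j ≤ l) : wt i j + wt j l = wt i l := by
  ext a
  simp only [Finsupp.add_apply, wt_apply]
  split_ifs <;> omega

section Eval

variable {A : Type*} [CommRing A]

/-- The series `f(y^e)`, for a nonzero exponent `e`. -/
noncomputable def evMono (e : ℕ →₀ ℕ) (f : PowerSeries A) : MvPowerSeries ℕ A :=
  f.subst (MvPowerSeries.monomial e (1 : A))

variable {e : ℕ →₀ ℕ}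

theorem evMono_one (he : e ≠ 0) : evMono e (1 : PowerSeries A) = 1 := by
  rw [evMono, ← PowerSeries.coe_substAlgHom (PowerSeries.HasSubst.monomial he 1), map_one]

theorem evMono_mul (he : e ≠ 0) (f g : PowerSeries A) :
    evMono e (f * g) = evMono e f * evMono e g :=
  PowerSeries.subst_mul (PowerSeries.HasSubst.monomial he 1) f g

theorem evMono_add (he : e ≠ 0) (f g : PowerSeries A) :
    evMono e (f + g) = evMono e f + evMono e g :=
  PowerSeries.subst_add (PowerSeries.HasSubst.monomial he 1) f g

theorem evMono_sub (he : e ≠ 0) (f g : PowerSeries A) :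
    evMono e (f - g) = evMono e f - evMono e g :=
  PowerSeries.subst_sub (PowerSeries.HasSubst.monomial he 1) f g

theorem evMono_X (he : e ≠ 0) :
    evMono e (PowerSeries.X : PowerSeries A) = MvPowerSeries.monomial e 1 :=
  PowerSeries.subst_X (PowerSeries.HasSubst.monomial he 1)

theorem evMono_C (a : A) : evMono e (PowerSeries.C a) = MvPowerSeries.C a :=
  PowerSeries.subst_C _

theorem evMono_prod (he : e ≠ 0) {ι : Type*} (s : Finset ι) (f : ι → PowerSeries A) :
    evMono e (∏ i ∈ s, f i) = ∏ i ∈ s, evMono e (f i) := by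
  simp only [evMono, ← PowerSeries.coe_substAlgHom (PowerSeries.HasSubst.monomial he (1 : A)),
    map_prod]

theorem map_evMono {B : Type*} [CommRing B] (h : A →+* B) (he : e ≠ 0) (f : PowerSeries A) :
    MvPowerSeries.map h (evMono e f) = evMono e (PowerSeries.map h f) := by
  rw [evMono, PowerSeries.map_subst (PowerSeries.HasSubst.monomial he 1),
    MvPowerSeries.map_monomial, map_one, evMono]

theorem monomial_one_pow (e : ℕ →₀ ℕ) (n : ℕ) :
    (MvPowerSeries.monomial e (1 : A)) ^ n = MvPowerSeries.monomial (n • e) 1 := by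
  rw [MvPowerSeries.monomial_pow, one_pow]

theorem smul_exponent_injective (he : e ≠ 0) {m n : ℕ} (h : m • e = n • e) : m = n := by
  obtain ⟨a, ha⟩ := Finsupp.ne_iff.1 he
  have := DFunLike.congr_fun h a
  rw [Finsupp.smul_apply, Finsupp.smul_apply, smul_eq_mul, smul_eq_mul] at this
  exact Nat.eq_of_mul_eq_mul_right (Nat.pos_of_ne_zero ha) this

theorem coeff_evMono_smul (he : e ≠ 0) (f : PowerSeries A) (n : ℕ) :
    MvPowerSeries.coeff (n • e) (evMono e f) = PowerSeries.coeff n f := by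
  classical
  rw [evMono, PowerSeries.coeff_subst (PowerSeries.HasSubst.monomial he 1)]
  rw [finsum_eq_single _ n]
  · rw [monomial_one_pow, MvPowerSeries.coeff_monomial_same, smul_eq_mul, mul_one]
  · intro d hd
    rw [monomial_one_pow, MvPowerSeries.coeff_monomial_ne, smul_zero]
    intro h
    exact hd (smul_exponent_injective he h).symm

theorem coeff_evMono_of_forall_ne (he : e ≠ 0) (f : PowerSeries A) {m : ℕ →₀ ℕ}
    (h : ∀ n : ℕ, m ≠ n • e) : MvPowerSeries.coeff m (evMono e f) = 0 := by
  rw [evMono, PowerSeries.coeff_subst (PowerSeries.HasSubst.monomial he 1)]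
  refine finsum_eq_zero_of_forall_eq_zero fun d => ?_
  rw [monomial_one_pow, MvPowerSeries.coeff_monomial_ne (h d), smul_zero]

/-- Agreement of all coefficients whose exponents divide `y^τ`. -/
def EqUpTo (τ : ℕ →₀ ℕ) (f g : MvPowerSeries ℕ A) : Prop :=
  ∀ m ≤ τ, MvPowerSeries.coeff m f = MvPowerSeries.coeff m g

theorem EqUpTo.refl (τ : ℕ →₀ ℕ) (f : MvPowerSeries ℕ A) : EqUpTo τ f f := fun _ _ => rfl

theorem EqUpTo.mul {τ : ℕ →₀ ℕ} {f f' g g' : MvPowerSeries ℕ A} (hf : EqUpTo τ f f')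
    (hg : EqUpTo τ g g') : EqUpTo τ (f * g) (f' * g') := by
  classical
  intro m hm
  rw [MvPowerSeries.coeff_mul, MvPowerSeries.coeff_mul]
  refine Finset.sum_congr rfl fun x hx => ?_
  rw [Finset.HasAntidiagonal.mem_antidiagonal] at hx
  rw [hf _ (le_trans (hx ▸ le_self_add) hm), hg _ (le_trans (hx ▸ le_add_self) hm)]

theorem EqUpTo.prod {τ : ℕ →₀ ℕ} {ι : Type*} {s : Finset ι} {f f' : ι → MvPowerSeries ℕ A}
    (h : ∀ i ∈ s, EqUpTo τ (f i) (f' i)) : EqUpTo τ (∏ i ∈ s, f i) (∏ i ∈ s, f' i) := by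
  classical
  induction s using Finset.induction_on with
  | empty => simpa using EqUpTo.refl τ 1
  | insert a s ha ih =>
    rw [Finset.prod_insert ha, Finset.prod_insert ha]
    exact (h a (Finset.mem_insert_self _ _)).mul
      (ih fun i hi => h i (Finset.mem_insert_of_mem hi))

theorem eqUpTo_evMono {τ : ℕ →₀ ℕ} {D : ℕ} (hD : ∀ a, τ a < D) (he : e ≠ 0)
    (f : PowerSeries A) : EqUpTo τ (evMono e f)
      (∑ n ∈ Finset.range D, MvPowerSeries.monomial (n • e) (PowerSeries.coeff n f)) := by
  classical
  intro m hm
  rw [map_sum]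
  by_cases h : ∃ n : ℕ, m = n • e
  · obtain ⟨n, rfl⟩ := h
    rw [coeff_evMono_smul he, Finset.sum_eq_single n]
    · rw [MvPowerSeries.coeff_monomial_same]
    · intro d _ hd
      rw [MvPowerSeries.coeff_monomial_ne]
      intro h
      exact hd (smul_exponent_injective he h).symm
    · intro hn
      exfalso
      apply hn
      obtain ⟨a, ha⟩ := Finsupp.ne_iff.1 he
      rw [Finset.mem_range]
      refine lt_of_le_of_lt ?_ (hD a)
      refine le_trans ?_ (hm a)
      rw [Finsupp.smul_apply, smul_eq_mul]
      exact Nat.le_mul_of_pos_right _ (Nat.pos_of_ne_zero ha)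
  · push Not at h
    rw [coeff_evMono_of_forall_ne he f h]
    refine (Finset.sum_eq_zero fun d _ => ?_).symm
    rw [MvPowerSeries.coeff_monomial_ne (h d)]

theorem prod_monomial {ι : Type*} (s : Finset ι) (m : ι → ℕ →₀ ℕ) (a : ι → A) :
    ∏ i ∈ s, MvPowerSeries.monomial (m i) (a i)
      = MvPowerSeries.monomial (∑ i ∈ s, m i) (∏ i ∈ s, a i) := by
  classical
  induction s using Finset.induction_on with
  | empty => simp [MvPowerSeries.monomial_zero_eq_C_apply]
  | insert b s hb ih =>
    rw [Finset.prod_insert hb, Finset.sum_insert hb, Finset.prod_insert hb, ih,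
      MvPowerSeries.monomial_mul_monomial]

/-- A product of finite sums, expanded over finitely supported choice functions. -/
theorem prod_sum_finsupp {ι M : Type*} [CommRing M] (s : Finset ι) (t : Finset ℕ)
    (g : ι → ℕ → M) :
    ∏ a ∈ s, ∑ b ∈ t, g a b = ∑ n ∈ s.finsupp (fun _ => t), ∏ a ∈ s, g a (n a) := by
  classical
  rw [Finset.prod_sum, Finset.finsupp, Finset.sum_map]
  refine Finset.sum_congr rfl fun x _ => ?_
  rw [← Finset.prod_attach s]
  refine Finset.prod_congr rfl fun i _ => ?_
  rw [Function.Embedding.coeFn_mk, Finsupp.indicator_of_mem i.2]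

theorem eqUpTo_prod_evMono {ι : Type*} {τ : ℕ →₀ ℕ} {D : ℕ} (hD : ∀ a, τ a < D) (s : Finset ι)
    (e : ι → ℕ →₀ ℕ) (he : ∀ i ∈ s, e i ≠ 0) (f : ι → PowerSeries A) :
    EqUpTo τ (∏ i ∈ s, evMono (e i) (f i))
      (∑ n ∈ s.finsupp (fun _ => Finset.range D),
        MvPowerSeries.monomial (∑ i ∈ s, n i • e i) (∏ i ∈ s, PowerSeries.coeff (n i) (f i))) := by
  have h := EqUpTo.prod (τ := τ) (s := s) (f := fun i => evMono (e i) (f i))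
    (fun i hi => eqUpTo_evMono hD (he i hi) (f i))
  rw [prod_sum_finsupp] at h
  simpa only [prod_monomial] using h

/-- The coefficient of a power series at an integer, zero for negative integers. -/
noncomputable def zcoeff (f : PowerSeries A) (z : ℤ) : A :=
  if 0 ≤ z then PowerSeries.coeff z.toNat f else 0

theorem zcoeff_natCast (f : PowerSeries A) (n : ℕ) : zcoeff f n = PowerSeries.coeff n f := by
  simp [zcoeff]

/-- A coefficient of a product of series in the independent monomials `y_1 ⋯ y_i`. -/
theorem coeff_monomial_mul_prod_evMono (L : ℕ) (E τ : ℕ →₀ ℕ) (g : ℕ → PowerSeries A) (r : ℕ → ℤ)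
    (h : ∀ a ∈ Finset.Icc 1 L, (τ a : ℤ) = E a + ∑ i ∈ Finset.Icc a L, r i)
    (h' : ∀ a ∉ Finset.Icc 1 L, τ a = E a) :
    MvPowerSeries.coeff τ (MvPowerSeries.monomial E 1 *
        ∏ i ∈ Finset.Icc 1 L, evMono (wt 0 i) (g i))
      = ∏ i ∈ Finset.Icc 1 L, zcoeff (g i) (r i) := by
  classical
  obtain ⟨D, hD⟩ : ∃ D, ∀ a, τ a < D := by
    obtain ⟨B, hB⟩ := (τ.support.image τ).bddAbove
    refine ⟨B + 1, fun a => ?_⟩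
    by_cases ha : a ∈ τ.support
    · exact Nat.lt_succ_of_le (hB (Finset.mem_coe.2 (Finset.mem_image_of_mem _ ha)))
    · rw [Finsupp.notMem_support_iff.1 ha]; omega
  have hwt : ∀ i ∈ Finset.Icc 1 L, wt 0 i ≠ 0 := fun i hi =>
    wt_ne_zero (by rw [Finset.mem_Icc] at hi; omega)
  have hu : ∀ (x : ℕ → ℕ) (a : ℕ), (∑ i ∈ Finset.Icc 1 L, x i • wt 0 i) a
      = if a ∈ Finset.Icc 1 L then ∑ i ∈ Finset.Icc a L, x i else 0 := by
    intro x a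
    rw [Finsupp.finsetSum_apply]
    simp only [Finsupp.smul_apply, wt_apply, smul_eq_mul, mul_ite, mul_one, mul_zero]
    rw [← Finset.sum_filter]
    split_ifs with ha
    · refine Finset.sum_congr ?_ fun _ _ => rfl
      ext i
      simp only [Finset.mem_filter, Finset.mem_Icc] at ha ⊢
      omega
    · refine Finset.sum_eq_zero fun i hi => ?_
      simp only [Finset.mem_filter, Finset.mem_Icc] at ha hi
      omega
  rw [((EqUpTo.refl τ (MvPowerSeries.monomial E 1)).mul
    (eqUpTo_prod_evMono hD (Finset.Icc 1 L) (wt 0) hwt g)) τ le_rfl, Finset.mul_sum, map_sum]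
  simp only [MvPowerSeries.monomial_mul_monomial, one_mul, MvPowerSeries.coeff_monomial]
  -- the exponent determines the choice function
  have key : ∀ x : ℕ → ℕ, τ = E + ∑ i ∈ Finset.Icc 1 L, x i • wt 0 i →
      ∀ i ∈ Finset.Icc 1 L, (x i : ℤ) = r i := by
    intro x hx i hi
    have h1 : ∀ a ∈ Finset.Icc 1 L,
        ∑ i ∈ Finset.Icc a L, (x i : ℤ) = ∑ i ∈ Finset.Icc a L, r i := by
      intro a ha
      have h2 := DFunLike.congr_fun hx a
      rw [Finsupp.add_apply, hu, if_pos ha] at h2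
      have h3 := h a ha
      rw [h2] at h3
      push_cast at h3
      linarith
    rw [Finset.mem_Icc] at hi
    have h2 := h1 i (Finset.mem_Icc.2 hi)
    rw [← Finset.insert_Icc_add_one_left_eq_Icc hi.2, Finset.sum_insert (by simp),
      Finset.sum_insert (by simp)] at h2
    by_cases hiL : i + 1 ≤ L
    · have h3 := h1 (i + 1) (Finset.mem_Icc.2 ⟨by omega, hiL⟩)
      linarith
    · rw [Finset.Icc_eq_empty (by omega)] at h2
      simpa using h2
  by_cases hr : ∀ i ∈ Finset.Icc 1 L, 0 ≤ r i
  · have hτ : τ = E + ∑ i ∈ Finset.Icc 1 L, (r i).toNat • wt 0 i := by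
      ext a
      rw [Finsupp.add_apply, hu]
      split_ifs with ha
      · have h3 := h a ha
        have h4 : ∑ i ∈ Finset.Icc a L, r i = ((∑ i ∈ Finset.Icc a L, (r i).toNat : ℕ) : ℤ) := by
          push_cast
          refine Finset.sum_congr rfl fun i hi => ?_
          rw [Finset.mem_Icc] at ha hi
          rw [Int.toNat_of_nonneg (hr i (Finset.mem_Icc.2 ⟨by omega, hi.2⟩))]
        rw [h4] at h3
        exact_mod_cast h3
      · rw [h' a ha, add_zero]
    have hmem : Finsupp.indicator (Finset.Icc 1 L) (fun i _ => (r i).toNat) ∈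
        (Finset.Icc 1 L).finsupp (fun _ => Finset.range D) := by
      rw [Finset.mem_finsupp_iff]
      refine ⟨Finsupp.support_indicator_subset _ _, fun i hi => ?_⟩
      rw [Finsupp.indicator_of_mem hi, Finset.mem_range]
      refine lt_of_le_of_lt ?_ (hD i)
      have := DFunLike.congr_fun hτ i
      rw [Finsupp.add_apply, hu, if_pos hi] at this
      rw [this]
      rw [Finset.mem_Icc] at hi
      exact (Finset.single_le_sum (f := fun i => (r i).toNat) (fun _ _ => Nat.zero_le _)
        (Finset.mem_Icc.2 ⟨le_rfl, hi.2⟩)).trans le_add_self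
    rw [Finset.sum_eq_single_of_mem _ hmem]
    · rw [if_pos]
      · refine Finset.prod_congr rfl fun i hi => ?_
        rw [Finsupp.indicator_of_mem hi, zcoeff, if_pos (hr i hi)]
      · rw [hτ]
        congr 1
        refine Finset.sum_congr rfl fun i hi => ?_
        rw [Finsupp.indicator_of_mem hi]
    · intro x hx hne
      rw [if_neg]
      intro hx'
      apply hne
      ext i
      by_cases hi : i ∈ Finset.Icc 1 L
      · rw [Finsupp.indicator_of_mem hi]
        have := key x hx' i hi
        omega
      · rw [Finsupp.indicator_of_notMem hi]
        exact Finsupp.notMem_support_iff.1 fun hh => hi ((Finset.mem_finsupp_iff.1 hx).1 hh)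
  · push Not at hr
    obtain ⟨i, hi, hneg⟩ := hr
    rw [Finset.prod_eq_zero hi (by rw [zcoeff, if_neg (by omega)])]
    refine Finset.sum_eq_zero fun x _ => ?_
    rw [if_neg]
    intro hx'
    have := key x hx' i hi
    omega

end Eval

/-! ### Generating series of the polynomials `c^r_p` -/

section Geometric

variable {B : Type*} [CommRing B]

/-- The series `(1 + tX)⁻¹`. -/
noncomputable def geo (t : B) : PowerSeries B := PowerSeries.mk fun n => (-t) ^ n

theorem geo_mul (t : B) : geo t * (1 + PowerSeries.C t * PowerSeries.X) = 1 := by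
  ext n
  cases n with
  | zero => simp [geo, mul_add, ← mul_assoc]
  | succ n =>
    simp only [geo, mul_add, mul_one, ← mul_assoc, map_add, PowerSeries.coeff_succ_mul_X,
      PowerSeries.coeff_mul_C, PowerSeries.coeff_mk, PowerSeries.coeff_one]
    rw [if_neg (by omega)]
    ring

theorem map_geo {B' : Type*} [CommRing B'] (φ : B →+* B') (t : B) :
    PowerSeries.map φ (geo t) = geo (φ t) := by
  ext n
  simp [geo]

end Geometric

section Symmetric

variable {B : Type*} [CommRing B]

theorem coeff_prod_one_add_eq_esymm (R : Type*) [CommRing R] [Algebra R B] (n j : ℕ)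
    (x : Fin n → B) :
    PowerSeries.coeff j (∏ a, (1 + PowerSeries.C (x a) * PowerSeries.X))
      = MvPolynomial.aeval x (MvPolynomial.esymm (Fin n) R j) := by
  classical
  rw [Finset.prod_one_add, map_sum, MvPolynomial.esymm, map_sum,
    Finset.powersetCard_eq_filter, Finset.sum_filter]
  refine Finset.sum_congr rfl fun s _ => ?_
  rw [Finset.prod_mul_distrib, Finset.prod_const, ← map_prod, PowerSeries.coeff_C_mul,
    PowerSeries.coeff_X_pow, map_prod]
  simp only [MvPolynomial.aeval_X, eq_comm (a := j)]
  split_ifs <;> simp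

theorem coeff_prod_mk_eq_hsymm (R : Type*) [CommRing R] [Algebra R B] (n j : ℕ)
    (x : Fin n → B) :
    PowerSeries.coeff j (∏ a, PowerSeries.mk (fun m => x a ^ m))
      = MvPolynomial.aeval x (MvPolynomial.hsymm (Fin n) R j) := by
  classical
  rw [PowerSeries.coeff_prod, MvPolynomial.hsymm, map_sum]
  symm
  refine Finset.sum_bij (fun s _ => Multiset.toFinsupp s.1) ?_ ?_ ?_ ?_
  · intro s _
    rw [Finset.mem_finsuppAntidiag]
    refine ⟨?_, Finset.subset_univ _⟩
    change ∑ a, Multiset.count a s.1 = j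
    exact (Multiset.sum_count_eq_card fun a _ => Finset.mem_univ a).trans s.2
  · intro s _ s' _ h
    exact Subtype.ext (Multiset.toFinsupp.injective h)
  · intro l hl
    rw [Finset.mem_finsuppAntidiag] at hl
    refine ⟨⟨Finsupp.toMultiset l, ?_⟩, Finset.mem_univ _, ?_⟩
    · rw [Finsupp.card_toMultiset, Finsupp.sum_fintype _ _ (fun _ => rfl)]
      exact hl.1
    · simp
  · intro s _
    rw [map_multiset_prod, Multiset.map_map, Finset.prod_multiset_map_count]
    simp only [Function.comp, MvPolynomial.aeval_X, PowerSeries.coeff_mk, Multiset.toFinsupp_apply]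
    refine Finset.prod_subset (Finset.subset_univ _) fun a _ ha => ?_
    rw [Multiset.mem_toFinset] at ha
    rw [Multiset.count_eq_zero_of_notMem ha, pow_zero]

end Symmetric

section Series

variable (R : Type) [CommRing R] (k : ℕ)

/-- The series `∑ c_p X^p`. -/
noncomputable def cBase : PowerSeries (PolyBT R) :=
  PowerSeries.mk fun p => MvPolynomial.C (cPoly R k p)

/-- The series `∑ c^r_p X^p`. -/
noncomputable def cSer (r : ℤ) : PowerSeries (PolyBT R) := PowerSeries.mk fun p => cUp R k r p

/-- The series `∑ h^r_j(-t) X^j`. -/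
noncomputable def hSer (r : ℤ) : PowerSeries (PolyBT R) := PowerSeries.mk (hNeg R r)

theorem cSer_eq (r : ℤ) : cSer R k r = cBase R k * hSer R r := by
  ext1 p
  rw [mul_comm, PowerSeries.coeff_mul, cSer, PowerSeries.coeff_mk, cUp,
    Finset.Nat.sum_antidiagonal_eq_sum_range_succ_mk]
  refine Finset.sum_congr (by congr 1) fun j hj => ?_
  have hj' : j ≤ p := by rw [Finset.mem_range] at hj; omega
  simp only [hSer, cBase, PowerSeries.coeff_mk]
  rw [mul_comm, Nat.cast_sub hj']

theorem hSer_neg (n : ℕ) : hSer R (-(n : ℤ)) =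
    ∏ a ∈ Finset.range n, (1 - PowerSeries.C (tVar R (a + 1)) * PowerSeries.X) := by
  ext1 j
  rw [← Fin.prod_univ_eq_prod_range]
  have h := coeff_prod_one_add_eq_esymm R n j (fun a : Fin n => -tVar R ((a : ℕ) + 1))
  have e : ∀ a : Fin n, 1 - PowerSeries.C (tVar R ((a : ℕ) + 1)) * PowerSeries.X
      = 1 + PowerSeries.C (-tVar R ((a : ℕ) + 1)) * PowerSeries.X := by
    intro a
    rw [map_neg]
    ring
  rw [Finset.prod_congr rfl fun a _ => e a, h, hSer, PowerSeries.coeff_mk, hNeg]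
  split_ifs with h0
  · have hn : n = 0 := by omega
    subst hn
    cases j with
    | zero => simp
    | succ j =>
      simp only [MvPolynomial.hsymm, MvPolynomial.esymm, Finset.univ_eq_empty]
      rw [Finset.powersetCard_eq_empty.2 (by simp)]
      simp
  · rw [neg_neg, eNeg]
    rfl

theorem hSer_natCast (n : ℕ) : hSer R n = ∏ a ∈ Finset.range n, geo (tVar R (a + 1)) := by
  ext1 j
  rw [← Fin.prod_univ_eq_prod_range]
  have h := coeff_prod_mk_eq_hsymm R n j (fun a : Fin n => -tVar R ((a : ℕ) + 1))
  unfold geo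
  rw [h, hSer, PowerSeries.coeff_mk, hNeg, if_pos (by omega)]
  rfl

theorem cSer_natCast (n : ℕ) :
    cSer R k n = cBase R k * ∏ a ∈ Finset.range n, geo (tVar R (a + 1)) := by
  rw [cSer_eq, hSer_natCast]

theorem cSer_neg (n : ℕ) : cSer R k (-(n : ℤ)) = cBase R k *
    ∏ a ∈ Finset.range n, (1 - PowerSeries.C (tVar R (a + 1)) * PowerSeries.X) := by
  rw [cSer_eq, hSer_neg]

theorem cSer_zero : cSer R k 0 = cBase R k := by
  simpa using cSer_natCast R k 0

/-- The product `∏_{a ≤ n} (-t_a)`. -/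
noncomputable def negT (n : ℕ) : PolyBT R := ∏ a ∈ Finset.range n, -tVar R (a + 1)

theorem eNeg_self (n : ℕ) : eNeg R n n = negT R n := by
  rw [eNeg, MvPolynomial.esymm]
  have : Finset.powersetCard n (Finset.univ : Finset (Fin n)) = {Finset.univ} := by
    have h := Finset.powersetCard_self (Finset.univ : Finset (Fin n))
    rwa [Finset.card_fin] at h
  rw [this, Finset.sum_singleton, map_prod, negT, ← Fin.prod_univ_eq_prod_range]
  simp

end Series

/-! ### The simple reflections over the rational numbers -/

theorem toRat_C (x : PolyB ℤ) :
    toRat (MvPolynomial.C x) = MvPolynomial.C (MvPolynomial.map (Int.castRingHom ℚ) x) := by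
  rw [toRat, MvPolynomial.map_C]

theorem toRat_tVar (i : ℕ) : toRat (tVar ℤ i) = tVar ℚ i := by
  rw [toRat, tVar, MvPolynomial.map_X, tVar]

theorem map_bPoly (p : ℤ) : MvPolynomial.map (Int.castRingHom ℚ) (bPoly ℤ p) = bPoly ℚ p := by
  match p with
  | Int.ofNat 0 => simp [bPoly]
  | Int.ofNat (n + 1) => simp [bPoly]
  | Int.negSucc _ => simp [bPoly]

theorem map_bTildePoly : MvPolynomial.map (Int.castRingHom ℚ) (bTildePoly ℤ) = bTildePoly ℚ := by
  simp [bTildePoly]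

theorem map_cPoly (k : ℕ) (p : ℤ) :
    MvPolynomial.map (Int.castRingHom ℚ) (cPoly ℤ k p) = cPoly ℚ k p := by
  unfold cPoly
  split_ifs <;> simp [map_bPoly, map_bTildePoly]

theorem map_cBase (k : ℕ) : PowerSeries.map toRat (cBase ℤ k) = cBase ℚ k := by
  ext1 p
  rw [PowerSeries.coeff_map, cBase, PowerSeries.coeff_mk, toRat_C, map_cPoly, cBase,
    PowerSeries.coeff_mk]

theorem map_cSer (k : ℕ) (r : ℤ) : PowerSeries.map toRat (cSer ℤ k r) = cSer ℚ k r := by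
  obtain ⟨n, rfl | rfl⟩ := Int.eq_nat_or_neg r
  · rw [cSer_natCast, cSer_natCast, map_mul, map_cBase, map_prod]
    simp only [map_geo, toRat_tVar]
  · rw [cSer_neg, cSer_neg, map_mul, map_cBase, map_prod]
    simp only [map_sub, map_mul, map_one, PowerSeries.map_C, PowerSeries.map_X, toRat_tVar]

theorem cUp_of_neg (R : Type) [CommRing R] (k : ℕ) (r : ℤ) {p : ℤ} (hp : p < 0) :
    cUp R k r p = 0 := by
  rw [cUp, show (p + 1).toNat = 0 by omega, Finset.sum_range_zero]

theorem cUp_eq_zcoeff (R : Type) [CommRing R] (k : ℕ) (r p : ℤ) :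
    cUp R k r p = zcoeff (cSer R k r) p := by
  unfold zcoeff
  split_ifs with h
  · rw [cSer, PowerSeries.coeff_mk, Int.toNat_of_nonneg h]
  · exact cUp_of_neg R k r (by omega)

theorem toRat_cUp (k : ℕ) (r p : ℤ) : toRat (cUp ℤ k r p) = cUp ℚ k r p := by
  rw [cUp_eq_zcoeff, cUp_eq_zcoeff, ← map_cSer]
  unfold zcoeff
  split_ifs <;> simp

theorem toRat_injective : Function.Injective toRat :=
  MvPolynomial.map_injective _ (MvPolynomial.map_injective _ (RingHom.injective_int _))

/-- The action of the simple reflection `s_i` on `ℚ[b, t]`. -/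
noncomputable def reflectRat (k : ℕ) : ℕ → (PolyBT ℚ →+* PolyBT ℚ)
  | 0 => MvPolynomial.eval₂Hom (MvPolynomial.eval₂Hom
      ((MvPolynomial.C : PolyB ℚ →+* PolyBT ℚ).comp MvPolynomial.C)
      (fun g => toRat (s0Gen k g))) (fun n => toRat (s0T n))
  | i + 1 => (MvPolynomial.rename (Equiv.swap i (i + 1))).toRingHom

theorem toRat_reflect (k i : ℕ) (f : PolyBT ℤ) :
    toRat (reflect k i f) = reflectRat k i (toRat f) := by
  suffices h : toRat.comp (reflect k i) = (reflectRat k i).comp toRat from RingHom.congr_fun h f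
  cases i with
  | zero =>
    refine MvPolynomial.ringHom_ext' (MvPolynomial.ringHom_ext' (RingHom.ext_int _ _) ?_) ?_
    · intro g
      simp [reflect, reflectRat, toRat_C]
    · intro n
      simp only [RingHom.comp_apply, reflect, reflectRat, MvPolynomial.coe_eval₂Hom,
        MvPolynomial.eval₂_X]
      rw [show toRat (MvPolynomial.X n) = MvPolynomial.X n by simp [toRat],
        MvPolynomial.eval₂_X]
  | succ i =>
    refine MvPolynomial.ringHom_ext' (MvPolynomial.ringHom_ext' (RingHom.ext_int _ _) ?_) ?_
    · intro g
      simp [reflect, reflectRat, toRat_C]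
    · intro n
      simp [reflect, reflectRat, toRat]

theorem reflectRat_const (k i : ℕ) (q : ℚ) :
    reflectRat k i (MvPolynomial.C (MvPolynomial.C q)) = MvPolynomial.C (MvPolynomial.C q) := by
  cases i <;> simp [reflectRat]

theorem reflectRat_succ_C (k i : ℕ) (x : PolyB ℚ) :
    reflectRat k (i + 1) (MvPolynomial.C x) = MvPolynomial.C x := by
  simp [reflectRat]

theorem reflectRat_succ_tVar (k n a : ℕ) :
    reflectRat k (n + 1) (tVar ℚ (a + 1)) = tVar ℚ (Equiv.swap n (n + 1) a + 1) := by
  simp [reflectRat, tVar]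

theorem reflectRat_zero_tVar_one (k : ℕ) : reflectRat k 0 (tVar ℚ 1) = -tVar ℚ 2 := by
  rw [← toRat_tVar, ← toRat_reflect, ← toRat_tVar, ← map_neg]
  simp [reflect, tVar, s0T]

theorem reflectRat_zero_tVar_two (k : ℕ) : reflectRat k 0 (tVar ℚ 2) = -tVar ℚ 1 := by
  rw [← toRat_tVar, ← toRat_reflect, ← toRat_tVar, ← map_neg]
  simp [reflect, tVar, s0T]

theorem reflectRat_zero_tVar (k a : ℕ) : reflectRat k 0 (tVar ℚ (a + 3)) = tVar ℚ (a + 3) := by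
  rw [← toRat_tVar, ← toRat_reflect]
  simp [reflect, tVar, s0T]

/-- The difference `b̃_k - b_k`. -/
noncomputable def dDiff (k : ℕ) : PolyBT ℚ := MvPolynomial.C (bTildePoly ℚ - bPoly ℚ k)

theorem reflect_zero_bPoly (k n : ℕ) :
    reflect k 0 (MvPolynomial.C (bPoly ℤ (n + 1 : ℕ))) = MvPolynomial.C (bPoly ℤ (n + 1 : ℕ)) -
      (if n + 1 < k then 2 else 1) * ((tVar ℤ 1 + tVar ℤ 2) * cUp ℤ k 2 n) := by
  rw [show bPoly ℤ (n + 1 : ℕ) = MvPolynomial.X (Gen.b n) from rfl]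
  simp [reflect, s0Gen]

theorem reflect_zero_bTildePoly (k : ℕ) :
    reflect k 0 (MvPolynomial.C (bTildePoly ℤ)) = MvPolynomial.C (bTildePoly ℤ) -
      (tVar ℤ 1 + tVar ℤ 2) * cUp ℤ k 2 (k - 1) := by
  simp [reflect, s0Gen, bTildePoly]

theorem reflectRat_dDiff (k i : ℕ) [NeZero k] : reflectRat k i (dDiff k) = dDiff k := by
  cases i with
  | succ i => exact reflectRat_succ_C k i _
  | zero =>
    obtain ⟨n, rfl⟩ : ∃ n, k = n + 1 := ⟨k - 1, by have := NeZero.ne k; omega⟩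
    have h : dDiff (n + 1) =
        toRat (MvPolynomial.C (bTildePoly ℤ) - MvPolynomial.C (bPoly ℤ (n + 1 : ℕ))) := by
      rw [dDiff, map_sub MvPolynomial.C, map_sub toRat, toRat_C, toRat_C, map_bPoly, map_bTildePoly]
    rw [h, ← toRat_reflect]
    congr 1
    rw [map_sub, reflect_zero_bPoly, reflect_zero_bTildePoly, if_neg (by omega),
      show ((n + 1 : ℕ) : ℤ) - 1 = n by push_cast; ring]
    ring

theorem reflect_zero_cPoly (k n : ℕ) [NeZero k] :
    reflect k 0 (MvPolynomial.C (cPoly ℤ k (n + 1 : ℕ))) = MvPolynomial.C (cPoly ℤ k (n + 1 : ℕ))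
      - 2 * ((tVar ℤ 1 + tVar ℤ 2) * cUp ℤ k 2 n) := by
  unfold cPoly
  by_cases h1 : n + 1 < k
  · rw [if_pos (by exact_mod_cast h1), reflect_zero_bPoly, if_pos h1]
  · rw [if_neg (by exact_mod_cast h1)]
    by_cases h2 : n + 1 = k
    · subst h2
      rw [if_pos rfl, map_add, map_add, reflect_zero_bPoly, reflect_zero_bTildePoly, if_neg h1,
        show ((n + 1 : ℕ) : ℤ) - 1 = n by push_cast; ring]
      ring
    · rw [if_neg (by exact_mod_cast h2), map_mul, map_mul, reflect_zero_bPoly, if_neg h1]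
      simp only [map_ofNat]
      ring

theorem map_reflectRat_succ_cBase (k i : ℕ) :
    PowerSeries.map (reflectRat k (i + 1)) (cBase ℚ k) = cBase ℚ k := by
  ext1 p
  rw [PowerSeries.coeff_map, cBase, PowerSeries.coeff_mk, reflectRat_succ_C]

/-- The reflection `s_0` multiplies `∑ c_p X^p` by
`(1 - t_1 X) (1 - t_2 X) / ((1 + t_1 X) (1 + t_2 X))`. -/
theorem map_reflectRat_zero_cBase (k : ℕ) [NeZero k] :
    PowerSeries.map (reflectRat k 0) (cBase ℚ k) = cBase ℚ k *
      ((1 - PowerSeries.C (tVar ℚ 1) * PowerSeries.X) *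
        (1 - PowerSeries.C (tVar ℚ 2) * PowerSeries.X) * geo (tVar ℚ 1) * geo (tVar ℚ 2)) := by
  have h : PowerSeries.map (reflectRat k 0) (cBase ℚ k) = cBase ℚ k -
      2 * (PowerSeries.C (tVar ℚ 1 + tVar ℚ 2) * (PowerSeries.X * cSer ℚ k 2)) := by
    have h2 : ∀ f : PowerSeries (PolyBT ℚ), 2 * f = PowerSeries.C 2 * f := by
      intro f; rw [map_ofNat]
    rw [h2]
    ext1 p
    rw [PowerSeries.coeff_map, map_sub, PowerSeries.coeff_C_mul, PowerSeries.coeff_C_mul]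
    cases p with
    | zero =>
      have : reflectRat k 0 (MvPolynomial.C (cPoly ℚ k (0 : ℕ)))
          = MvPolynomial.C (cPoly ℚ k (0 : ℕ)) := by
        rw [cPoly, if_pos (by have := NeZero.pos k; omega)]
        simp [bPoly]
      simp only [cBase, PowerSeries.coeff_mk, this]
      simp
    | succ n =>
      have hn : (MvPolynomial.C (cPoly ℚ k (n + 1 : ℕ)) : PolyBT ℚ)
          = toRat (MvPolynomial.C (cPoly ℤ k (n + 1 : ℕ))) := by
        rw [toRat_C, map_cPoly]
      rw [PowerSeries.coeff_succ_X_mul, cBase, PowerSeries.coeff_mk, cSer, PowerSeries.coeff_mk,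
        hn, ← toRat_reflect, reflect_zero_cPoly]
      simp only [map_sub, map_mul, map_add, toRat_tVar, toRat_cUp, map_ofNat]
  have h1 := geo_mul (tVar ℚ 1)
  have h2 := geo_mul (tVar ℚ 2)
  have h3 := cSer_natCast ℚ k 2
  rw [Finset.prod_range_succ, Finset.prod_range_one] at h3
  norm_num at h3
  rw [h, h3, map_add]
  have h4 : geo (tVar ℚ 1) * geo (tVar ℚ 2) *
      ((1 + PowerSeries.C (tVar ℚ 1) * PowerSeries.X) *
        (1 + PowerSeries.C (tVar ℚ 2) * PowerSeries.X)) = 1 := by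
    linear_combination (geo (tVar ℚ 2) * (1 + PowerSeries.C (tVar ℚ 2) * PowerSeries.X)) * h1 + h2
  linear_combination (-cBase ℚ k) * h4

theorem prod_range_swap {M : Type*} [CommMonoid M] (g : ℕ → M) {n r : ℕ} (hr : r ≠ n + 1) :
    ∏ a ∈ Finset.range r, g (Equiv.swap n (n + 1) a) = ∏ a ∈ Finset.range r, g a := by
  refine Finset.prod_equiv (Equiv.swap n (n + 1)) (fun a => ?_) fun a _ => rfl
  rw [Finset.mem_range, Finset.mem_range, Equiv.swap_apply_def]
  split_ifs <;> omega

theorem map_reflectRat_succ_cSer (k n : ℕ) {r : ℤ} (h1 : r ≠ n + 1) (h2 : r ≠ -(n + 1)) :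
    PowerSeries.map (reflectRat k (n + 1)) (cSer ℚ k r) = cSer ℚ k r := by
  obtain ⟨m, rfl | rfl⟩ := Int.eq_nat_or_neg r
  · rw [cSer_natCast, map_mul, map_reflectRat_succ_cBase, map_prod]
    simp only [map_geo, reflectRat_succ_tVar]
    rw [prod_range_swap (fun a => geo (tVar ℚ (a + 1))) (by omega)]
  · rw [cSer_neg, map_mul, map_reflectRat_succ_cBase, map_prod]
    simp only [map_sub, map_mul, map_one, PowerSeries.map_C, PowerSeries.map_X,
      reflectRat_succ_tVar]
    rw [prod_range_swap (fun a => 1 - PowerSeries.C (tVar ℚ (a + 1)) * PowerSeries.X) (by omega)]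

theorem map_reflectRat_zero_cSer (k : ℕ) [NeZero k] {r : ℤ} (h : 2 ≤ |r|) :
    PowerSeries.map (reflectRat k 0) (cSer ℚ k r) = cSer ℚ k r := by
  have h1 := geo_mul (tVar ℚ 1)
  have h2 := geo_mul (tVar ℚ 2)
  obtain ⟨m, hm⟩ := Int.eq_nat_or_neg r
  obtain ⟨n, rfl⟩ : ∃ n, m = n + 2 := by
    refine ⟨m - 2, ?_⟩
    rcases hm with rfl | rfl
    · rw [abs_of_nonneg (by omega)] at h; omega
    · rw [abs_neg, abs_of_nonneg (by omega)] at h; omega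
  rcases hm with rfl | rfl
  · have h3 := geo_mul (-tVar ℚ 1)
    have h4 := geo_mul (-tVar ℚ 2)
    rw [cSer_natCast, map_mul, map_reflectRat_zero_cBase, map_prod, Finset.prod_range_succ',
      Finset.prod_range_succ', Finset.prod_range_succ', Finset.prod_range_succ']
    simp only [map_geo, zero_add, reflectRat_zero_tVar_one, reflectRat_zero_tVar_two,
      reflectRat_zero_tVar, show ∀ a : ℕ, a + 1 + 1 + 1 = a + 3 from fun _ => rfl,
      show 1 + 1 = 2 from rfl]
    rw [map_neg] at h3 h4
    linear_combination (cBase ℚ k * geo (tVar ℚ 1) * geo (tVar ℚ 2) *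
      ∏ a ∈ Finset.range n, geo (tVar ℚ (a + 3))) *
      (h3 * geo (-tVar ℚ 2) * (1 - PowerSeries.C (tVar ℚ 2) * PowerSeries.X) + h4)
  · rw [cSer_neg, map_mul, map_reflectRat_zero_cBase, map_prod, Finset.prod_range_succ',
      Finset.prod_range_succ', Finset.prod_range_succ', Finset.prod_range_succ']
    simp only [map_sub, map_mul, map_one, PowerSeries.map_C, PowerSeries.map_X, zero_add,
      reflectRat_zero_tVar_one, reflectRat_zero_tVar_two,
      reflectRat_zero_tVar, show ∀ a : ℕ, a + 1 + 1 + 1 = a + 3 from fun _ => rfl,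
      show 1 + 1 = 2 from rfl, map_neg]
    linear_combination (cBase ℚ k * (1 - PowerSeries.C (tVar ℚ 1) * PowerSeries.X) *
      (1 - PowerSeries.C (tVar ℚ 2) * PowerSeries.X) *
      ∏ a ∈ Finset.range n, (1 - PowerSeries.C (tVar ℚ (a + 3)) * PowerSeries.X)) *
      (h1 * geo (tVar ℚ 2) * (1 + PowerSeries.C (tVar ℚ 2) * PowerSeries.X) + h2)

/-! ### The factors of a double eta polynomial, as functions of the entries of `w` -/

/-- The constant `1/2`. -/
noncomputable def half : PolyBT ℚ := MvPolynomial.C (MvPolynomial.C (1 / 2))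

theorem half_add_half : half + half = 1 := by
  rw [half, ← map_add, ← map_add]
  norm_num

theorem two_mul_half : (2 : PolyBT ℚ) * half = 1 := by
  rw [two_mul, half_add_half]

/-- The sign `+1` for odd positions and `-1` for even positions. -/
noncomputable def posSign (j : ℕ) : PolyBT ℚ := (-1) ^ (j + 1)

/-- The series of the factor at a position with entry `v`: half of `c^{v+1}` if `v < 0`, the
series of `a^1` if `v = 1`, and `c^v` otherwise. -/
noncomputable def entrySer (k : ℕ) (v : ℤ) : PowerSeries (PolyBT ℚ) :=
  if v < 0 then PowerSeries.C half * cSer ℚ k (v + 1)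
  else if v = 1 then cSer ℚ k 1 - PowerSeries.C half * cBase ℚ k
  else cSer ℚ k v

/-- The correction to the factor at position `j` with entry `v`, which occurs for the raising
operators not involving `j`. -/
noncomputable def entryCorr (k j : ℕ) (v : ℤ) : PolyBT ℚ :=
  if v < 0 then half * posSign j * dDiff k * negT ℚ (-v - 1).toNat
  else if v = 1 then -(half * posSign j * dDiff k)
  else 0

theorem entrySer_of_one_lt (k : ℕ) {v : ℤ} (h : 1 < v) : entrySer k v = cSer ℚ k v := by
  rw [entrySer, if_neg (by omega), if_neg (by omega)]

theorem entryCorr_of_one_lt (k j : ℕ) {v : ℤ} (h : 1 < v) : entryCorr k j v = 0 := by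
  rw [entryCorr, if_neg (by omega), if_neg (by omega)]

theorem entrySer_neg (k n : ℕ) :
    entrySer k (-((n : ℤ) + 1)) = PowerSeries.C half * cSer ℚ k (-(n : ℤ)) := by
  rw [entrySer, if_pos (by omega), show -((n : ℤ) + 1) + 1 = -n by ring]

theorem entryCorr_neg (k j n : ℕ) :
    entryCorr k j (-((n : ℤ) + 1)) = half * posSign j * dDiff k * negT ℚ n := by
  rw [entryCorr, if_pos (by omega), show (-(-((n : ℤ) + 1)) - 1).toNat = n by omega]

theorem entrySer_one (k : ℕ) : entrySer k 1 = PowerSeries.C half * (cBase ℚ k *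
    (1 - PowerSeries.C (tVar ℚ 1) * PowerSeries.X) * geo (tVar ℚ 1)) := by
  have h := cSer_natCast ℚ k 1
  rw [Finset.prod_range_one] at h
  norm_num at h
  have h1 := geo_mul (tVar ℚ 1)
  have h2 : (PowerSeries.C half + PowerSeries.C half : PowerSeries (PolyBT ℚ)) = 1 := by
    rw [← map_add, half_add_half, map_one]
  rw [entrySer, if_neg (by omega), if_pos rfl, h]
  linear_combination (PowerSeries.C half * cBase ℚ k) * h1 - cBase ℚ k * geo (tVar ℚ 1) * h2

theorem entryCorr_one (k j : ℕ) : entryCorr k j 1 = -(half * posSign j * dDiff k) := by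
  rw [entryCorr, if_neg (by omega), if_pos rfl]

theorem reflectRat_half (k i : ℕ) : reflectRat k i half = half := reflectRat_const k i _

theorem reflectRat_posSign (k i j : ℕ) : reflectRat k i (posSign j) = posSign j := by
  simp [posSign]

theorem reflectRat_succ_negT (k : ℕ) {n r : ℕ} (h : r ≠ n + 1) :
    reflectRat k (n + 1) (negT ℚ r) = negT ℚ r := by
  rw [negT, map_prod]
  simp only [map_neg, reflectRat_succ_tVar]
  rw [prod_range_swap (fun a => -tVar ℚ (a + 1)) h]

theorem reflectRat_zero_negT (k r : ℕ) : reflectRat k 0 (negT ℚ (r + 2)) = negT ℚ (r + 2) := by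
  rw [negT, map_prod, Finset.prod_range_succ', Finset.prod_range_succ', Finset.prod_range_succ',
    Finset.prod_range_succ']
  simp only [map_neg, zero_add, reflectRat_zero_tVar_one, reflectRat_zero_tVar_two,
      reflectRat_zero_tVar, show ∀ a : ℕ, a + 1 + 1 + 1 = a + 3 from fun _ => rfl,
      show 1 + 1 = 2 from rfl]
  ring

theorem map_reflectRat_succ_entrySer (k n : ℕ) {v : ℤ} (h1 : |v| ≠ n + 1) (h2 : |v| ≠ n + 2) :
    PowerSeries.map (reflectRat k (n + 1)) (entrySer k v) = entrySer k v := by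
  unfold entrySer
  split_ifs with hv hv'
  · rw [abs_of_neg hv] at h1 h2
    rw [map_mul, PowerSeries.map_C, reflectRat_half,
      map_reflectRat_succ_cSer k n (by omega) (by omega)]
  · rw [abs_of_nonneg (by omega)] at h1 h2
    rw [map_sub, map_mul, PowerSeries.map_C, reflectRat_half, map_reflectRat_succ_cBase,
      map_reflectRat_succ_cSer k n (by omega) (by omega)]
  · rw [abs_of_nonneg (by omega)] at h1 h2
    rw [map_reflectRat_succ_cSer k n (by omega) (by omega)]

theorem reflectRat_succ_entryCorr (k n j : ℕ) [NeZero k] {v : ℤ} (h2 : |v| ≠ n + 2) :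
    reflectRat k (n + 1) (entryCorr k j v) = entryCorr k j v := by
  unfold entryCorr
  split_ifs with hv hv'
  · rw [abs_of_neg hv] at h2
    rw [map_mul, map_mul, map_mul, reflectRat_half, reflectRat_posSign, reflectRat_dDiff,
      reflectRat_succ_negT k (by omega)]
  · rw [map_neg, map_mul, map_mul, reflectRat_half, reflectRat_posSign, reflectRat_dDiff]
  · exact map_zero _

theorem map_reflectRat_zero_entrySer (k : ℕ) [NeZero k] {v : ℤ} (h : 3 ≤ |v|) :
    PowerSeries.map (reflectRat k 0) (entrySer k v) = entrySer k v := by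
  unfold entrySer
  split_ifs with hv hv'
  · rw [abs_of_neg hv] at h
    rw [map_mul, PowerSeries.map_C, reflectRat_half, map_reflectRat_zero_cSer k
      (by rw [abs_of_neg (by omega)]; omega)]
  · rw [hv'] at h
    norm_num at h
  · rw [map_reflectRat_zero_cSer k (by omega)]

theorem reflectRat_zero_entryCorr (k j : ℕ) [NeZero k] {v : ℤ} (h : 3 ≤ |v|) :
    reflectRat k 0 (entryCorr k j v) = entryCorr k j v := by
  unfold entryCorr
  split_ifs with hv hv'
  · rw [abs_of_neg hv] at h
    obtain ⟨r, hr⟩ : ∃ r, (-v - 1).toNat = r + 2 := ⟨(-v - 3).toNat, by omega⟩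
    rw [map_mul, map_mul, map_mul, reflectRat_half, reflectRat_posSign, reflectRat_dDiff, hr,
      reflectRat_zero_negT k]
  · rw [map_neg, map_mul, map_mul, reflectRat_half, reflectRat_posSign, reflectRat_dDiff]
  · exact map_zero _

/-- The effect of a reflection on one factor: the differences of the series and of the
corrections, for the entry `v` of `λ` and the entry `v'` of `μ`. -/
def EntryStep (k i : ℕ) (v v' : ℤ) : Prop :=
  entrySer k v - PowerSeries.map (reflectRat k i) (entrySer k v)
      = PowerSeries.C (toRat (denom i)) * PowerSeries.X * entrySer k v' ∧
    ∀ j, entryCorr k j v - reflectRat k i (entryCorr k j v)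
      = toRat (denom i) * entryCorr k j v'

theorem toRat_denom_succ (n : ℕ) :
    toRat (denom (n + 1)) = tVar ℚ (n + 2) - tVar ℚ (n + 1) := by
  rw [denom, if_neg (by omega), map_sub, toRat_tVar, toRat_tVar]

theorem toRat_denom_zero : toRat (denom 0) = tVar ℚ 1 + tVar ℚ 2 := by
  rw [denom, if_pos rfl, map_add, toRat_tVar, toRat_tVar]

theorem reflectRat_succ_tVar_self (k n : ℕ) :
    reflectRat k (n + 1) (tVar ℚ (n + 1)) = tVar ℚ (n + 2) := by
  rw [reflectRat_succ_tVar, Equiv.swap_apply_left]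

theorem cSer_natCast_succ (k n : ℕ) :
    cSer ℚ k ((n : ℤ) + 1) = cSer ℚ k n * geo (tVar ℚ (n + 1)) := by
  have h := cSer_natCast ℚ k (n + 1)
  rw [Nat.cast_succ] at h
  rw [h, cSer_natCast, Finset.prod_range_succ]
  ring

theorem cSer_neg_succ (k n : ℕ) : cSer ℚ k (-((n : ℤ) + 1))
    = cSer ℚ k (-(n : ℤ)) * (1 - PowerSeries.C (tVar ℚ (n + 1)) * PowerSeries.X) := by
  have h := cSer_neg ℚ k (n + 1)
  rw [Nat.cast_succ] at h
  rw [h, cSer_neg, Finset.prod_range_succ]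
  ring

theorem cSer_step_pos (k n : ℕ) :
    cSer ℚ k ((n : ℤ) + 1) - PowerSeries.map (reflectRat k (n + 1)) (cSer ℚ k ((n : ℤ) + 1))
      = PowerSeries.C (toRat (denom (n + 1))) * PowerSeries.X * cSer ℚ k ((n : ℤ) + 2) := by
  have h0 := cSer_natCast_succ k (n + 1)
  rw [show (((n + 1 : ℕ) : ℤ) + 1) = (n : ℤ) + 2 by push_cast; ring,
    show ((n + 1 : ℕ) : ℤ) = (n : ℤ) + 1 by push_cast; ring] at h0
  have h1 := geo_mul (tVar ℚ (n + 1))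
  have h2 := geo_mul (tVar ℚ (n + 2))
  rw [h0, cSer_natCast_succ, map_mul, map_reflectRat_succ_cSer k n (by omega) (by omega),
    map_geo, reflectRat_succ_tVar_self, toRat_denom_succ, map_sub,
    show n + 1 + 1 = n + 2 from rfl]
  linear_combination cSer ℚ k n * (geo (tVar ℚ (n + 2)) * h1 - geo (tVar ℚ (n + 1)) * h2)

theorem cSer_step_neg (k n : ℕ) :
    cSer ℚ k (-((n : ℤ) + 1)) - PowerSeries.map (reflectRat k (n + 1)) (cSer ℚ k (-((n : ℤ) + 1)))
      = PowerSeries.C (toRat (denom (n + 1))) * PowerSeries.X * cSer ℚ k (-(n : ℤ)) := by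
  rw [cSer_neg_succ, map_mul, map_reflectRat_succ_cSer k n (by omega) (by omega)]
  simp only [map_sub, map_mul, map_one, PowerSeries.map_C, PowerSeries.map_X,
    reflectRat_succ_tVar_self, toRat_denom_succ]
  ring

theorem negT_succ (n : ℕ) : negT ℚ (n + 1) = -tVar ℚ (n + 1) * negT ℚ n := by
  rw [negT, Finset.prod_range_succ, mul_comm, negT]

/-- The reflection `s_{n+1}` moves the entry `-(n+1)` to `-(n+2)`. -/
theorem entryStep_neg (k n : ℕ) [NeZero k] :
    EntryStep k (n + 1) (-((n : ℤ) + 2)) (-((n : ℤ) + 1)) := by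
  constructor
  · have h := entrySer_neg k (n + 1)
    rw [show -(((n + 1 : ℕ) : ℤ) + 1) = -((n : ℤ) + 2) by push_cast; ring,
      show -((n + 1 : ℕ) : ℤ) = -((n : ℤ) + 1) by push_cast; ring] at h
    rw [h, entrySer_neg, map_mul, PowerSeries.map_C, reflectRat_half]
    linear_combination PowerSeries.C half * cSer_step_neg k n
  · intro j
    have h := entryCorr_neg k j (n + 1)
    rw [show -(((n + 1 : ℕ) : ℤ) + 1) = -((n : ℤ) + 2) by push_cast; ring] at h
    rw [h, entryCorr_neg, negT_succ]
    simp only [map_mul, map_neg, reflectRat_half, reflectRat_posSign, reflectRat_dDiff,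
      reflectRat_succ_tVar_self, toRat_denom_succ, reflectRat_succ_negT k (show n ≠ n + 1 by omega)]
    ring

/-- The reflection `s_{n+1}` moves the entry `n+2` to `n+1`. -/
theorem entryStep_pos (k n : ℕ) [NeZero k] :
    EntryStep k (n + 1) ((n : ℤ) + 1) ((n : ℤ) + 2) := by
  constructor
  · rw [entrySer_of_one_lt k (show (1 : ℤ) < n + 2 by omega), ← cSer_step_pos]
    by_cases hn : n = 0
    · subst hn
      rw [entrySer, if_neg (by norm_num), if_pos (by norm_num)]
      rw [map_sub, map_mul, PowerSeries.map_C, reflectRat_half, map_reflectRat_succ_cBase]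
      norm_num
    · rw [entrySer_of_one_lt k (by omega)]
  · intro j
    rw [entryCorr_of_one_lt k j (show (1 : ℤ) < n + 2 by omega), mul_zero]
    by_cases hn : n = 0
    · subst hn
      rw [show ((0 : ℕ) : ℤ) + 1 = 1 by norm_num, entryCorr_one]
      simp only [map_mul, map_neg, reflectRat_half, reflectRat_posSign, reflectRat_dDiff, sub_self]
    · rw [entryCorr_of_one_lt k j (by omega), map_zero, sub_zero]

theorem cSer_two (k : ℕ) :
    cSer ℚ k 2 = cBase ℚ k * geo (tVar ℚ 1) * geo (tVar ℚ 2) := by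
  have h3 := cSer_natCast ℚ k 2
  rw [Finset.prod_range_succ, Finset.prod_range_one] at h3
  norm_num at h3
  rw [h3]
  ring

theorem cSer_neg_one (k : ℕ) : cSer ℚ k (-1) =
    cBase ℚ k * (1 - PowerSeries.C (tVar ℚ 1) * PowerSeries.X) := by
  have h3 := cSer_neg ℚ k 1
  rw [Finset.prod_range_one] at h3
  norm_num at h3
  exact h3

theorem entrySer_neg_one (k : ℕ) : entrySer k (-1) = PowerSeries.C half * cBase ℚ k := by
  have h := entrySer_neg k 0
  rw [← cSer_zero]
  simpa using h

theorem entrySer_neg_two (k : ℕ) : entrySer k (-2) = PowerSeries.C half *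
    (cBase ℚ k * (1 - PowerSeries.C (tVar ℚ 1) * PowerSeries.X)) := by
  have h := entrySer_neg k 1
  rw [← cSer_neg_one]
  norm_num at h
  exact h

theorem entryCorr_neg_one (k j : ℕ) : entryCorr k j (-1) = half * posSign j * dDiff k := by
  have h := entryCorr_neg k j 0
  rw [negT, Finset.prod_range_zero] at h
  simpa using h

theorem entryCorr_neg_two (k j : ℕ) :
    entryCorr k j (-2) = half * posSign j * dDiff k * -tVar ℚ 1 := by
  have h := entryCorr_neg k j 1
  rw [negT, Finset.prod_range_one] at h
  norm_num at h
  exact h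

/-- The reflection `s_0` moves the entry `1` to `-2`. -/
theorem entryStep_zero_neg_two (k : ℕ) [NeZero k] : EntryStep k 0 (-2) 1 := by
  have h1 := geo_mul (tVar ℚ 1)
  have h2 := geo_mul (tVar ℚ 2)
  constructor
  · rw [entrySer_neg_two, entrySer_one]
    simp only [map_mul, map_sub, map_one, PowerSeries.map_C, PowerSeries.map_X,
      map_reflectRat_zero_cBase, reflectRat_half, reflectRat_zero_tVar_one, toRat_denom_zero,
      map_add, map_neg]
    linear_combination (-PowerSeries.C half * cBase ℚ k *
      (1 - PowerSeries.C (tVar ℚ 1) * PowerSeries.X)) * (h1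
        + geo (tVar ℚ 1) * (1 - PowerSeries.C (tVar ℚ 2) * PowerSeries.X) * h2)
  · intro j
    rw [entryCorr_neg_two, entryCorr_one]
    simp only [map_mul, map_neg, reflectRat_half, reflectRat_posSign, reflectRat_dDiff,
      reflectRat_zero_tVar_one, toRat_denom_zero]
    ring

/-- The reflection `s_0` moves the entry `2` to `-1`. -/
theorem entryStep_zero_neg_one (k : ℕ) [NeZero k] : EntryStep k 0 (-1) 2 := by
  have h1 := geo_mul (tVar ℚ 1)
  have h2 := geo_mul (tVar ℚ 2)
  have h3 : (PowerSeries.C half + PowerSeries.C half : PowerSeries (PolyBT ℚ)) = 1 := by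
    rw [← map_add, half_add_half, map_one]
  constructor
  · rw [entrySer_neg_one, entrySer_of_one_lt k (by norm_num), cSer_two]
    simp only [map_mul, PowerSeries.map_C, map_reflectRat_zero_cBase, reflectRat_half,
      toRat_denom_zero, map_add]
    linear_combination (-PowerSeries.C half * cBase ℚ k) * (h1 * geo (tVar ℚ 2) *
      (1 + PowerSeries.C (tVar ℚ 2) * PowerSeries.X) + h2) + cBase ℚ k * geo (tVar ℚ 1) *
      geo (tVar ℚ 2) * (PowerSeries.C (tVar ℚ 1) + PowerSeries.C (tVar ℚ 2)) * PowerSeries.X * h3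
  · intro j
    rw [entryCorr_neg_one, entryCorr_of_one_lt k j (by norm_num)]
    simp only [map_mul, reflectRat_half, reflectRat_posSign, reflectRat_dDiff]
    ring

namespace TypedPartition

/-! ### The entries of `w_λ` -/

variable {k : ℕ}

theorem part_eq_zero (lam : TypedPartition k) {j : ℕ} (h : lam.length < j) : lam.part j = 0 := by
  rw [part, List.getD_eq_getElem?_getD, List.getElem?_eq_none (by rw [length] at h; omega)]
  rfl

theorem part_mem (lam : TypedPartition k) {j : ℕ} (h1 : 1 ≤ j) (h : j ≤ lam.length) :
    lam.part j ∈ lam.parts := by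
  rw [length] at h
  rw [part, List.getD_eq_getElem?_getD, List.getElem?_eq_getElem (by omega)]
  exact List.getElem_mem _

theorem size_eq_sum (lam : TypedPartition k) {L : ℕ} (hL : lam.length ≤ L) :
    lam.size = ∑ j ∈ Finset.Icc 1 L, lam.part j := by
  have h1 : ∑ j ∈ Finset.Icc 1 L, lam.part j = ∑ j ∈ Finset.range L, lam.parts.getD j 0 := by
    rw [Finset.range_eq_Ico, Finset.sum_Ico_eq_sum_range, ← Finset.Ico_succ_right_eq_Icc,
      Finset.sum_Ico_eq_sum_range]
    refine Finset.sum_congr (by simp) fun j _ => ?_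
    rw [part]
    congr 1
    omega
  rw [h1, size, ← Finset.sum_subset (Finset.range_mono hL)]
  · rw [length, Finset.sum_range, ← Fin.sum_univ_getElem]
    refine Finset.sum_congr rfl fun j _ => ?_
    simp [List.getD_eq_getElem?_getD]
  · intro j _ hj
    rw [Finset.mem_range, not_lt] at hj
    exact lam.part_eq_zero (j := j + 1) (by omega)

theorem le_numLarge_iff (lam : TypedPartition k) {j : ℕ} (h1 : 1 ≤ j) :
    j ≤ lam.numLarge ↔ k < lam.part j := by
  obtain ⟨L, hL⟩ : ∃ L, L = lam.parts.filter (fun x => k < x) := ⟨_, rfl⟩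
  obtain ⟨M, hM⟩ : ∃ M, M = lam.parts.filter (fun x => x ≤ k) := ⟨_, rfl⟩
  have hLM : lam.parts = L ++ M := by
    rw [hL, hM]; exact filter_append_filter k _ lam.sorted
  have hn : lam.numLarge = L.length := by rw [numLarge, hL]
  rw [hn, part, hLM]
  constructor
  · intro h
    rw [List.getD_append _ _ _ _ (by omega), List.getD_eq_getElem?_getD,
      List.getElem?_eq_getElem (by omega), Option.getD_some]
    have h3 : ∀ x ∈ L, k < x := by
      intro x hx; rw [hL] at hx; simpa using (List.mem_filter.1 hx).2
    exact h3 _ (List.getElem_mem _)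
  · intro h
    by_contra hcon
    rw [List.getD_append_right _ _ _ _ (by omega)] at h
    by_cases hj : j - 1 - L.length < M.length
    · rw [List.getD_eq_getElem?_getD, List.getElem?_eq_getElem hj, Option.getD_some] at h
      have h2 : M[j - 1 - L.length]'hj ∈ M := List.getElem_mem _
      have h3 : ∀ x ∈ M, x ≤ k := by
        intro x hx; rw [hM] at hx; simpa using (List.mem_filter.1 hx).2
      have := h3 _ h2
      omega
    · rw [List.getD_eq_getElem?_getD, List.getElem?_eq_none (by omega), Option.getD_none] at h
      omega

theorem mid_pos (lam : TypedPartition k) : 1 ≤ lam.mid := by rw [mid]; omega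

variable [NeZero k] (lam : TypedPartition k)

/-- The entry of `w_λ` in position `k + j`. -/
noncomputable def entry (j : ℕ) : ℤ := lam.weyl (k + j : ℕ)

theorem weyl_neg (a : ℤ) : lam.weyl (-a) = -lam.weyl a := lam.corresponds_weyl.1.1 a

theorem weyl_zero : lam.weyl 0 = 0 := by
  have := lam.weyl_neg 0
  rw [neg_zero] at this
  omega

theorem weyl_ne_zero {a : ℤ} (h : a ≠ 0) : lam.weyl a ≠ 0 := by
  intro h0
  rw [← lam.weyl_zero] at h0
  exact h (lam.weyl.injective h0)

theorem abs_weyl_ne {a b : ℤ} (ha : 0 < a) (hb : 0 < b) (h : a ≠ b) :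
    |lam.weyl a| ≠ |lam.weyl b| := by
  intro h0
  rcases abs_eq_abs.1 h0 with h1 | h1
  · exact h (lam.weyl.injective h1)
  · rw [← weyl_neg] at h1
    have := lam.weyl.injective h1
    omega

theorem entry_ne_zero {j : ℕ} (h : 1 ≤ j) : lam.entry j ≠ 0 :=
  lam.weyl_ne_zero (by omega)

theorem entry_lt_succ {j : ℕ} (h : 1 ≤ j) : lam.entry j < lam.entry (j + 1) := by
  have := lam.corresponds_weyl.2.1.2.2 (k + j) (by omega)
  simpa [entry, add_assoc] using this

theorem entry_lt {i j : ℕ} (h : 1 ≤ i) (hij : i < j) : lam.entry i < lam.entry j := by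
  induction j, hij using Nat.le_induction with
  | base => exact lam.entry_lt_succ h
  | succ j hj ih => exact ih.trans (lam.entry_lt_succ (by omega))

theorem abs_entry_ne {i j : ℕ} (hi : 1 ≤ i) (hj : 1 ≤ j) (hij : i ≠ j) :
    |lam.entry i| ≠ |lam.entry j| :=
  lam.abs_weyl_ne (by have := NeZero.pos k; omega) (by have := NeZero.pos k; omega) (by omega)

theorem part_of_entry_neg {j : ℕ} (h : 1 ≤ j) (hv : lam.entry j < 0) :
    (lam.part j : ℤ) = k - 1 - lam.entry j := by
  have h1 : (lam.part j : ℤ) = k - 1 + |lam.entry j| := lam.corresponds_weyl.2.2.1 j h hv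
  rw [h1, abs_of_neg hv]
  ring

theorem part_of_entry_pos {j : ℕ} (h : 1 ≤ j) (hv : 0 < lam.entry j) :
    lam.part j = ((Finset.Icc 1 k).filter (fun p : ℕ => lam.entry j < |lam.weyl p|)).card :=
  lam.corresponds_weyl.2.2.2.1 j h hv

theorem part_le_of_entry_pos {j : ℕ} (h : 1 ≤ j) (hv : 0 < lam.entry j) : lam.part j ≤ k := by
  rw [lam.part_of_entry_pos h hv]
  exact (Finset.card_filter_le _ _).trans (by simp)

theorem type_pos_iff_weyl : 0 < lam.type ↔ 1 < |lam.weyl 1| := lam.corresponds_weyl.2.2.2.2.1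

theorem type_eq (h : 0 < lam.type) : lam.type = if 0 < lam.weyl 1 then 1 else 2 :=
  lam.corresponds_weyl.2.2.2.2.2 h

theorem abs_weyl_one_lt {p : ℕ} (h : 2 ≤ p) (hp : p ≤ k) : |lam.weyl 1| < lam.weyl p := by
  induction p, h using Nat.le_induction with
  | base => exact lam.corresponds_weyl.2.1.1 hp
  | succ p h2 ih =>
    have := lam.corresponds_weyl.2.1.2.1 p h2 (by omega)
    push_cast
    exact (ih (by omega)).trans this

theorem entry_le_neg_two_iff {j : ℕ} (h : 1 ≤ j) : lam.entry j ≤ -2 ↔ j < lam.mid := by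
  rw [mid, Nat.lt_succ_iff, lam.le_numLarge_iff h]
  rcases lt_or_gt_of_ne (lam.entry_ne_zero h) with hv | hv
  · have := lam.part_of_entry_neg h hv
    omega
  · have := lam.part_le_of_entry_pos h hv
    omega

theorem eq_mid_of_abs_entry {j : ℕ} (h : 1 ≤ j) (hv : |lam.entry j| = 1) : j = lam.mid := by
  have h1 : ¬ lam.entry j ≤ -2 := by
    rcases abs_eq (by norm_num : (0 : ℤ) ≤ 1) |>.1 hv with h | h <;> omega
  rw [lam.entry_le_neg_two_iff h] at h1
  by_contra hne
  have hm := lam.mid_pos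
  have h2 : ¬ lam.entry lam.mid ≤ -2 := by
    rw [lam.entry_le_neg_two_iff hm]; omega
  have h3 := lam.entry_lt hm (show lam.mid < j by omega)
  have h4 := lam.entry_ne_zero hm
  have h5 := lam.abs_entry_ne hm h (by omega)
  rcases abs_eq (by norm_num : (0 : ℤ) ≤ 1) |>.1 hv with h | h
  · have h6 : lam.entry lam.mid = -1 := by omega
    rw [h6, h] at h5
    norm_num at h5
  · omega

theorem type_pos_of_abs_entry {j : ℕ} (h : 1 ≤ j) (hv : |lam.entry j| = 1) : 0 < lam.type := by
  rw [type_pos_iff_weyl]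
  have h1 := lam.abs_weyl_ne (a := 1) (b := (k + j : ℕ)) (by norm_num) (by omega)
    (by have := NeZero.pos k; omega)
  have h2 : 0 < |lam.weyl 1| := abs_pos.2 (lam.weyl_ne_zero (by norm_num))
  change |lam.weyl 1| ≠ |lam.entry j| at h1
  omega

theorem abs_entry_mid (h : 0 < lam.type) : |lam.entry lam.mid| = 1 := by
  rw [type_pos_iff_weyl] at h
  obtain ⟨a, ha⟩ := lam.weyl.surjective 1
  obtain ⟨n, hn⟩ := Int.eq_nat_or_neg a
  have h1 : |lam.weyl n| = 1 := by
    rcases hn with rfl | rfl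
    · rw [ha]; norm_num
    · rw [lam.weyl_neg] at ha
      rw [show lam.weyl n = -1 by omega]; norm_num
  have hkn : k < n := by
    by_contra hcon
    by_cases hn0 : n = 0
    · subst hn0
      rw [Nat.cast_zero, weyl_zero] at h1
      norm_num at h1
    by_cases hn1 : n = 1
    · subst hn1
      norm_num at h1
      omega
    · have := lam.abs_weyl_one_lt (p := n) (by omega) (by omega)
      rw [abs_of_pos (by omega)] at h1
      omega
  have h2 : |lam.entry (n - k)| = 1 := by
    rw [entry, show k + (n - k) = n by omega]
    exact h1
  rw [← lam.eq_mid_of_abs_entry (by omega) h2]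
  exact h2

theorem one_lt_entry {j : ℕ} (h : 1 ≤ j) (hj : lam.mid < j ∨ (lam.type = 0 ∧ lam.mid ≤ j)) :
    1 < lam.entry j := by
  have h1 : ¬ lam.entry j ≤ -2 := by
    rw [lam.entry_le_neg_two_iff h]; omega
  have h2 := lam.entry_ne_zero h
  by_contra hcon
  have h3 : |lam.entry j| = 1 := by
    rw [abs_eq (by norm_num)]
    omega
  have h4 := lam.eq_mid_of_abs_entry h h3
  have h5 := lam.type_pos_of_abs_entry h h3
  omega

theorem part_mid (h : 0 < lam.type) : lam.part lam.mid = k := by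
  have h1 := lam.abs_entry_mid h
  have hm := lam.mid_pos
  rcases abs_eq (by norm_num : (0 : ℤ) ≤ 1) |>.1 h1 with h2 | h2
  · rw [lam.part_of_entry_pos hm (by omega), h2, Finset.filter_true_of_mem]
    · simp
    · intro p hp
      rw [Finset.mem_Icc] at hp
      have h3 := lam.type_pos_iff_weyl.1 h
      by_cases hp1 : p = 1
      · subst hp1; exact_mod_cast h3
      · have h4 := lam.abs_weyl_one_lt (p := p) (by omega) hp.2
        exact lt_of_lt_of_le (by omega) (le_abs_self _)
  · have := lam.part_of_entry_neg hm (by omega)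
    omega

theorem le_part_of_entry_lt_two {j : ℕ} (h : 1 ≤ j) (hv : lam.entry j < 2) : k ≤ lam.part j := by
  rcases lt_or_gt_of_ne (lam.entry_ne_zero h) with hv' | hv'
  · have := lam.part_of_entry_neg h hv'
    omega
  · have h1 : |lam.entry j| = 1 := by rw [abs_of_pos hv']; omega
    rw [lam.eq_mid_of_abs_entry h h1, lam.part_mid (lam.type_pos_of_abs_entry h h1)]

theorem le_length_of_entry_lt_two {j : ℕ} (h : 1 ≤ j) (hv : lam.entry j < 2) :
    j ≤ lam.length := by
  by_contra hcon
  have h1 := lam.part_eq_zero (j := j) (by omega)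
  have h2 := lam.le_part_of_entry_lt_two h hv
  have := NeZero.pos k
  omega

/-- The parity condition on `w_λ` in terms of the number of negative entries in positions
greater than `k`. -/
theorem even_card_negative (N : ℕ) (hN : ∀ j, 1 ≤ j → (lam.entry j < 0 ↔ j ≤ N)) :
    Even ((if lam.weyl 1 < 0 then 1 else 0) + N) := by
  classical
  have h := lam.corresponds_weyl.1.2.2
  have hk := NeZero.pos k
  have e : {a : ℤ | 0 < a ∧ lam.weyl a < 0} =
      (((if lam.weyl 1 < 0 then {1} else ∅) ∪
        (Finset.Icc 1 N).image (fun j : ℕ => ((k + j : ℕ) : ℤ)) : Finset ℤ) : Set ℤ) := by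
    ext a
    simp only [Set.mem_ofPred_eq, Finset.coe_union, Set.mem_union, Finset.mem_coe,
      Finset.mem_image, Finset.mem_Icc]
    constructor
    · rintro ⟨ha, hw⟩
      obtain ⟨n, rfl⟩ := Int.eq_ofNat_of_zero_le ha.le
      by_cases hnk : k < n
      · right
        refine ⟨n - k, ⟨by omega, (hN _ (by omega)).1 ?_⟩, by omega⟩
        rw [entry, show k + (n - k) = n by omega]
        exact hw
      · left
        by_cases hn1 : n = 1
        · subst hn1
          rw [Nat.cast_one] at hw
          rw [if_pos hw]
          simp
        · have h1 := lam.abs_weyl_one_lt (p := n) (by omega) (by omega)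
          have h2 := abs_nonneg (lam.weyl 1)
          omega
    · rintro (h1 | ⟨j, hj, rfl⟩)
      · split_ifs at h1 with h2
        · rw [Finset.mem_singleton] at h1
          subst h1
          exact ⟨by norm_num, h2⟩
        · simp at h1
      · exact ⟨by omega, (hN j hj.1).2 hj.2⟩
  rw [e, Set.ncard_coe_finset, Finset.card_union_of_disjoint, Finset.card_image_of_injective,
    Nat.card_Icc] at h
  · convert h using 2
    · split_ifs <;> simp
    · omega
  · intro a b hab
    simpa using hab
  · rw [Finset.disjoint_left]
    intro a ha hb
    rw [Finset.mem_image] at hb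
    obtain ⟨j, hj, rfl⟩ := hb
    rw [Finset.mem_Icc] at hj
    split_ifs at ha
    · rw [Finset.mem_singleton] at ha
      omega
    · simp at ha

/-- The type is determined by the entry `±1` in the positions greater than `k` and by the parity
of its position. -/
theorem type_eq_one_iff (h : 0 < lam.type) :
    lam.type = 1 ↔ (lam.entry lam.mid = 1 ↔ Odd lam.mid) := by
  have hm := lam.mid_pos
  have h1 := lam.abs_entry_mid h
  have h0 := lam.weyl_ne_zero (a := 1) (by norm_num)
  have ht : lam.type = 1 ↔ ¬ lam.weyl 1 < 0 := by
    rw [lam.type_eq h]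
    split_ifs with h2
    · exact ⟨fun _ => by omega, fun _ => rfl⟩
    · exact ⟨fun h3 => by omega, fun h3 => by omega⟩
  rw [ht]
  have hle : ∀ j, 1 ≤ j → (lam.entry j ≤ -2 ↔ j < lam.mid) :=
    fun j hj => lam.entry_le_neg_two_iff hj
  rcases abs_eq (by norm_num : (0 : ℤ) ≤ 1) |>.1 h1 with h2 | h2
  · have h3 := lam.even_card_negative (lam.mid - 1) (by
      intro j hj
      have := hle j hj
      have h4 : lam.entry j ≠ -1 := by
        intro h5
        have h6 := lam.eq_mid_of_abs_entry hj (by rw [h5]; norm_num)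
        rw [h6, h2] at h5
        norm_num at h5
      omega)
    simp only [h2, true_iff]
    split_ifs at h3 with h4
    · simp only [h4, not_true, false_iff]
      rw [Nat.not_odd_iff_even]
      rwa [show 1 + (lam.mid - 1) = lam.mid by omega] at h3
    · simp only [h4, not_false_iff, true_iff]
      rw [zero_add] at h3
      have := h3.add_one
      rwa [Nat.sub_add_cancel hm] at this
  · have h3 := lam.even_card_negative lam.mid (by
      intro j hj
      have := hle j hj
      by_cases hj' : j = lam.mid
      · subst hj'; omega
      · have h4 : lam.entry j ≠ -1 := by
          intro h5
          exact hj' (lam.eq_mid_of_abs_entry hj (by rw [h5]; norm_num))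
        omega)
    have h5 : ¬ lam.entry lam.mid = 1 := by omega
    simp only [h5, false_iff, Nat.not_odd_iff_even]
    split_ifs at h3 with h4
    · simp only [h4, not_true, false_iff]
      intro h6
      have := h6.one_add
      rw [← Nat.not_even_iff_odd] at this
      exact this h3
    · simp only [h4, not_false_iff, true_iff]
      rwa [zero_add] at h3

end TypedPartition

/-! ### The generating series of the double eta polynomials -/

/-- The series `(1 - X) / (1 + X)` if `s < 0`, and `1 - X` otherwise; `s` is the sum of two entries
of `w`. -/
noncomputable def raiseSer (B : Type*) [CommRing B] (s : ℤ) : PowerSeries B :=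
  if s < 0 then (1 - PowerSeries.X) * geo 1 else 1 - PowerSeries.X

theorem map_raiseSer {B B' : Type*} [CommRing B] [CommRing B'] (φ : B →+* B') (s : ℤ) :
    PowerSeries.map φ (raiseSer B s) = raiseSer B' s := by
  unfold raiseSer
  split_ifs <;> simp [map_geo]

theorem coeff_zero_raiseSer {B : Type*} [CommRing B] (s : ℤ) :
    PowerSeries.coeff 0 (raiseSer B s) = 1 := by
  unfold raiseSer
  split_ifs <;> simp [geo]

theorem inv_one_add_X_eq_geo : (1 + PowerSeries.X : PowerSeries ℚ)⁻¹ = geo 1 := by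
  rw [PowerSeries.inv_eq_iff_mul_eq_one (by simp)]
  simpa using geo_mul (1 : ℚ)

/-- The exponent of `∏ u_i^{λ_i}`, with `u_i = y_1 ⋯ y_i`. -/
noncomputable def partExp (L : ℕ) (part : ℕ → ℕ) : ℕ →₀ ℕ :=
  ∑ i ∈ Finset.Icc 1 L, part i • wt 0 i

theorem partExp_apply (L : ℕ) (part : ℕ → ℕ) (a : ℕ) : partExp L part a
    = if 1 ≤ a then ∑ i ∈ Finset.Icc a L, part i else 0 := by
  rw [partExp, Finsupp.finsetSum_apply]
  simp only [Finsupp.smul_apply, wt_apply, smul_eq_mul, mul_ite, mul_one, mul_zero]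
  rw [← Finset.sum_filter]
  split_ifs with ha
  · refine Finset.sum_congr ?_ fun _ _ => rfl
    ext i
    simp only [Finset.mem_filter, Finset.mem_Icc]
    omega
  · refine Finset.sum_eq_zero fun i hi => ?_
    simp only [Finset.mem_filter, Finset.mem_Icc] at hi
    omega

/-- The contribution of a position `i` which no raising operator involves: a multiple of the
monomial `u_i^{λ_i}`, where `u_i = y_1 ⋯ y_i` is encoded by the exponent `wt 0 i`. -/
noncomputable def corrTerm (k : ℕ) (part : ℕ → ℕ) (v : ℕ → ℤ) (i : ℕ) :
    MvPowerSeries ℕ (PolyBT ℚ) :=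
  MvPowerSeries.monomial (part i • wt 0 i) (entryCorr k i (v i))

/-- The series of the factor at position `i`, in the monomial `u_i`. -/
noncomputable def entryTerm (k : ℕ) (v : ℕ → ℤ) (i : ℕ) : MvPowerSeries ℕ (PolyBT ℚ) :=
  evMono (wt 0 i) (entrySer k (v i))

/-- The series of the raising operator `R_{ij}`, which acts on generating series as multiplication
by `u_j / u_i = y_{i+1} ⋯ y_j`. -/
noncomputable def pairTerm (v : ℕ → ℤ) (i j : ℕ) : MvPowerSeries ℕ (PolyBT ℚ) :=
  evMono (wt i j) (raiseSer (PolyBT ℚ) (v i + v j))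

/-- The generating series, whose coefficient at `∏ u_i^{λ_i}` is the double eta polynomial. -/
noncomputable def etaSer (k L : ℕ) (part : ℕ → ℕ) (v : ℕ → ℤ) : MvPowerSeries ℕ (PolyBT ℚ) :=
  subsetSum (Finset.Icc 1 L) (corrTerm k part v) (entryTerm k v) (pairTerm v)

/-- Enlarging the set of positions by one with part zero does not change the coefficient. -/
theorem coeff_etaSer_succ (k L : ℕ) [NeZero k] (part : ℕ → ℕ) (v : ℕ → ℤ) (hp : part (L + 1) = 0)
    (hv : 1 < v (L + 1)) :
    MvPowerSeries.coeff (partExp (L + 1) part) (etaSer k (L + 1) part v)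
      = MvPowerSeries.coeff (partExp L part) (etaSer k L part v) := by
  have he : partExp (L + 1) part = partExp L part := by
    rw [partExp, ← Finset.insert_Icc_right_eq_Icc_add_one (by omega), Finset.sum_insert (by simp),
      hp, zero_smul, zero_add, partExp]
  obtain ⟨τ, hτ⟩ : ∃ τ, τ = partExp L part := ⟨_, rfl⟩
  have hτ0 : τ (L + 1) = 0 := by
    rw [hτ, partExp_apply, if_pos (by omega), Finset.Icc_eq_empty (by omega), Finset.sum_empty]
  -- series in a monomial divisible by `y_{L+1}` only contribute their constant term
  have key : ∀ i, i < L + 1 → ∀ f : PowerSeries (PolyBT ℚ), PowerSeries.coeff 0 f = 1 →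
      EqUpTo τ (evMono (wt i (L + 1)) f) 1 := by
    intro i hi f hf m hm
    have hm0 : m (L + 1) = 0 := by
      have := hm (L + 1)
      omega
    classical
    by_cases h : m = 0
    · subst h
      have := coeff_evMono_smul (wt_ne_zero hi) f 0
      rw [zero_smul] at this
      rw [this, hf]
      simp
    · rw [coeff_evMono_of_forall_ne (wt_ne_zero hi), MvPowerSeries.coeff_one, if_neg h]
      intro n hn
      have h1 := DFunLike.congr_fun hn (L + 1)
      rw [hm0, Finsupp.smul_apply, wt_apply, if_pos ⟨hi, le_rfl⟩, smul_eq_mul, mul_one] at h1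
      rw [← h1, zero_smul] at hn
      exact h hn
  rw [he, ← hτ, etaSer, ← Finset.insert_Icc_right_eq_Icc_add_one (by omega),
    subsetSum_insert _ _ _ (by simp), etaSer, subsetSum, map_sum, map_sum]
  refine Finset.sum_congr rfl fun T hT => ?_
  rw [Finset.mem_powerset] at hT
  have h1 : corrTerm k part v (L + 1) = 0 := by
    rw [corrTerm, entryCorr_of_one_lt k _ hv, map_zero]
  have h2 : EqUpTo τ (entryTerm k v (L + 1)) 1 := by
    refine key 0 (by omega) _ ?_
    rw [entrySer_of_one_lt k hv]
    simp only [cSer, PowerSeries.coeff_mk, cUp]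
    norm_num
    rw [cPoly, if_pos (by have := NeZero.pos k; omega)]
    obtain ⟨n, hn⟩ := Int.eq_ofNat_of_zero_le (show 0 ≤ v (L + 1) by omega)
    have h3 : hNeg ℚ (v (L + 1)) 0 = PowerSeries.coeff 0 (hSer ℚ (v (L + 1))) := by
      rw [hSer, PowerSeries.coeff_mk]
    rw [h3, hn, hSer_natCast, PowerSeries.coeff_zero_eq_constantCoeff, map_prod]
    simp [geo, bPoly, ← PowerSeries.coeff_zero_eq_constantCoeff_apply]
  have h4 : EqUpTo τ (linkProd (pairTerm v) (L + 1) T) 1 := by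
    have h5 : EqUpTo τ (linkProd (pairTerm v) (L + 1) T) (∏ j ∈ T, 1) := by
      refine EqUpTo.prod fun j hj => ?_
      have hj' := hT hj
      rw [Finset.mem_Icc] at hj'
      rw [min_eq_right (by omega), max_eq_left (by omega)]
      exact key j (by omega) _ (coeff_zero_raiseSer _)
    rwa [Finset.prod_const_one] at h5
  have h6 := ((EqUpTo.refl τ (subsetTerm (Finset.Icc 1 L) (corrTerm k part v) (entryTerm k v)
    (pairTerm v) T)).mul (h2.mul h4)) τ le_rfl
  rw [one_mul, mul_one] at h6
  rw [h1, zero_add, h6]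

namespace TypedPartition

variable {k : ℕ}

/-! ### Raising operators as exponents -/

section Raised

variable (lam : TypedPartition k)

/-- The raising operator with exponents `n` involves no factor with index `i`. -/
def Avoids (n : ℕ × ℕ →₀ ℕ) (i : ℕ) : Prop := ∀ p, n p ≠ 0 → p.1 ≠ i ∧ p.2 ≠ i

theorem mem_pairs {p : ℕ × ℕ} : p ∈ lam.pairs ↔ 1 ≤ p.1 ∧ p.1 < p.2 ∧ p.2 ≤ lam.length := by
  simp only [pairs, Finset.mem_filter, Finset.mem_product, Finset.mem_Icc]
  omega

theorem mem_pairs_of_ne_zero {n : ℕ × ℕ →₀ ℕ} (hn : n.support ⊆ lam.pairs) {p : ℕ × ℕ}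
    (h : n p ≠ 0) : 1 ≤ p.1 ∧ p.1 < p.2 ∧ p.2 ≤ lam.length :=
  lam.mem_pairs.1 (hn (Finsupp.mem_support_iff.2 h))

theorem raised_of_avoids {n : ℕ × ℕ →₀ ℕ} {i : ℕ} (h : Avoids n i) :
    lam.raised n i = lam.part i := by
  rw [raised, Finset.sum_eq_zero, add_zero]
  intro j _
  have h1 : n (i, j) = 0 := by
    by_contra h0
    exact (h _ h0).1 rfl
  have h2 : n (j, i) = 0 := by
    by_contra h0
    exact (h _ h0).2 rfl
  rw [h1, h2]
  simp

/-- The exponent of `∏ (u_j / u_i)^{n_{ij}}`. -/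
noncomputable def pairExp (n : ℕ × ℕ →₀ ℕ) : ℕ →₀ ℕ := ∑ p ∈ lam.pairs, n p • wt p.1 p.2

theorem pairExp_apply (n : ℕ × ℕ →₀ ℕ) (a : ℕ) : lam.pairExp n a
    = ∑ p ∈ lam.pairs, if p.1 < a ∧ a ≤ p.2 then n p else 0 := by
  rw [pairExp, Finsupp.finsetSum_apply]
  simp only [Finsupp.smul_apply, wt_apply, smul_eq_mul, mul_ite, mul_one, mul_zero]

/-- The exponents of `∏ u_i^{λ_i}` are the partial sums `λ_a + ⋯ + λ_ℓ`. Applying a raising operator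
changes them by the exponents of the corresponding monomial in the quotients `u_j / u_i`. -/
theorem sum_raised {n : ℕ × ℕ →₀ ℕ} (hn : n.support ⊆ lam.pairs) {a : ℕ} (ha : 1 ≤ a) :
    ∑ i ∈ Finset.Icc a lam.length, (lam.part i : ℤ)
      = lam.pairExp n a + ∑ i ∈ Finset.Icc a lam.length, lam.raised n i := by
  obtain ⟨I, hI⟩ : ∃ I, I = Finset.Icc 1 lam.length := ⟨_, rfl⟩
  have hsub : Finset.Icc a lam.length = I.filter (fun i => a ≤ i) := by
    ext i
    simp only [hI, Finset.mem_filter, Finset.mem_Icc]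
    omega
  have h1 : ∑ i ∈ Finset.Icc a lam.length, ∑ j ∈ I, ((n (i, j) : ℤ) - n (j, i))
      = ∑ p ∈ I ×ˢ I, (n p : ℤ) * ((if a ≤ p.1 then 1 else 0) - (if a ≤ p.2 then 1 else 0)) := by
    rw [hsub, Finset.sum_filter]
    simp only [mul_sub, Finset.sum_sub_distrib]
    rw [Finset.sum_product, Finset.sum_product_right, ← Finset.sum_sub_distrib]
    refine Finset.sum_congr rfl fun i _ => ?_
    split_ifs <;> simp
  have h2 : (lam.pairExp n a : ℤ)
      = -∑ p ∈ I ×ˢ I,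
        (n p : ℤ) * ((if a ≤ p.1 then 1 else 0) - (if a ≤ p.2 then 1 else 0)) := by
    rw [pairExp_apply, ← Finset.sum_neg_distrib]
    push_cast
    rw [← Finset.sum_subset (s₁ := lam.pairs) (s₂ := I ×ˢ I)]
    · refine Finset.sum_congr rfl fun p hp => ?_
      rw [mem_pairs] at hp
      split_ifs <;> omega
    · intro p hp
      rw [hI]
      rw [mem_pairs] at hp
      simp only [Finset.mem_product, Finset.mem_Icc]
      omega
    · intro p _ hp
      have : n p = 0 := by
        by_contra h0
        exact hp (hn (Finsupp.mem_support_iff.2 h0))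
      rw [this]
      simp
  simp only [raised, ← hI, Finset.sum_add_distrib]
  rw [h1, h2]
  ring

end Raised

variable [NeZero k] (lam : TypedPartition k)

open Classical in
/-- The `i`-th factor of the contribution of a raising operator, with the powers of `2`
distributed over the factors. -/
noncomputable def evenFactor (n : ℕ × ℕ →₀ ℕ) (i : ℕ) : PolyBT ℚ :=
  zcoeff (entrySer k (lam.entry i)) (lam.raised n i)
    + if Avoids n i then entryCorr k i (lam.entry i) else 0

/-- The coefficient of `R_p^n` in the factor of the raising operator expression for the pair
`p`. -/
noncomputable def pairCoeff (p : ℕ × ℕ) (n : ℕ) : PolyBT ℚ :=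
  PowerSeries.coeff n (raiseSer (PolyBT ℚ) (lam.entry p.1 + lam.entry p.2))

/-- The contribution of a raising operator to the double eta polynomial. -/
noncomputable def evenTerm (n : ℕ × ℕ →₀ ℕ) : PolyBT ℚ :=
  (∏ p ∈ lam.pairs, lam.pairCoeff p (n p)) * ∏ i ∈ Finset.Icc 1 lam.length, lam.evenFactor n i

theorem evenFactor_of_raised_neg {n : ℕ × ℕ →₀ ℕ} {i : ℕ} (h : lam.raised n i < 0) :
    lam.evenFactor n i = 0 := by
  rw [evenFactor, zcoeff, if_neg (by omega), if_neg, add_zero]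
  intro h1
  rw [lam.raised_of_avoids h1] at h
  omega

/-- Only finitely many raising operators contribute: a large exponent of `R_{ij}` makes one of the
indices from `j` on negative. -/
theorem evenTerm_eq_zero {n : ℕ × ℕ →₀ ℕ} (hn : n.support ⊆ lam.pairs) {p : ℕ × ℕ}
    (hp : lam.size < n p) : lam.evenTerm n = 0 := by
  have hp' := lam.mem_pairs_of_ne_zero hn (p := p) (by omega)
  have h1 := lam.sum_raised hn (a := p.2) (by omega)
  have h2 : n p ≤ lam.pairExp n p.2 := by
    rw [pairExp_apply]
    have := Finset.single_le_sum (s := lam.pairs)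
      (f := fun q => if q.1 < p.2 ∧ p.2 ≤ q.2 then n q else 0) (fun _ _ => Nat.zero_le _)
      (lam.mem_pairs.2 hp')
    rwa [if_pos ⟨hp'.2.1, le_rfl⟩] at this
  have h3 : ∑ i ∈ Finset.Icc p.2 lam.length, lam.part i ≤ lam.size := by
    rw [lam.size_eq_sum le_rfl]
    refine Finset.sum_le_sum_of_subset ?_
    intro i
    simp only [Finset.mem_Icc]
    omega
  have h4 : ∑ i ∈ Finset.Icc p.2 lam.length, lam.raised n i < 0 := by
    have : (∑ i ∈ Finset.Icc p.2 lam.length, (lam.part i : ℤ)) ≤ lam.size := by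
      exact_mod_cast h3
    omega
  obtain ⟨i, hi, hneg⟩ : ∃ i ∈ Finset.Icc p.2 lam.length, lam.raised n i < 0 := by
    by_contra hcon
    push Not at hcon
    have := Finset.sum_nonneg hcon
    omega
  rw [Finset.mem_Icc] at hi
  rw [evenTerm, Finset.prod_eq_zero (Finset.mem_Icc.2 ⟨by omega, hi.2⟩)
    (lam.evenFactor_of_raised_neg hneg), mul_zero]

/-- The coefficient of the generating series, expanded over the raising operators. The sum over the
subsets `T` of positions becomes the expansion of `∏ (series + correction)`: an operator which
involves some position outside `T` does not occur in the term of `T`. -/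
theorem coeff_partExp_etaSer : MvPowerSeries.coeff (partExp lam.length lam.part)
      (etaSer k lam.length lam.part lam.entry)
    = ∑ n ∈ lam.pairs.finsupp (fun _ => Finset.range (lam.size + 1)), lam.evenTerm n := by
  classical
  obtain ⟨τ, hτ⟩ : ∃ τ, τ = partExp lam.length lam.part := ⟨_, rfl⟩
  obtain ⟨I, hI⟩ : ∃ I, I = Finset.Icc 1 lam.length := ⟨_, rfl⟩
  have hD : ∀ a, τ a < lam.size + 1 := by
    intro a
    rw [hτ, partExp_apply, Nat.lt_succ_iff]
    split_ifs
    · rw [lam.size_eq_sum le_rfl]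
      refine Finset.sum_le_sum_of_subset ?_
      intro i
      simp only [Finset.mem_Icc]
      omega
    · omega
  rw [← hτ, etaSer, subsetSum, map_sum, ← hI]
  -- the contribution of one subset of positions
  have hT : ∀ T ∈ I.powerset, MvPowerSeries.coeff τ (subsetTerm I (corrTerm k lam.part lam.entry)
      (entryTerm k lam.entry) (pairTerm lam.entry) T)
      = ∑ n ∈ lam.pairs.finsupp (fun _ => Finset.range (lam.size + 1)),
        (∏ p ∈ lam.pairs, lam.pairCoeff p (n p)) *
        ((∏ i ∈ T, zcoeff (entrySer k (lam.entry i)) (lam.raised n i)) *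
          ∏ i ∈ I \ T, if Avoids n i then entryCorr k i (lam.entry i) else 0) := by
    intro T hT
    rw [Finset.mem_powerset] at hT
    obtain ⟨g, hg⟩ : ∃ g : ℕ → PowerSeries (PolyBT ℚ), g = fun i =>
      if i ∈ T then entrySer k (lam.entry i)
      else PowerSeries.C (entryCorr k i (lam.entry i)) * PowerSeries.X ^ lam.part i := ⟨_, rfl⟩
    obtain ⟨f, hf⟩ : ∃ f : ℕ × ℕ → PowerSeries (PolyBT ℚ), f = fun p =>
      if p.1 ∈ T ∧ p.2 ∈ T then raiseSer (PolyBT ℚ) (lam.entry p.1 + lam.entry p.2)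
      else 1 := ⟨_, rfl⟩
    have hwt : ∀ i ∈ I, wt 0 i ≠ 0 := by
      intro i hi
      rw [hI, Finset.mem_Icc] at hi
      exact wt_ne_zero (by omega)
    have hwt2 : ∀ p ∈ lam.pairs, wt p.1 p.2 ≠ 0 := fun p hp =>
      wt_ne_zero (lam.mem_pairs.1 hp).2.1
    have e1 : (∏ i ∈ I \ T, corrTerm k lam.part lam.entry i) * ∏ i ∈ T, entryTerm k lam.entry i
        = ∏ i ∈ I, evMono (wt 0 i) (g i) := by
      rw [← Finset.prod_sdiff hT]
      congr 1
      · refine Finset.prod_congr rfl fun i hi => ?_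
        rw [Finset.mem_sdiff] at hi
        simp only [hg, if_neg hi.2]
        rw [evMono_mul (hwt i hi.1), evMono_C, corrTerm]
        have : (PowerSeries.X ^ lam.part i : PowerSeries (PolyBT ℚ))
            = ∏ _j ∈ Finset.range (lam.part i), PowerSeries.X := by simp
        rw [this, evMono_prod (hwt i hi.1), Finset.prod_const, Finset.card_range,
          evMono_X (hwt i hi.1), monomial_one_pow, ← MvPowerSeries.monomial_zero_eq_C_apply,
          MvPowerSeries.monomial_mul_monomial, zero_add, mul_one]
      · refine Finset.prod_congr rfl fun i hi => ?_
        simp only [hg, if_pos hi]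
        rfl
    have e2 : pairProd (pairTerm lam.entry) T = ∏ p ∈ lam.pairs, evMono (wt p.1 p.2) (f p) := by
      have h1 : pairProd (pairTerm lam.entry) T
          = ∏ p ∈ (T ×ˢ T).filter (fun p => p.1 < p.2), pairTerm lam.entry p.1 p.2 := by
        rw [Finset.prod_filter, Finset.prod_product, pairProd]
      rw [h1]
      refine Finset.prod_subset_one_on_sdiff ?_ ?_ ?_
      · intro p hp
        simp only [Finset.mem_filter, Finset.mem_product] at hp
        have h2 := hT hp.1.1
        have h3 := hT hp.1.2
        rw [hI, Finset.mem_Icc] at h2 h3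
        exact lam.mem_pairs.2 ⟨h2.1, hp.2, h3.2⟩
      · intro p hp
        rw [Finset.mem_sdiff] at hp
        have h2 := lam.mem_pairs.1 hp.1
        have h3 : ¬ (p.1 ∈ T ∧ p.2 ∈ T) := by
          intro h
          exact hp.2 (Finset.mem_filter.2 ⟨Finset.mem_product.2 h, h2.2.1⟩)
        simp only [hf, if_neg h3]
        exact evMono_one (hwt2 p hp.1)
      · intro p hp
        simp only [Finset.mem_filter, Finset.mem_product] at hp
        simp only [hf, if_pos hp.1]
        rfl
    have e3 := ((EqUpTo.refl τ (∏ i ∈ I, evMono (wt 0 i) (g i))).mul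
      (eqUpTo_prod_evMono hD lam.pairs (fun p => wt p.1 p.2) hwt2 f)) τ le_rfl
    rw [subsetTerm, e1, e2, e3, Finset.mul_sum, map_sum]
    refine Finset.sum_congr rfl fun n hn => ?_
    have hns : n.support ⊆ lam.pairs := (Finset.mem_finsupp_iff.1 hn).1
    have e4 : MvPowerSeries.coeff τ (MvPowerSeries.monomial (lam.pairExp n) 1 *
        ∏ i ∈ I, evMono (wt 0 i) (g i)) = ∏ i ∈ I, zcoeff (g i) (lam.raised n i) := by
      rw [hI]
      refine coeff_monomial_mul_prod_evMono _ _ _ _ _ ?_ ?_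
      · intro a ha
        rw [Finset.mem_Icc] at ha
        rw [← lam.sum_raised hns ha.1, hτ, partExp_apply, if_pos ha.1]
        push_cast
        rfl
      · intro a ha
        rw [Finset.mem_Icc] at ha
        rw [hτ, partExp_apply, pairExp_apply, Finset.sum_eq_zero (s := lam.pairs)]
        · split_ifs
          · rw [Finset.Icc_eq_empty (by omega), Finset.sum_empty]
          · rfl
        · intro p hp
          have := lam.mem_pairs.1 hp
          rw [if_neg (by omega)]
    have e5 : MvPowerSeries.monomial (∑ p ∈ lam.pairs, n p • wt p.1 p.2)
        (∏ p ∈ lam.pairs, PowerSeries.coeff (n p) (f p))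
        = MvPowerSeries.C (∏ p ∈ lam.pairs, PowerSeries.coeff (n p) (f p)) *
          MvPowerSeries.monomial (lam.pairExp n) 1 := by
      rw [← MvPowerSeries.monomial_zero_eq_C_apply, MvPowerSeries.monomial_mul_monomial, zero_add,
        mul_one, pairExp]
    rw [e5, mul_left_comm, MvPowerSeries.coeff_C_mul, mul_comm (∏ i ∈ I, _), e4]
    by_cases hsub : ∀ p, n p ≠ 0 → p.1 ∈ T ∧ p.2 ∈ T
    · congr 1
      · refine Finset.prod_congr rfl fun p hp => ?_
        simp only [hf, pairCoeff]
        split_ifs with h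
        · rfl
        · have h0 : n p = 0 := by
            by_contra h0
            exact h (hsub p h0)
          rw [h0, coeff_zero_raiseSer]
          simp
      · rw [← Finset.prod_sdiff hT, mul_comm]
        congr 1
        · refine Finset.prod_congr rfl fun i hi => ?_
          simp only [hg, if_pos hi]
        · refine Finset.prod_congr rfl fun i hi => ?_
          rw [Finset.mem_sdiff] at hi
          have hav : Avoids n i := by
            intro p hp
            have := hsub p hp
            refine ⟨?_, ?_⟩
            · rintro rfl; exact hi.2 this.1
            · rintro rfl; exact hi.2 this.2
          simp only [hg, if_neg hi.2]
          rw [if_pos hav, lam.raised_of_avoids hav, zcoeff_natCast, PowerSeries.coeff_C_mul,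
            PowerSeries.coeff_X_pow_self, mul_one]
    · push Not at hsub
      obtain ⟨p, hp0, hp⟩ := hsub
      have hpm := lam.mem_pairs_of_ne_zero hns hp0
      have h1 : ∏ p ∈ lam.pairs, PowerSeries.coeff (n p) (f p) = 0 := by
        refine Finset.prod_eq_zero (lam.mem_pairs.2 hpm) ?_
        have h3 : ¬ (p.1 ∈ T ∧ p.2 ∈ T) := fun h => hp h.1 h.2
        simp only [hf, if_neg h3]
        rw [PowerSeries.coeff_one, if_neg hp0]
      obtain ⟨i, hi, hav⟩ : ∃ i ∈ I \ T, ¬ Avoids n i := by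
        by_cases h2 : p.1 ∈ T
        · refine ⟨p.2, ?_, fun h => (h p hp0).2 rfl⟩
          rw [Finset.mem_sdiff, hI, Finset.mem_Icc]
          exact ⟨by omega, hp h2⟩
        · refine ⟨p.1, ?_, fun h => (h p hp0).1 rfl⟩
          rw [Finset.mem_sdiff, hI, Finset.mem_Icc]
          exact ⟨by omega, h2⟩
      rw [h1, zero_mul, Finset.prod_eq_zero hi (if_neg hav), mul_zero, mul_zero]
  rw [Finset.sum_congr rfl hT, Finset.sum_comm]
  refine Finset.sum_congr rfl fun n _ => ?_
  rw [← Finset.mul_sum, ← Finset.prod_add, ← hI.symm, evenTerm]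
  congr 1

end TypedPartition

/-! ### Double eta polynomials as coefficients -/

theorem hNeg_zero (s : ℤ) : hNeg ℚ s 0 = 1 := by
  have h3 : hNeg ℚ s 0 = PowerSeries.coeff 0 (hSer ℚ s) := by
    rw [hSer, PowerSeries.coeff_mk]
  obtain ⟨n, rfl | rfl⟩ := Int.eq_nat_or_neg s
  · rw [h3, hSer_natCast, PowerSeries.coeff_zero_eq_constantCoeff, map_prod]
    simp [geo, ← PowerSeries.coeff_zero_eq_constantCoeff_apply]
  · rw [h3, hSer_neg, PowerSeries.coeff_zero_eq_constantCoeff, map_prod]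
    simp

theorem cUp_eq_add_cTail (k : ℕ) (s : ℤ) (p : ℕ) :
    cUp ℚ k s p = MvPolynomial.C (cPoly ℚ k p) + cTail ℚ k s p := by
  rw [cUp, cTail, show ((p : ℤ) + 1).toNat = p + 1 by omega, Finset.range_eq_Ico,
    Finset.sum_eq_sum_Ico_succ_bot (by omega), hNeg_zero, mul_one, Nat.cast_zero, sub_zero,
    zero_add, Int.toNat_natCast, ← Finset.Ico_succ_right_eq_Icc]
  rfl

theorem cPoly_of_neg (k : ℕ) {p : ℤ} (h : p < 0) : cPoly ℚ k p = 0 := by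
  rw [cPoly, if_pos (by omega)]
  obtain ⟨n, rfl⟩ := Int.eq_negSucc_of_lt_zero h
  rfl

theorem cUp_eq_zero_add_cTail (k : ℕ) (s p : ℤ) :
    cUp ℚ k s p = MvPolynomial.C (cPoly ℚ k p) + cTail ℚ k s p := by
  by_cases h : p < 0
  · rw [cUp_of_neg ℚ k s h, cPoly_of_neg k h, cTail, Finset.Icc_eq_empty (by omega)]
    simp
  · obtain ⟨n, rfl⟩ := Int.eq_ofNat_of_zero_le (show 0 ≤ p by omega)
    exact cUp_eq_add_cTail k s n

theorem cUp_zero (k : ℕ) (p : ℤ) : cUp ℚ k 0 p = MvPolynomial.C (cPoly ℚ k p) := by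
  by_cases h : p < 0
  · rw [cUp_of_neg ℚ k 0 h, cPoly_of_neg k h, map_zero]
  · obtain ⟨n, rfl⟩ := Int.eq_ofNat_of_zero_le (show 0 ≤ p by omega)
    rw [cUp_eq_zcoeff, cSer_zero, zcoeff_natCast, cBase, PowerSeries.coeff_mk]

theorem aUp_eq (k : ℕ) (s p : ℤ) : aUp k s p = cUp ℚ k s p - half * cUp ℚ k 0 p := by
  have h := half_add_half
  rw [aUp, cUp_zero, cUp_eq_zero_add_cTail, map_mul]
  change half * _ + _ = _
  linear_combination (MvPolynomial.C (cPoly ℚ k p)) * h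

theorem zcoeff_C_mul {A : Type*} [CommRing A] (a : A) (f : PowerSeries A) (z : ℤ) :
    zcoeff (PowerSeries.C a * f) z = a * zcoeff f z := by
  unfold zcoeff
  split_ifs <;> simp

theorem zcoeff_sub {A : Type*} [CommRing A] (f g : PowerSeries A) (z : ℤ) :
    zcoeff (f - g) z = zcoeff f z - zcoeff g z := by
  unfold zcoeff
  split_ifs <;> simp

theorem zcoeff_entrySer_neg (k n : ℕ) (z : ℤ) :
    zcoeff (entrySer k (-((n : ℤ) + 1))) z = half * cUp ℚ k (-(n : ℤ)) z := by
  rw [entrySer_neg, zcoeff_C_mul, cUp_eq_zcoeff]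

theorem zcoeff_entrySer_one (k : ℕ) (z : ℤ) : zcoeff (entrySer k 1) z = aUp k 1 z := by
  rw [entrySer, if_neg (by norm_num), if_pos rfl, zcoeff_sub, zcoeff_C_mul, aUp_eq, cUp_eq_zcoeff,
    cUp_eq_zcoeff, cSer_zero]

theorem zcoeff_entrySer_of_one_lt (k : ℕ) {v : ℤ} (h : 1 < v) (z : ℤ) :
    zcoeff (entrySer k v) z = cUp ℚ k v z := by
  rw [entrySer_of_one_lt k h, cUp_eq_zcoeff]

theorem neg_one_pow_succ_of_odd {A : Type*} [CommRing A] {i : ℕ} (h : Odd i) :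
    (-1 : A) ^ (i + 1) = 1 :=
  h.add_one.neg_one_pow

theorem neg_one_pow_succ_of_not_odd {A : Type*} [CommRing A] {i : ℕ} (h : ¬ Odd i) :
    (-1 : A) ^ (i + 1) = -1 :=
  (Nat.not_odd_iff_even.1 h).add_one.neg_one_pow

theorem posSign_of_odd {i : ℕ} (h : Odd i) : posSign i = 1 := by
  unfold posSign
  exact neg_one_pow_succ_of_odd h

theorem posSign_of_not_odd {i : ℕ} (h : ¬ Odd i) : posSign i = -1 := by
  unfold posSign
  exact neg_one_pow_succ_of_not_odd h

theorem posSign_mul_dDiff (k i : ℕ) : posSign i * dDiff k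
    = MvPolynomial.C (2 * (if Odd i then bTildePoly ℚ else bPoly ℚ k) - cPoly ℚ k k) := by
  rw [cPoly, if_neg (lt_irrefl _), if_pos rfl, dDiff]
  split_ifs with h
  · rw [posSign_of_odd h, one_mul]
    congr 1
    ring
  · rw [posSign_of_not_odd h, ← map_one MvPolynomial.C, ← map_neg, ← map_mul]
    congr 1
    ring

theorem half_cPoly_sub (k : ℕ) :
    half * MvPolynomial.C (cPoly ℚ k k) - half * dDiff k = MvPolynomial.C (bPoly ℚ k) := by
  rw [cPoly, if_neg (lt_irrefl _), if_pos rfl, dDiff, map_add, map_sub]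
  linear_combination MvPolynomial.C (bPoly ℚ k) * half_add_half

theorem half_cPoly_add (k : ℕ) :
    half * MvPolynomial.C (cPoly ℚ k k) + half * dDiff k = MvPolynomial.C (bTildePoly ℚ) := by
  rw [cPoly, if_neg (lt_irrefl _), if_pos rfl, dDiff, map_add, map_sub]
  linear_combination MvPolynomial.C (bTildePoly ℚ) * half_add_half

namespace TypedPartition

theorem numLarge_le_length {k : ℕ} (lam : TypedPartition k) : lam.numLarge ≤ lam.length :=
  List.length_filter_le _ _

theorem involvesMid_iff {k : ℕ} (lam : TypedPartition k) (n : ℕ × ℕ →₀ ℕ) :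
    lam.InvolvesMid n ↔ ¬ Avoids n lam.mid := by
  constructor
  · rintro ⟨p, hp, h⟩ hav
    have := hav p (by omega)
    omega
  · intro h
    unfold Avoids at h
    push Not at h
    obtain ⟨p, hp, h⟩ := h
    refine ⟨p, by omega, ?_⟩
    by_cases h1 : p.1 = lam.mid
    · exact Or.inl h1
    · exact Or.inr (h h1)

variable {k : ℕ} [NeZero k] (lam : TypedPartition k)

/-- The factors in the rows `i < m`. An index `i` outside `supp_m(R)` can occur in `R` only in
factors `R_{ij}` with `j ≥ m`; these raise the index of `ĉ` above the value at which it differs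
from `c`. Thus the correction occurs exactly if `R` does not involve `i`. -/
theorem half_mul_starFactor {n : ℕ × ℕ →₀ ℕ} (hn : n.support ⊆ lam.pairs) {i : ℕ} (hi : 1 ≤ i)
    (him : i < lam.mid) : half * lam.starFactor n i = lam.evenFactor n i := by
  classical
  have h1 := (lam.entry_le_neg_two_iff hi).2 him
  obtain ⟨N, hN⟩ : ∃ N : ℕ, lam.entry i = -((N : ℤ) + 1) := ⟨(-lam.entry i - 1).toNat, by omega⟩
  have hb : lam.beta i = -(N : ℤ) := by
    have : lam.beta i = if lam.entry i < 0 then lam.entry i + 1 else lam.entry i := rfl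
    rw [this, if_pos (by omega)]
    omega
  have hpart := lam.part_of_entry_neg hi (by omega)
  rw [starFactor, if_pos (Or.inr him), cBar, evenFactor, hN, zcoeff_entrySer_neg, hb,
    entryCorr_neg]
  by_cases hs : lam.InSupp n i
  · rw [if_pos hs, if_neg, add_zero]
    obtain ⟨p, hp, -, h3⟩ := hs
    intro h
    have := h p (by omega)
    omega
  · rw [if_neg hs, cHat, mul_add]
    congr 1
    have hin : ∀ j, n (j, i) = 0 := by
      intro j
      by_contra h0
      exact hs ⟨(j, i), by omega, him, Or.inr rfl⟩
    have hraised : lam.raised n i = lam.part i + ∑ j ∈ Finset.Icc 1 lam.length, (n (i, j) : ℤ) := by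
      rw [raised]
      congr 1
      refine Finset.sum_congr rfl fun j _ => ?_
      rw [hin, Nat.cast_zero, sub_zero]
    by_cases hav : Avoids n i
    · have hr := lam.raised_of_avoids hav
      rw [if_pos hav, if_pos (by omega), hr, ← posSign_mul_dDiff,
        show ((lam.part i : ℤ) - k).toNat = N by omega, eNeg_self]
      ring
    · rw [if_neg hav, if_neg, mul_zero]
      rintro ⟨h4, -⟩
      apply hav
      intro p hp
      have hpp := lam.mem_pairs_of_ne_zero hn hp
      constructor
      · rintro h5
        have h6 := Finset.single_le_sum (f := fun j => (n (i, j) : ℤ)) (fun _ _ => by positivity)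
          (Finset.mem_Icc.2 (show 1 ≤ p.2 ∧ p.2 ≤ lam.length by omega))
        have h7 : n (i, p.2) ≠ 0 := by rw [← h5]; exact hp
        omega
      · intro h5
        apply hp
        have := hin p.1
        rwa [← h5] at this

/-- The factor in the row `m`, if the type is positive. The type and the parity of `m` determine the
sign of the entry `w_{k+m} = ± 1`, so that `b_k` and `b̃_k` are `c_k / 2` with the correction for
that entry. -/
theorem starFactor_mid (n : ℕ × ℕ →₀ ℕ) (ht : 0 < lam.type) :
    lam.starFactor n lam.mid = lam.evenFactor n lam.mid := by
  classical
  have hm := lam.mid_pos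
  rw [starFactor, if_neg (by omega), if_pos rfl, evenFactor]
  have hb : lam.beta lam.mid
      = if lam.entry lam.mid < 0 then lam.entry lam.mid + 1 else lam.entry lam.mid := rfl
  have htype := lam.type_eq_one_iff ht
  have hz : zcoeff (entrySer k (lam.entry lam.mid)) (lam.raised n lam.mid)
      = aUp k (lam.beta lam.mid) (lam.raised n lam.mid) := by
    rcases abs_eq (by norm_num : (0 : ℤ) ≤ 1) |>.1 (lam.abs_entry_mid ht) with h2 | h2
    · rw [hb, h2, zcoeff_entrySer_one]
      rfl
    · rw [hb, h2, aUp_eq]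
      have := zcoeff_entrySer_neg k 0 (lam.raised n lam.mid)
      norm_num at this ⊢
      rw [this]
      linear_combination (cUp ℚ k 0 (lam.raised n lam.mid)) * half_add_half
  rw [hz]
  by_cases hav : Avoids n lam.mid
  · have hni : ¬ lam.InvolvesMid n := by rw [involvesMid_iff]; exact not_not.2 hav
    rw [if_neg hni, if_pos hav, lam.raised_of_avoids hav, lam.part_mid ht]
    have ha : ∀ s : ℤ, aUp k s k = half * MvPolynomial.C (cPoly ℚ k k) + cTail ℚ k s k := by
      intro s
      rw [aUp, map_mul]
      rfl
    rw [ha]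
    have hp := half_cPoly_add k
    have hm := half_cPoly_sub k
    have hsign : Odd lam.mid ∧ posSign lam.mid = 1 ∨ ¬ Odd lam.mid ∧ posSign lam.mid = -1 := by
      by_cases h : Odd lam.mid
      · exact Or.inl ⟨h, posSign_of_odd h⟩
      · exact Or.inr ⟨h, posSign_of_not_odd h⟩
    rcases abs_eq (by norm_num : (0 : ℤ) ≤ 1) |>.1 (lam.abs_entry_mid ht) with h2 | h2
    · rw [h2, entryCorr_one]
      rcases hsign with ⟨h3, h4⟩ | ⟨h3, h4⟩
      · rw [if_pos (htype.2 (by simp [h2, h3])), bUp, h4, ← hm]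
        ring
      · rw [if_neg (fun h => h3 ((htype.1 h).1 h2)), bTildeUp, h4, ← hp]
        ring
    · rw [h2, entryCorr_neg_one]
      have h5 : ¬ lam.entry lam.mid = 1 := by omega
      rcases hsign with ⟨h3, h4⟩ | ⟨h3, h4⟩
      · rw [if_neg (fun h => h5 ((htype.1 h).2 h3)), bTildeUp, h4, ← hp]
        ring
      · rw [if_pos (htype.2 (by simp [h5, h3])), bUp, h4, ← hm]
        ring
  · rw [if_pos ((lam.involvesMid_iff n).2 hav), if_neg hav, add_zero]

theorem starFactor_of_one_lt (n : ℕ × ℕ →₀ ℕ) {i : ℕ} (hi : 1 ≤ i)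
    (him : lam.mid < i ∨ (lam.type = 0 ∧ lam.mid ≤ i)) :
    lam.starFactor n i = lam.evenFactor n i := by
  classical
  have h1 := lam.one_lt_entry hi him
  have hb : lam.beta i = lam.entry i := by
    have : lam.beta i = if lam.entry i < 0 then lam.entry i + 1 else lam.entry i := rfl
    rw [this, if_neg (by omega)]
  rw [evenFactor, zcoeff_entrySer_of_one_lt k h1, entryCorr_of_one_lt k i h1, ite_self, add_zero,
    starFactor, hb]
  by_cases ht : lam.type = 0
  · rw [if_pos (Or.inl ht), cBar, hb, cHat,
      if_neg (fun h => absurd h.2 (by omega) : ¬ (_ ∧ lam.entry i < 0)), add_zero, ite_self]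
  · rw [if_neg (by omega), if_neg (by omega)]

theorem C_mul_star {n : ℕ × ℕ →₀ ℕ} (hn : n.support ⊆ lam.pairs) :
    MvPolynomial.C (MvPolynomial.C ((2 : ℚ)⁻¹ ^ lam.numLarge * lam.raisingCoeff n)) * lam.star n
      = lam.evenTerm n := by
  classical
  have h1 : (MvPolynomial.C (MvPolynomial.C (lam.raisingCoeff n)) : PolyBT ℚ)
      = ∏ p ∈ lam.pairs, lam.pairCoeff p (n p) := by
    rw [raisingCoeff, map_prod, map_prod]
    refine Finset.prod_congr rfl fun p _ => ?_
    rw [pairCoeff, ← map_raiseSer ((MvPolynomial.C : PolyB ℚ →+* PolyBT ℚ).comp MvPolynomial.C),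
      PowerSeries.coeff_map, raiseSer, inv_one_add_X_eq_geo]
    have hiff : lam.InC p.1 p.2 ↔ lam.entry p.1 + lam.entry p.2 < 0 := Iff.rfl
    by_cases h : lam.entry p.1 + lam.entry p.2 < 0
    · rw [if_pos h, if_pos (hiff.2 h)]
      rfl
    · rw [if_neg h, if_neg (fun h' => h (hiff.1 h'))]
      rfl
  have h2 : (MvPolynomial.C (MvPolynomial.C ((2 : ℚ)⁻¹ ^ lam.numLarge)) : PolyBT ℚ)
      = ∏ i ∈ Finset.Icc 1 lam.length, if i < lam.mid then half else 1 := by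
    rw [← Finset.prod_filter, Finset.prod_const]
    have : (Finset.Icc 1 lam.length).filter (fun i => i < lam.mid) = Finset.Icc 1 lam.numLarge := by
      have := lam.numLarge_le_length
      ext i
      rw [Finset.mem_filter, Finset.mem_Icc, Finset.mem_Icc]
      have h3 : lam.mid = lam.numLarge + 1 := rfl
      omega
    rw [this, Nat.card_Icc, Nat.add_sub_cancel, half, map_pow, map_pow, one_div]
  rw [map_mul, map_mul, h1, h2, star, evenTerm, mul_comm (∏ i ∈ Finset.Icc 1 lam.length, _),
    mul_assoc, ← Finset.prod_mul_distrib]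
  congr 1
  refine Finset.prod_congr rfl fun i hi => ?_
  rw [Finset.mem_Icc] at hi
  split_ifs with him
  · exact lam.half_mul_starFactor hn hi.1 him
  · rw [one_mul]
    by_cases h3 : i = lam.mid ∧ 0 < lam.type
    · rw [h3.1]
      exact lam.starFactor_mid n h3.2
    · exact lam.starFactor_of_one_lt n hi.1 (by omega)

theorem doubleEta_eq_sum : lam.doubleEta
    = ∑ n ∈ lam.pairs.finsupp (fun _ => Finset.range (lam.size + 1)), lam.evenTerm n := by
  classical
  rw [doubleEta]
  simp only [finsum_eq_if]
  rw [finsum_eq_sum_of_support_subset (s := lam.pairs.finsupp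
    (fun _ => Finset.range (lam.size + 1)))]
  · refine Finset.sum_congr rfl fun n hn => ?_
    have hns : n.support ⊆ lam.pairs := (Finset.mem_finsupp_iff.1 hn).1
    rw [if_pos hns, lam.C_mul_star hns]
  · intro n hn
    rw [Function.mem_support] at hn
    have hns : n.support ⊆ lam.pairs := by
      by_contra h
      exact hn (if_neg h)
    rw [if_pos hns, lam.C_mul_star hns] at hn
    rw [Finset.mem_coe, Finset.mem_finsupp_iff]
    refine ⟨hns, fun p _ => ?_⟩
    rw [Finset.mem_range]
    by_contra hp
    exact hn (lam.evenTerm_eq_zero hns (p := p) (by omega))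

/-- The double eta polynomial is a coefficient of the generating series, for any sufficiently
large number of positions. -/
theorem doubleEta_eq_coeff {L : ℕ} (hL : lam.length ≤ L) :
    lam.doubleEta = MvPowerSeries.coeff (partExp L lam.part) (etaSer k L lam.part lam.entry) := by
  induction L, hL using Nat.le_induction with
  | base => rw [lam.coeff_partExp_etaSer, lam.doubleEta_eq_sum]
  | succ L hL ih =>
    rw [coeff_etaSer_succ k L _ _ (lam.part_eq_zero (by omega)) ?_, ih]
    by_contra h
    have := lam.le_length_of_entry_lt_two (j := L + 1) (by omega) (by omega)
    omega

end TypedPartition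

/-! ### The action of a simple reflection on the entries -/

/-- The integers moved by the simple reflection `s_i`. -/
def IsMoved (i : ℕ) (v : ℤ) : Prop := |v| = max (i : ℤ) 1 ∨ |v| = max (i : ℤ) 1 + 1

/-- The pairs `(s_i v', v')` for which the reflection, applied to one entry `v'`, can enlarge the
partition. -/
def StepUp (i : ℕ) (v v' : ℤ) : Prop :=
  (i = 0 ∧ (v = -2 ∧ v' = 1 ∨ v = -1 ∧ v' = 2)) ∨
    (1 ≤ i ∧ (v = -((i : ℤ) + 1) ∧ v' = -(i : ℤ) ∨ v = i ∧ v' = (i : ℤ) + 1))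

theorem simpleReflection_zero_apply (a : ℤ) : simpleReflection 0 a
    = if a = 1 then -2 else if a = -2 then 1 else if a = 2 then -1 else if a = -1 then 2 else a := by
  rw [simpleReflection, if_pos rfl, Equiv.Perm.mul_apply, Equiv.swap_apply_def,
    Equiv.swap_apply_def]
  split_ifs <;> first | rfl | omega | simp_all

theorem simpleReflection_succ_apply {i : ℕ} (hi : 1 ≤ i) (a : ℤ) : simpleReflection i a
    = if a = i then (i : ℤ) + 1 else if a = (i : ℤ) + 1 then (i : ℤ)
      else if a = -(i : ℤ) then -((i : ℤ) + 1) else if a = -((i : ℤ) + 1) then -(i : ℤ) else a := by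
  rw [simpleReflection, if_neg (by omega), Equiv.Perm.mul_apply, Equiv.swap_apply_def,
    Equiv.swap_apply_def]
  split_ifs <;> omega

theorem isMoved_iff {i : ℕ} {v : ℤ} : IsMoved i v ↔
    (i = 0 ∧ (v = 1 ∨ v = -1 ∨ v = 2 ∨ v = -2)) ∨
      (1 ≤ i ∧ (v = i ∨ v = -(i : ℤ) ∨ v = (i : ℤ) + 1 ∨ v = -((i : ℤ) + 1))) := by
  unfold IsMoved
  rcases abs_cases v with h | h <;> omega

theorem simpleReflection_of_not_isMoved {i : ℕ} {v : ℤ} (h : ¬ IsMoved i v) :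
    simpleReflection i v = v := by
  rw [isMoved_iff] at h
  rcases Nat.eq_zero_or_pos i with rfl | hi
  · rw [simpleReflection_zero_apply]
    split_ifs <;> omega
  · rw [simpleReflection_succ_apply hi]
    split_ifs <;> omega

theorem abs_simpleReflection_lt_iff {i : ℕ} {v a : ℤ} (hv : ¬ IsMoved i v) (hv0 : 0 < v) :
    v < |simpleReflection i a| ↔ v < |a| := by
  rw [isMoved_iff] at hv
  rcases Nat.eq_zero_or_pos i with rfl | hi
  · rw [simpleReflection_zero_apply]
    rcases abs_cases a with h | h <;> split_ifs <;> (try subst a) <;> norm_num at * <;> omega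
  · rw [simpleReflection_succ_apply hi]
    split_ifs with h1 h2 h3 h4
    · subst h1
      rw [abs_of_nonneg (by omega), abs_of_nonneg (by omega)]
      omega
    · subst h2
      rw [abs_of_nonneg (by omega), abs_of_nonneg (by omega)]
      omega
    · subst h3
      rw [abs_of_nonpos (by omega), abs_of_nonpos (by omega)]
      omega
    · subst h4
      rw [abs_of_nonpos (by omega), abs_of_nonpos (by omega)]
      omega
    · rfl

theorem abs_simpleReflection_lt_iff_succ {i : ℕ} (hi : 1 ≤ i) {a : ℤ} :
    (i : ℤ) + 1 < |simpleReflection i a| ↔ (i : ℤ) + 1 < |a| := by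
  rw [simpleReflection_succ_apply hi]
  split_ifs with h1 h2 h3 h4
  · subst h1
    rw [abs_of_nonneg (by omega), abs_of_nonneg (by omega)]
    omega
  · subst h2
    rw [abs_of_nonneg (by omega), abs_of_nonneg (by omega)]
    omega
  · subst h3
    rw [abs_of_nonpos (by omega), abs_of_nonpos (by omega)]
    omega
  · subst h4
    rw [abs_of_nonpos (by omega), abs_of_nonpos (by omega)]
    omega
  · rfl

theorem stepUp_entryStep (k : ℕ) [NeZero k] {i : ℕ} {v v' : ℤ} (h : StepUp i v v') :
    EntryStep k i v v' := by
  rcases h with ⟨rfl, ⟨rfl, rfl⟩ | ⟨rfl, rfl⟩⟩ | ⟨hi, h⟩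
  · exact entryStep_zero_neg_two k
  · exact entryStep_zero_neg_one k
  · obtain ⟨n, rfl⟩ : ∃ n, i = n + 1 := ⟨i - 1, by omega⟩
    rcases h with ⟨rfl, rfl⟩ | ⟨rfl, rfl⟩
    · convert entryStep_neg k n using 1 <;> push_cast <;> ring
    · convert entryStep_pos k n using 1 <;> push_cast <;> ring

namespace TypedPartition

variable {k : ℕ} [NeZero k] {lam mu : TypedPartition k} {i : ℕ}

theorem weyl_apply_of_eq (hweyl : lam.weyl = simpleReflection i * mu.weyl) (a : ℤ) :
    lam.weyl a = simpleReflection i (mu.weyl a) := by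
  rw [hweyl, Equiv.Perm.mul_apply]

theorem entry_of_eq (hweyl : lam.weyl = simpleReflection i * mu.weyl) (j : ℕ) :
    lam.entry j = simpleReflection i (mu.entry j) :=
  weyl_apply_of_eq hweyl _

theorem part_eq_of_not_isMoved (hweyl : lam.weyl = simpleReflection i * mu.weyl) {j : ℕ}
    (hj : 1 ≤ j) (h : ¬ IsMoved i (mu.entry j)) : lam.part j = mu.part j := by
  have h1 : lam.entry j = mu.entry j := by
    rw [entry_of_eq hweyl, simpleReflection_of_not_isMoved h]
  rcases lt_or_gt_of_ne (mu.entry_ne_zero hj) with hv | hv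
  · have h2 := mu.part_of_entry_neg hj hv
    have h3 := lam.part_of_entry_neg hj (by omega)
    omega
  · rw [mu.part_of_entry_pos hj hv, lam.part_of_entry_pos hj (by omega), h1]
    congr 1
    refine Finset.filter_congr fun p _ => ?_
    rw [weyl_apply_of_eq hweyl, abs_simpleReflection_lt_iff h hv]

/-- Only the entries `-i` and `i + 1`, respectively `1` and `2` if `i = 0`, can give rise to a
larger part. -/
theorem stepUp_of_part_lt (hweyl : lam.weyl = simpleReflection i * mu.weyl) {j : ℕ}
    (hj : 1 ≤ j) (h : mu.part j < lam.part j) :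
    (i = 0 ∧ (mu.entry j = 1 ∧ lam.entry j = -2 ∨ mu.entry j = 2 ∧ lam.entry j = -1)) ∨
    (1 ≤ i ∧ (mu.entry j = -(i : ℤ) ∧ lam.entry j = -((i : ℤ) + 1) ∨
      mu.entry j = (i : ℤ) + 1 ∧ lam.entry j = i)) := by
  have hm : IsMoved i (mu.entry j) := by
    by_contra h1
    have := part_eq_of_not_isMoved hweyl hj h1
    omega
  have he := entry_of_eq hweyl j
  rw [isMoved_iff] at hm
  rcases hm with ⟨rfl, hm⟩ | ⟨hi, hm⟩
  · rw [simpleReflection_zero_apply] at he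
    rcases hm with hm | hm | hm | hm
    · rw [hm] at he
      norm_num at he
      omega
    · rw [hm] at he
      norm_num at he
      have h1 := mu.part_of_entry_neg hj (by omega)
      have h2 := lam.part_le_of_entry_pos hj (by omega)
      omega
    · rw [hm] at he
      norm_num at he
      omega
    · rw [hm] at he
      norm_num at he
      have h1 := mu.part_of_entry_neg hj (by omega)
      have h2 := lam.part_le_of_entry_pos hj (by omega)
      omega
  · rw [simpleReflection_succ_apply hi] at he
    rcases hm with hm | hm | hm | hm
    · rw [if_pos hm] at he
      exfalso
      rw [mu.part_of_entry_pos hj (by omega), lam.part_of_entry_pos hj (by omega), he, hm] at h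
      refine absurd h (not_lt.2 (Finset.card_le_card fun p => ?_))
      simp only [Finset.mem_filter]
      rintro ⟨h1, h2⟩
      refine ⟨h1, ?_⟩
      rw [weyl_apply_of_eq hweyl, abs_simpleReflection_lt_iff_succ hi] at h2
      omega
    · rw [if_neg (by omega), if_neg (by omega), if_pos hm] at he
      omega
    · rw [if_neg (by omega), if_pos hm] at he
      omega
    · rw [if_neg (by omega), if_neg (by omega), if_neg (by omega), if_pos hm] at he
      have h1 := mu.part_of_entry_neg hj (by omega)
      have h2 := lam.part_of_entry_neg hj (by omega)
      omega

/-- The two ways in which a reflection can enlarge the partition by one box: it moves the entry at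
one position `p`, or those at two positions `p < q`. In both cases the new box is in row `p`. -/
theorem reflection_cases (hsize : lam.size = mu.size + 1)
    (hweyl : lam.weyl = simpleReflection i * mu.weyl) :
    ∃ p, 1 ≤ p ∧ lam.part p = mu.part p + 1 ∧ (∀ j, 1 ≤ j → j ≠ p → lam.part j = mu.part j) ∧
      ((StepUp i (lam.entry p) (mu.entry p) ∧
          ∀ j, 1 ≤ j → j ≠ p → lam.entry j = mu.entry j ∧ ¬ IsMoved i (mu.entry j)) ∨
        ∃ q, p < q ∧
          (∀ j, 1 ≤ j → j ≠ p → j ≠ q → lam.entry j = mu.entry j ∧ ¬ IsMoved i (mu.entry j)) ∧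
          ((i = 0 ∧ mu.entry p = 1 ∧ mu.entry q = 2 ∧ lam.entry p = -2 ∧ lam.entry q = -1) ∨
            (1 ≤ i ∧ mu.entry p = -(i : ℤ) ∧ mu.entry q = (i : ℤ) + 1 ∧
              lam.entry p = -((i : ℤ) + 1) ∧ lam.entry q = i))) := by
  obtain ⟨L, hL1, hL2⟩ : ∃ L, lam.length ≤ L ∧ mu.length ≤ L := ⟨max lam.length mu.length, by simp⟩
  rw [lam.size_eq_sum hL1, mu.size_eq_sum hL2] at hsize
  have hex : ∃ p, 1 ≤ p ∧ mu.part p < lam.part p := by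
    by_contra hcon
    push Not at hcon
    have := Finset.sum_le_sum (s := Finset.Icc 1 L) (f := lam.part) (g := mu.part)
      (fun j hj => hcon j (Finset.mem_Icc.1 hj).1)
    omega
  obtain ⟨p, hp1, hp⟩ := hex
  have hpL : p ∈ Finset.Icc 1 L := by
    rw [Finset.mem_Icc]
    refine ⟨hp1, ?_⟩
    by_contra h
    rw [lam.part_eq_zero (j := p) (by omega)] at hp
    omega
  have hunm : ∀ j, ¬ IsMoved i (mu.entry j) → lam.entry j = mu.entry j := fun j h => by
    rw [entry_of_eq hweyl, simpleReflection_of_not_isMoved h]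
  have hup := stepUp_of_part_lt hweyl hp1 hp
  rw [← Finset.add_sum_erase _ _ hpL, ← Finset.add_sum_erase _ mu.part hpL] at hsize
  by_cases hsingle : ∀ j, 1 ≤ j → j ≠ p → ¬ IsMoved i (mu.entry j)
  · have hparts : ∀ j, 1 ≤ j → j ≠ p → lam.part j = mu.part j := fun j hj hjp =>
      part_eq_of_not_isMoved hweyl hj (hsingle j hj hjp)
    have h1 : ∑ j ∈ (Finset.Icc 1 L).erase p, lam.part j
        = ∑ j ∈ (Finset.Icc 1 L).erase p, mu.part j := by
      refine Finset.sum_congr rfl fun j hj => ?_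
      rw [Finset.mem_erase, Finset.mem_Icc] at hj
      exact hparts j hj.2.1 hj.1
    refine ⟨p, hp1, by omega, hparts, Or.inl ⟨?_, fun j hj hjp =>
      ⟨hunm j (hsingle j hj hjp), hsingle j hj hjp⟩⟩⟩
    unfold StepUp
    omega
  · push Not at hsingle
    obtain ⟨q, hq1, hqp, hq⟩ := hsingle
    have habs := mu.abs_entry_ne hp1 hq1 (Ne.symm hqp)
    have hrest : ∀ j, 1 ≤ j → j ≠ p → j ≠ q → ¬ IsMoved i (mu.entry j) := by
      intro j hj hjp hjq hmj
      have h1 := mu.abs_entry_ne hj hp1 hjp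
      have h2 := mu.abs_entry_ne hj hq1 hjq
      have h3 : IsMoved i (mu.entry p) := by
        rw [isMoved_iff]
        omega
      unfold IsMoved at hmj hq h3
      omega
    have hparts : ∀ j, 1 ≤ j → j ≠ p → j ≠ q → lam.part j = mu.part j := fun j hj hjp hjq =>
      part_eq_of_not_isMoved hweyl hj (hrest j hj hjp hjq)
    -- the new box is not in row `q`
    have hsum : lam.part p + lam.part q = mu.part p + mu.part q + 1 := by
      by_cases hqL : q ∈ (Finset.Icc 1 L).erase p
      · rw [← Finset.add_sum_erase _ _ hqL, ← Finset.add_sum_erase _ mu.part hqL] at hsize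
        have h1 : ∑ j ∈ ((Finset.Icc 1 L).erase p).erase q, lam.part j
            = ∑ j ∈ ((Finset.Icc 1 L).erase p).erase q, mu.part j := by
          refine Finset.sum_congr rfl fun j hj => ?_
          rw [Finset.mem_erase, Finset.mem_erase, Finset.mem_Icc] at hj
          exact hparts j hj.2.2.1 hj.2.1 hj.1
        omega
      · have h1 : ∑ j ∈ (Finset.Icc 1 L).erase p, lam.part j
            = ∑ j ∈ (Finset.Icc 1 L).erase p, mu.part j := by
          refine Finset.sum_congr rfl fun j hj => ?_
          have hjq : j ≠ q := fun h => hqL (h ▸ hj)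
          rw [Finset.mem_erase, Finset.mem_Icc] at hj
          exact hparts j hj.2.1 hj.1 hjq
        rw [Finset.mem_erase, Finset.mem_Icc] at hqL
        rw [lam.part_eq_zero (j := q) (by omega), mu.part_eq_zero (j := q) (by omega)]
        omega
    have hlq := entry_of_eq hweyl q
    have hord : (p < q ∧ mu.entry p < mu.entry q ∧ lam.entry p < lam.entry q) ∨
        (q < p ∧ mu.entry q < mu.entry p ∧ lam.entry q < lam.entry p) := by
      rcases lt_or_gt_of_ne hqp with h | h
      · exact Or.inr ⟨h, mu.entry_lt hq1 h, lam.entry_lt hq1 h⟩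
      · exact Or.inl ⟨h, mu.entry_lt hp1 h, lam.entry_lt hp1 h⟩
    have hgoal : p < q ∧ lam.part p = mu.part p + 1 ∧
        ((i = 0 ∧ mu.entry p = 1 ∧ mu.entry q = 2 ∧ lam.entry p = -2 ∧ lam.entry q = -1) ∨
          (1 ≤ i ∧ mu.entry p = -(i : ℤ) ∧ mu.entry q = (i : ℤ) + 1 ∧
            lam.entry p = -((i : ℤ) + 1) ∧ lam.entry q = i)) := by
      rw [isMoved_iff] at hq
      have hne1 : mu.entry p ≠ mu.entry q := fun h => habs (by rw [h])
      have hne2 : mu.entry p ≠ -mu.entry q := fun h => habs (by rw [h, abs_neg])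
      rcases Nat.eq_zero_or_pos i with hi | hi
      · subst hi
        rw [simpleReflection_zero_apply] at hlq
        rcases hup with ⟨-, ⟨h1, h2⟩ | ⟨h1, h2⟩⟩ | ⟨hi, -⟩
        · have h3 := lam.part_of_entry_neg hp1 (by omega)
          have h4 := mu.part_le_of_entry_pos hp1 (by omega)
          have h5 : mu.entry q = 2 := by
            split_ifs at hlq <;> omega
          rw [h5] at hlq
          norm_num at hlq
          have h6 := lam.part_of_entry_neg hq1 (by omega)
          have h7 := mu.part_le_of_entry_pos hq1 (by omega)
          omega
        · exfalso
          have h5 : mu.entry q = 1 := by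
            split_ifs at hlq <;> omega
          rw [h5] at hlq
          norm_num at hlq
          have h6 := lam.part_of_entry_neg hq1 (by omega)
          have h7 := mu.part_le_of_entry_pos hq1 (by omega)
          omega
        · omega
      · rw [simpleReflection_succ_apply hi] at hlq
        rcases hup with ⟨hi, -⟩ | ⟨-, ⟨h1, h2⟩ | ⟨h1, h2⟩⟩
        · omega
        · have h3 := lam.part_of_entry_neg hp1 (by omega)
          have h4 := mu.part_of_entry_neg hp1 (by omega)
          have h5 : mu.entry q = (i : ℤ) + 1 := by
            split_ifs at hlq <;> omega
          rw [if_neg (by omega), if_pos h5] at hlq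
          omega
        · exfalso
          have h5 : mu.entry q = -(i : ℤ) := by
            split_ifs at hlq <;> omega
          rw [if_neg (by omega), if_neg (by omega), if_pos h5] at hlq
          have h6 := lam.part_of_entry_neg hq1 (by omega)
          have h7 := mu.part_of_entry_neg hq1 (by omega)
          omega
    refine ⟨p, hp1, hgoal.2.1, ?_, Or.inr ⟨q, hgoal.1, fun j hj hjp hjq =>
      ⟨hunm j (hrest j hj hjp hjq), hrest j hj hjp hjq⟩, hgoal.2.2⟩⟩
    intro j hj hjp
    by_cases hjq : j = q
    · rw [hjq]
      have := hgoal.2.1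
      omega
    · exact hparts j hj hjp hjq

end TypedPartition

/-! ### The divided difference of the generating series -/

theorem map_reflectRat_entrySer (k : ℕ) [NeZero k] {i : ℕ} {v : ℤ} (hv0 : v ≠ 0)
    (hv : ¬ IsMoved i v) : PowerSeries.map (reflectRat k i) (entrySer k v) = entrySer k v := by
  cases i with
  | zero =>
    refine map_reflectRat_zero_entrySer k ?_
    rw [isMoved_iff] at hv
    rcases abs_cases v with h | h <;> omega
  | succ n =>
    rw [isMoved_iff] at hv
    refine map_reflectRat_succ_entrySer k n ?_ ?_ <;> rcases abs_cases v with h | h <;> omega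

theorem reflectRat_entryCorr (k j : ℕ) [NeZero k] {i : ℕ} {v : ℤ} (hv0 : v ≠ 0)
    (hv : ¬ IsMoved i v) : reflectRat k i (entryCorr k j v) = entryCorr k j v := by
  cases i with
  | zero =>
    refine reflectRat_zero_entryCorr k j ?_
    rw [isMoved_iff] at hv
    rcases abs_cases v with h | h <;> omega
  | succ n =>
    rw [isMoved_iff] at hv
    refine reflectRat_succ_entryCorr k n j ?_
    rcases abs_cases v with h | h <;> omega

theorem raiseSer_congr (B : Type*) [CommRing B] {s s' : ℤ} (h : s < 0 ↔ s' < 0) :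
    raiseSer B s = raiseSer B s' := by
  simp only [raiseSer, h]

/-- The monomial `u_i = y_1 ⋯ y_i`. -/
noncomputable def uMono (i : ℕ) : MvPowerSeries ℕ (PolyBT ℚ) := MvPowerSeries.monomial (wt 0 i) 1

theorem evMono_C_mul {A : Type*} [CommRing A] {e : ℕ →₀ ℕ} (he : e ≠ 0) (a : A)
    (f : PowerSeries A) : evMono e (PowerSeries.C a * f) = MvPowerSeries.C a * evMono e f := by
  rw [evMono_mul he, evMono_C]

theorem uMono_pow (i n : ℕ) : uMono i ^ n = MvPowerSeries.monomial (n • wt 0 i) 1 :=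
  monomial_one_pow _ _

theorem corrTerm_eq (k : ℕ) (part : ℕ → ℕ) (v : ℕ → ℤ) (i : ℕ) :
    corrTerm k part v i = MvPowerSeries.C (entryCorr k i (v i)) * uMono i ^ part i := by
  rw [corrTerm, uMono_pow, ← MvPowerSeries.monomial_zero_eq_C_apply,
    MvPowerSeries.monomial_mul_monomial, zero_add, mul_one]

section Map

variable (k i : ℕ)

theorem map_uMono (j : ℕ) : MvPowerSeries.map (reflectRat k i) (uMono j) = uMono j := by
  rw [uMono, MvPowerSeries.map_monomial, map_one]

theorem map_corrTerm (part : ℕ → ℕ) (v : ℕ → ℤ) (j : ℕ) :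
    MvPowerSeries.map (reflectRat k i) (corrTerm k part v j)
      = MvPowerSeries.C (reflectRat k i (entryCorr k j (v j))) * uMono j ^ part j := by
  rw [corrTerm_eq, map_mul, map_pow, map_uMono, MvPowerSeries.map_C]

theorem map_entryTerm (v : ℕ → ℤ) {j : ℕ} (hj : 1 ≤ j) :
    MvPowerSeries.map (reflectRat k i) (entryTerm k v j)
      = evMono (wt 0 j) (PowerSeries.map (reflectRat k i) (entrySer k (v j))) :=
  map_evMono _ (wt_ne_zero (by omega)) _

theorem map_pairTerm (v : ℕ → ℤ) {j l : ℕ} (h : j < l) :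
    MvPowerSeries.map (reflectRat k i) (pairTerm v j l) = pairTerm v j l := by
  rw [pairTerm, map_evMono _ (wt_ne_zero h), map_raiseSer]

theorem map_linkProd_pairTerm (v : ℕ → ℤ) {p : ℕ} {T : Finset ℕ} (hp : p ∉ T) :
    MvPowerSeries.map (reflectRat k i) (linkProd (pairTerm v) p T) = linkProd (pairTerm v) p T := by
  rw [map_linkProd]
  refine Finset.prod_congr rfl fun j hj => map_pairTerm k i v ?_
  have : p ≠ j := fun h => hp (h ▸ hj)
  omega

end Map

theorem linkProd_pairTerm_congr {v v' : ℕ → ℤ} {p : ℕ} {T : Finset ℕ}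
    (h : ∀ j ∈ T, v p + v j < 0 ↔ v' p + v' j < 0) :
    linkProd (pairTerm v) p T = linkProd (pairTerm v') p T := by
  refine linkProd_congr fun j hj => ?_
  rw [pairTerm, pairTerm]
  congr 1
  refine raiseSer_congr _ ?_
  have := h j hj
  rcases le_total p j with h1 | h1
  · rw [min_eq_left h1, max_eq_right h1]
    exact this
  · rw [min_eq_right h1, max_eq_left h1, add_comm (v j), add_comm (v' j)]
    exact this

section Unmoved

variable {k i : ℕ} {I : Finset ℕ} {part part' : ℕ → ℕ} {v v' : ℕ → ℤ}

theorem subsetTerm_eq_of_unmoved (hpart : ∀ j ∈ I, part j = part' j) (hv : ∀ j ∈ I, v j = v' j)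
    {T : Finset ℕ} (hT : T ⊆ I) :
    subsetTerm I (corrTerm k part v) (entryTerm k v) (pairTerm v) T
      = subsetTerm I (corrTerm k part' v') (entryTerm k v') (pairTerm v') T := by
  refine subsetTerm_congr hT (fun j hj => ?_) (fun j hj => ?_) (fun j hj l hl _ => ?_)
  · rw [corrTerm, corrTerm, hpart j hj, hv j hj]
  · rw [entryTerm, entryTerm, hv j hj]
  · rw [pairTerm, pairTerm, hv j hj, hv l hl]

theorem map_subsetTerm_of_unmoved [NeZero k] (hI : ∀ j ∈ I, 1 ≤ j) (hv0 : ∀ j ∈ I, v j ≠ 0)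
    (hv : ∀ j ∈ I, ¬ IsMoved i (v j)) {T : Finset ℕ} (hT : T ⊆ I) :
    MvPowerSeries.map (reflectRat k i)
      (subsetTerm I (corrTerm k part v) (entryTerm k v) (pairTerm v) T)
      = subsetTerm I (corrTerm k part v) (entryTerm k v) (pairTerm v) T := by
  rw [map_subsetTerm]
  refine subsetTerm_congr hT (fun j hj => ?_) (fun j hj => ?_) (fun j _ l _ h => ?_)
  · rw [map_corrTerm, reflectRat_entryCorr k j (hv0 j hj) (hv j hj), corrTerm_eq]
  · rw [map_entryTerm k i v (hI j hj), map_reflectRat_entrySer k (hv0 j hj) (hv j hj)]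
    rfl
  · exact map_pairTerm k i v h

end Unmoved

section Step

variable {k i : ℕ} {v v' : ℤ}

theorem entrySer_step {p : ℕ} (hp : 1 ≤ p) (h : EntryStep k i v v') :
    evMono (wt 0 p) (entrySer k v)
        - evMono (wt 0 p) (PowerSeries.map (reflectRat k i) (entrySer k v))
      = MvPowerSeries.C (toRat (denom i)) * uMono p * evMono (wt 0 p) (entrySer k v') := by
  have hw := wt_ne_zero (show 0 < p by omega)
  rw [← evMono_sub hw, h.1, mul_assoc, evMono_C_mul hw, evMono_mul hw, evMono_X hw, mul_assoc]
  rfl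

theorem entryCorr_step (j : ℕ) (h : EntryStep k i v v') :
    (MvPowerSeries.C (entryCorr k j v) : MvPowerSeries ℕ (PolyBT ℚ))
        - MvPowerSeries.C (reflectRat k i (entryCorr k j v))
      = MvPowerSeries.C (toRat (denom i)) * MvPowerSeries.C (entryCorr k j v') := by
  rw [← map_sub, h.2 j, map_mul]

end Step

/-- One position moves. -/
theorem etaSer_sub_map_of_single {k : ℕ} [NeZero k] {i L p : ℕ} (hpL : p ∈ Finset.Icc 1 L)
    {part part' : ℕ → ℕ} {v v' : ℕ → ℤ} (hp : part p = part' p + 1)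
    (hpart : ∀ j, 1 ≤ j → j ≠ p → part j = part' j) (hstep : StepUp i (v p) (v' p))
    (hv0 : ∀ j, 1 ≤ j → v j ≠ 0)
    (hv : ∀ j, 1 ≤ j → j ≠ p → v j = v' j ∧ ¬ IsMoved i (v' j)) :
    etaSer k L part v - MvPowerSeries.map (reflectRat k i) (etaSer k L part v)
      = MvPowerSeries.C (toRat (denom i)) * uMono p * etaSer k L part' v' := by
  obtain ⟨I, hI⟩ : ∃ I, I = (Finset.Icc 1 L).erase p := ⟨_, rfl⟩
  have hins : Finset.Icc 1 L = insert p I := by rw [hI, Finset.insert_erase hpL]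
  have hpI : p ∉ I := by rw [hI]; exact Finset.notMem_erase _ _
  have hmem : ∀ j ∈ I, 1 ≤ j ∧ j ≠ p := by
    intro j hj
    rw [hI, Finset.mem_erase, Finset.mem_Icc] at hj
    exact ⟨hj.2.1, hj.1⟩
  have hp1 : 1 ≤ p := (Finset.mem_Icc.1 hpL).1
  rw [etaSer, etaSer, hins, subsetSum_insert _ _ _ hpI, subsetSum_insert _ _ _ hpI, map_sum,
    ← Finset.sum_sub_distrib, Finset.mul_sum]
  refine Finset.sum_congr rfl fun T hT => ?_
  rw [Finset.mem_powerset] at hT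
  have hpT : p ∉ T := fun h => hpI (hT h)
  have h1 := subsetTerm_eq_of_unmoved (k := k) (fun j hj => hpart j (hmem j hj).1 (hmem j hj).2)
    (fun j hj => (hv j (hmem j hj).1 (hmem j hj).2).1) hT
  have h2 := map_subsetTerm_of_unmoved (k := k) (i := i) (part := part)
    (fun j hj => (hmem j hj).1) (fun j hj => hv0 j (hmem j hj).1)
    (fun j hj => by
      have := hv j (hmem j hj).1 (hmem j hj).2
      rw [this.1]
      exact this.2) hT
  have h3 : linkProd (pairTerm v) p T = linkProd (pairTerm v') p T := by
    refine linkProd_pairTerm_congr fun j hj => ?_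
    have h4 := hmem j (hT hj)
    have h5 := hv j h4.1 h4.2
    have h6 := hv0 j h4.1
    have h7 := h5.2
    rw [isMoved_iff] at h7
    unfold StepUp at hstep
    omega
  have hst := stepUp_entryStep k hstep
  rw [map_mul, map_add, map_mul, h2, map_linkProd_pairTerm k i v hpT, map_corrTerm,
    map_entryTerm k i v hp1, ← h1, ← h3, corrTerm_eq, corrTerm_eq, hp, pow_succ, entryTerm,
    entryTerm]
  linear_combination subsetTerm I (corrTerm k part v) (entryTerm k v) (pairTerm v) T *
    (uMono p ^ part' p * uMono p * entryCorr_step p hst +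
      linkProd (pairTerm v) p T * entrySer_step hp1 hst)

theorem partExp_eq_add {L p : ℕ} (hpL : p ∈ Finset.Icc 1 L) {part part' : ℕ → ℕ}
    (hp : part p = part' p + 1) (hpart : ∀ j, 1 ≤ j → j ≠ p → part j = part' j) :
    partExp L part = wt 0 p + partExp L part' := by
  rw [partExp, partExp, ← Finset.add_sum_erase _ _ hpL,
    ← Finset.add_sum_erase _ (fun i => part' i • wt 0 i) hpL, hp, add_smul, one_smul,
    Finset.sum_congr rfl fun j hj => ?_]
  · abel
  · rw [Finset.mem_erase, Finset.mem_Icc] at hj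
    rw [hpart j hj.2.1 hj.1]

theorem coeff_C_mul_uMono_mul {p : ℕ} (a : PolyBT ℚ) (τ : ℕ →₀ ℕ)
    (f : MvPowerSeries ℕ (PolyBT ℚ)) :
    MvPowerSeries.coeff (wt 0 p + τ) (MvPowerSeries.C a * uMono p * f)
      = a * MvPowerSeries.coeff τ f := by
  rw [mul_assoc, MvPowerSeries.coeff_C_mul, uMono, MvPowerSeries.coeff_add_monomial_mul, one_mul]

theorem entrySer_eq_mul_neg (k n : ℕ) : entrySer k (-((n : ℤ) + 2))
    = (1 - PowerSeries.C (tVar ℚ (n + 1)) * PowerSeries.X) * entrySer k (-((n : ℤ) + 1)) := by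
  have h := entrySer_neg k (n + 1)
  rw [show -(((n + 1 : ℕ) : ℤ) + 1) = -((n : ℤ) + 2) by push_cast; ring,
    show -((n + 1 : ℕ) : ℤ) = -((n : ℤ) + 1) by push_cast; ring, cSer_neg_succ] at h
  rw [h, entrySer_neg]
  ring

theorem entryCorr_eq_mul_neg (k j n : ℕ) : entryCorr k j (-((n : ℤ) + 2))
    = -tVar ℚ (n + 1) * entryCorr k j (-((n : ℤ) + 1)) := by
  have h := entryCorr_neg k j (n + 1)
  rw [show -(((n + 1 : ℕ) : ℤ) + 1) = -((n : ℤ) + 2) by push_cast; ring, negT_succ] at h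
  rw [h, entryCorr_neg]
  ring

theorem entrySer_eq_mul_pos (k n : ℕ) (hn : 1 ≤ n) : entrySer k ((n : ℤ) + 1)
    = (1 + PowerSeries.C (tVar ℚ (n + 2)) * PowerSeries.X) * entrySer k ((n : ℤ) + 2) := by
  have h0 := cSer_natCast_succ k (n + 1)
  rw [show (((n + 1 : ℕ) : ℤ) + 1) = (n : ℤ) + 2 by push_cast; ring,
    show ((n + 1 : ℕ) : ℤ) = (n : ℤ) + 1 by push_cast; ring] at h0
  have h2 := geo_mul (tVar ℚ (n + 2))
  rw [entrySer_of_one_lt k (by omega), entrySer_of_one_lt k (by omega), h0]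
  linear_combination -(cSer ℚ k (n + 1)) * h2

/-- The identity behind the step at two positions, in terms of the factors of `λ` and `μ`. -/
theorem pair_step_identity {M : Type*} [CommRing M] {x y R t₁ t₂ κ κσ κ' a aσ a' b bσ b' F F' : M}
    (hκ : κ = -t₁ * x * κ') (hκσ : κ - κσ = (t₂ - t₁) * x * κ')
    (ha : a = (1 - t₁ * x) * a') (haσ : a - aσ = (t₂ - t₁) * x * a')
    (hb : b = (1 + t₂ * y) * b') (hbσ : b - bσ = (t₂ - t₁) * y * b')
    (hy : y = x * R) (hF : F * (1 + R) = F') (lp lq : M) :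
    (κ * b * lq + a * b * lp * lq * F) - (κσ * bσ * lq + aσ * bσ * lp * lq * F)
      = (t₂ - t₁) * x * (κ' * b' * lq + a' * b' * lp * lq * F') := by
  obtain rfl : κσ = κ - (t₂ - t₁) * x * κ' := by linear_combination -hκσ
  obtain rfl : aσ = a - (t₂ - t₁) * x * a' := by linear_combination -haσ
  obtain rfl : bσ = b - (t₂ - t₁) * y * b' := by linear_combination -hbσ
  subst hF hκ ha hb hy
  ring

theorem uMono_eq_mul {i j : ℕ} (h : i < j) :
    uMono j = uMono i * MvPowerSeries.monomial (wt i j) 1 := by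
  rw [uMono, uMono, MvPowerSeries.monomial_mul_monomial, wt_add (Nat.zero_le _) h.le, one_mul]

theorem raiseSer_mul_one_add_X {B : Type*} [CommRing B] {s s' : ℤ} (hs : s < 0) (hs' : 0 ≤ s') :
    raiseSer B s * (1 + PowerSeries.X) = raiseSer B s' := by
  have h := geo_mul (1 : B)
  rw [map_one, one_mul] at h
  rw [raiseSer, raiseSer, if_pos hs, if_neg (by omega)]
  linear_combination (1 - PowerSeries.X) * h

theorem pairTerm_mul {v v' : ℕ → ℤ} {p q : ℕ} (hpq : p < q) (hs : v p + v q < 0)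
    (hs' : 0 ≤ v' p + v' q) :
    pairTerm v p q * (1 + MvPowerSeries.monomial (wt p q) 1) = pairTerm v' p q := by
  have hw := wt_ne_zero hpq
  rw [pairTerm, pairTerm, ← raiseSer_mul_one_add_X hs hs', evMono_mul hw, evMono_add hw, evMono_one hw,
    evMono_X hw]

section PairStep

variable {k : ℕ} [NeZero k] {i L p q : ℕ} {part part' : ℕ → ℕ} {v v' : ℕ → ℤ}

/-- The part of the generating series which involves the positions `p` and `q`. -/
noncomputable def pairBlock (k : ℕ) (part : ℕ → ℕ) (v : ℕ → ℤ) (p q : ℕ) (T : Finset ℕ) :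
    MvPowerSeries ℕ (PolyBT ℚ) :=
  corrTerm k part v p * corrTerm k part v q
    + corrTerm k part v p * entryTerm k v q * linkProd (pairTerm v) q T
    + corrTerm k part v q * entryTerm k v p * linkProd (pairTerm v) p T
    + entryTerm k v p * entryTerm k v q * linkProd (pairTerm v) p T * linkProd (pairTerm v) q T *
      pairTerm v p q

/-- Two positions move: the difference of the generating series is determined by the difference of
the blocks of the two positions. -/
theorem etaSer_sub_map_of_pair (hp1 : 1 ≤ p) (hpq : p < q) (hqL : q ≤ L)
    (hpart : ∀ j, 1 ≤ j → j ≠ p → j ≠ q → part j = part' j) (hv0 : ∀ j, 1 ≤ j → v j ≠ 0)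
    (hv : ∀ j, 1 ≤ j → j ≠ p → j ≠ q → v j = v' j ∧ ¬ IsMoved i (v' j))
    (D : MvPowerSeries ℕ (PolyBT ℚ)) (E : Finset ℕ → MvPowerSeries ℕ (PolyBT ℚ))
    (hblock : ∀ T ⊆ ((Finset.Icc 1 L).erase p).erase q,
      pairBlock k part v p q T - MvPowerSeries.map (reflectRat k i) (pairBlock k part v p q T)
        = D * (pairBlock k part' v' p q T + E T)) :
    etaSer k L part v - MvPowerSeries.map (reflectRat k i) (etaSer k L part v)
      = D * (etaSer k L part' v' + ∑ T ∈ (((Finset.Icc 1 L).erase p).erase q).powerset,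
        subsetTerm (((Finset.Icc 1 L).erase p).erase q) (corrTerm k part' v') (entryTerm k v')
          (pairTerm v') T * E T) := by
  have hpL : p ∈ Finset.Icc 1 L := Finset.mem_Icc.2 ⟨hp1, by omega⟩
  have hqL' : q ∈ (Finset.Icc 1 L).erase p :=
    Finset.mem_erase.2 ⟨by omega, Finset.mem_Icc.2 ⟨by omega, hqL⟩⟩
  obtain ⟨I, hI⟩ : ∃ I, I = ((Finset.Icc 1 L).erase p).erase q := ⟨_, rfl⟩
  rw [← hI] at hblock ⊢
  have hins : Finset.Icc 1 L = insert p (insert q I) := by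
    rw [hI, Finset.insert_erase hqL', Finset.insert_erase hpL]
  have hmem : ∀ j ∈ I, 1 ≤ j ∧ j ≠ p ∧ j ≠ q := by
    intro j hj
    rw [hI, Finset.mem_erase, Finset.mem_erase, Finset.mem_Icc] at hj
    exact ⟨hj.2.2.1, hj.2.1, hj.1⟩
  have hpI : p ∉ I := fun h => (hmem p h).2.1 rfl
  have hqI : q ∉ I := fun h => (hmem q h).2.2 rfl
  rw [etaSer, etaSer, hins, subsetSum_insert_insert _ _ _ hpq hpI hqI,
    subsetSum_insert_insert _ _ _ hpq hpI hqI, map_sum, ← Finset.sum_sub_distrib,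
    ← Finset.sum_add_distrib, Finset.mul_sum]
  refine Finset.sum_congr rfl fun T hT => ?_
  rw [Finset.mem_powerset] at hT
  have h1 := subsetTerm_eq_of_unmoved (k := k)
    (fun j hj => hpart j (hmem j hj).1 (hmem j hj).2.1 (hmem j hj).2.2)
    (fun j hj => (hv j (hmem j hj).1 (hmem j hj).2.1 (hmem j hj).2.2).1) hT
  have h2 := map_subsetTerm_of_unmoved (k := k) (i := i) (part := part)
    (fun j hj => (hmem j hj).1) (fun j hj => hv0 j (hmem j hj).1)
    (fun j hj => by
      have := hv j (hmem j hj).1 (hmem j hj).2.1 (hmem j hj).2.2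
      rw [this.1]
      exact this.2) hT
  have h3 := hblock T hT
  unfold pairBlock at h3
  rw [map_mul, h2, ← h1]
  linear_combination subsetTerm I (corrTerm k part v) (entryTerm k v) (pairTerm v) T * h3

end PairStep

/-! ### The blocks of two moving positions -/

/-- Evaluation of power series at a monomial, as a ring homomorphism. -/
noncomputable def evMonoHom {A : Type*} [CommRing A] {e : ℕ →₀ ℕ} (he : e ≠ 0) :
    PowerSeries A →+* MvPowerSeries ℕ A where
  toFun := evMono e
  map_one' := evMono_one he
  map_mul' := evMono_mul he
  map_zero' := by
    have := evMono_sub he (1 : PowerSeries A) 1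
    simpa using this
  map_add' := evMono_add he

section

variable {A : Type*} [CommRing A] {e : ℕ →₀ ℕ} (he : e ≠ 0)

theorem evMonoHom_apply (f : PowerSeries A) : evMonoHom he f = evMono e f := rfl

theorem evMonoHom_C (a : A) : evMonoHom he (PowerSeries.C a) = MvPowerSeries.C a := evMono_C a

theorem evMonoHom_X :
    evMonoHom he (PowerSeries.X : PowerSeries A) = MvPowerSeries.monomial e 1 := evMono_X he

end

/-- The reflection `s_{n+1}` with `n ≥ 1` moves the entries `-(n+1)` and `n+2` to `-(n+2)` and `n+1`.
There is no correction at `q`, whose entry is greater than `1` both for `λ` and for `μ`. -/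
theorem pairBlock_step {k : ℕ} [NeZero k] {n p q : ℕ} {part part' : ℕ → ℕ} {v v' : ℕ → ℤ}
    {T : Finset ℕ} (hn : 1 ≤ n) (hp1 : 1 ≤ p) (hpq : p < q) (hp : part p = part' p + 1)
    (hvp : v p = -((n : ℤ) + 2)) (hvq : v q = (n : ℤ) + 1) (hvp' : v' p = -((n : ℤ) + 1))
    (hvq' : v' q = (n : ℤ) + 2) (hpT : p ∉ T) (hqT : q ∉ T)
    (hlp : linkProd (pairTerm v) p T = linkProd (pairTerm v') p T)
    (hlq : linkProd (pairTerm v) q T = linkProd (pairTerm v') q T) :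
    pairBlock k part v p q T
        - MvPowerSeries.map (reflectRat k (n + 1)) (pairBlock k part v p q T)
      = MvPowerSeries.C (toRat (denom (n + 1))) * uMono p * (pairBlock k part' v' p q T + 0) := by
  have hq1 : 1 ≤ q := by omega
  have hwp := wt_ne_zero (show 0 < p by omega)
  have hwq := wt_ne_zero (show 0 < q by omega)
  have hsp : EntryStep k (n + 1) (v p) (v' p) := by
    rw [hvp, hvp']
    exact entryStep_neg k n
  have hsq : EntryStep k (n + 1) (v q) (v' q) := by
    rw [hvq, hvq']
    exact entryStep_pos k n
  have hκq : corrTerm k part v q = 0 := by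
    rw [corrTerm, entryCorr_of_one_lt k q (by omega), map_zero]
  have hκq' : corrTerm k part' v' q = 0 := by
    rw [corrTerm, entryCorr_of_one_lt k q (by omega), map_zero]
  have hδ : (MvPowerSeries.C (toRat (denom (n + 1))) : MvPowerSeries ℕ (PolyBT ℚ))
      = MvPowerSeries.C (tVar ℚ (n + 2)) - MvPowerSeries.C (tVar ℚ (n + 1)) := by
    rw [toRat_denom_succ, map_sub]
  have hκ : corrTerm k part v p
      = -MvPowerSeries.C (tVar ℚ (n + 1)) * uMono p * corrTerm k part' v' p := by
    rw [corrTerm_eq, corrTerm_eq, hvp, hvp', entryCorr_eq_mul_neg, hp, map_mul, map_neg]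
    ring
  have ha : entryTerm k v p
      = (1 - MvPowerSeries.C (tVar ℚ (n + 1)) * uMono p) * entryTerm k v' p := by
    rw [entryTerm, entryTerm, hvp, hvp', entrySer_eq_mul_neg, ← evMonoHom_apply hwp,
      ← evMonoHom_apply hwp, map_mul, map_sub, map_mul, map_one, evMonoHom_C, evMonoHom_X, uMono]
  have hb : entryTerm k v q
      = (1 + MvPowerSeries.C (tVar ℚ (n + 2)) * uMono q) * entryTerm k v' q := by
    rw [entryTerm, entryTerm, hvq, hvq', entrySer_eq_mul_pos k n hn, ← evMonoHom_apply hwq,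
      ← evMonoHom_apply hwq, map_mul, map_add, map_mul, map_one, evMonoHom_C, evMonoHom_X, uMono]
  have hκσ := entryCorr_step p hsp
  have haσ := entrySer_step hp1 hsp
  have hbσ := entrySer_step hq1 hsq
  have hF := pairTerm_mul (v := v) (v' := v') hpq (by omega) (by omega)
  have hκσ' : corrTerm k part v p
        - MvPowerSeries.C (reflectRat k (n + 1) (entryCorr k p (v p))) * uMono p ^ part p
      = (MvPowerSeries.C (tVar ℚ (n + 2)) - MvPowerSeries.C (tVar ℚ (n + 1))) * uMono p *
        corrTerm k part' v' p := by
    rw [corrTerm_eq, corrTerm_eq, ← hδ, hp]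
    linear_combination uMono p ^ (part' p + 1) * hκσ
  have h := pair_step_identity hκ hκσ' ha (by rw [← hδ]; exact haσ) hb (by rw [← hδ]; exact hbσ)
    (uMono_eq_mul hpq) hF (linkProd (pairTerm v') p T) (linkProd (pairTerm v') q T)
  simp only [pairBlock, map_add, map_mul, map_entryTerm k (n + 1) v hp1,
    map_entryTerm k (n + 1) v hq1, map_linkProd_pairTerm k (n + 1) v' hpT,
    map_linkProd_pairTerm k (n + 1) v' hqT, map_pairTerm k (n + 1) v hpq, hκq, hκq', map_zero,
    map_corrTerm k (n + 1) part v p, hlp, hlq]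
  rw [hδ]
  linear_combination h

/-- The deviation, up to the factor `u_p` and the denominator, of the difference of the blocks from
the block of `μ`, in the exceptional cases. -/
noncomputable def pairExcess (k : ℕ) (v v' : ℕ → ℤ) (p q : ℕ) (T : Finset ℕ) :
    MvPowerSeries ℕ (PolyBT ℚ) :=
  MvPowerSeries.C (entryCorr k p (v' p)) ^ 2 * uMono p ^ k * uMono q ^ k
    + MvPowerSeries.C (entryCorr k p (v' p)) *
      (uMono q ^ k * evMono (wt 0 p) (entrySer k (v' p)) * linkProd (pairTerm v') p T
        - uMono p ^ k * evMono (wt 0 q) (entrySer k (v' p)) * linkProd (pairTerm v') q T)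
    - evMono (wt 0 p) (entrySer k (v' p)) * evMono (wt 0 q) (entrySer k (v' p)) *
      linkProd (pairTerm v') p T * linkProd (pairTerm v') q T * pairTerm v p q

/-- The series `∑ c_p X^p / (2 (1 + t_1 X) (1 + t_2 X))`. -/
noncomputable def halfSer (k : ℕ) : PowerSeries (PolyBT ℚ) := PowerSeries.C half * cSer ℚ k 2

theorem entrySer_two_eq (k : ℕ) : entrySer k 2 = halfSer k + halfSer k := by
  have h : (PowerSeries.C half + PowerSeries.C half : PowerSeries (PolyBT ℚ)) = 1 := by
    rw [← map_add, half_add_half, map_one]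
  rw [entrySer_of_one_lt k (by norm_num), halfSer]
  linear_combination -(cSer ℚ k 2) * h

theorem entrySer_neg_one_eq (k : ℕ) : entrySer k (-1)
    = (1 + PowerSeries.C (tVar ℚ 1) * PowerSeries.X) *
      (1 + PowerSeries.C (tVar ℚ 2) * PowerSeries.X) * halfSer k := by
  have h1 := geo_mul (tVar ℚ 1)
  have h2 := geo_mul (tVar ℚ 2)
  rw [entrySer_neg_one, halfSer, cSer_two]
  linear_combination -(PowerSeries.C half * cBase ℚ k) * (h1 +
    geo (tVar ℚ 1) * (1 + PowerSeries.C (tVar ℚ 1) * PowerSeries.X) * h2)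

theorem entrySer_one_eq (k : ℕ) : entrySer k 1
    = (1 - PowerSeries.C (tVar ℚ 1) * PowerSeries.X) *
      (1 + PowerSeries.C (tVar ℚ 2) * PowerSeries.X) * halfSer k := by
  have h2 := geo_mul (tVar ℚ 2)
  rw [entrySer_one, halfSer, cSer_two]
  linear_combination -(PowerSeries.C half * cBase ℚ k *
    (1 - PowerSeries.C (tVar ℚ 1) * PowerSeries.X) * geo (tVar ℚ 1)) * h2

theorem entrySer_neg_two_eq (k : ℕ) : entrySer k (-2)
    = (1 - PowerSeries.C (tVar ℚ 1) * PowerSeries.X) * entrySer k (-1) := by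
  rw [entrySer_neg_two, entrySer_neg_one]
  ring

theorem map_reflectRat_one_entrySer_neg_one (k : ℕ) :
    PowerSeries.map (reflectRat k 1) (entrySer k (-1)) = entrySer k (-1) := by
  rw [entrySer_neg_one, map_mul, PowerSeries.map_C, reflectRat_half, map_reflectRat_succ_cBase]

theorem reflectRat_one_tVar_one (k : ℕ) : reflectRat k 1 (tVar ℚ 1) = tVar ℚ 2 :=
  reflectRat_succ_tVar_self k 0

theorem reflectRat_one_tVar_two (k : ℕ) : reflectRat k 1 (tVar ℚ 2) = tVar ℚ 1 := by
  have h := reflectRat_succ_tVar k 0 1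
  rwa [Equiv.swap_apply_right] at h

theorem map_reflectRat_one_halfSer (k : ℕ) :
    PowerSeries.map (reflectRat k 1) (halfSer k) = halfSer k := by
  rw [halfSer, cSer_two]
  simp only [map_mul, PowerSeries.map_C, reflectRat_half, map_reflectRat_succ_cBase, map_geo,
    reflectRat_one_tVar_one, reflectRat_one_tVar_two]
  ring

theorem map_reflectRat_zero_halfSer_mul (k : ℕ) [NeZero k] :
    PowerSeries.map (reflectRat k 0) (entrySer k (-1))
      = (1 - PowerSeries.C (tVar ℚ 1) * PowerSeries.X) *
        (1 - PowerSeries.C (tVar ℚ 2) * PowerSeries.X) * halfSer k := by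
  rw [entrySer_neg_one, map_mul, PowerSeries.map_C, reflectRat_half, map_reflectRat_zero_cBase,
    halfSer, cSer_two]
  ring

/-- The identity behind the step in the exceptional case of `s_1`. Here `β` is half of the factor of
`μ` at the second position, and `gy` is the series of the entry `-1`, evaluated at `y`. -/
theorem pair_excess_identity_one {M : Type*} [CommRing M]
    {x y R t₁ t₂ S xk yk κp κpσ κq κp' a aσ a' b bσ b' gy β F F' : M}
    (hκp : κp = -t₁ * x * κp') (hκpσ : κpσ = -t₂ * x * κp') (hκp' : κp' = S * xk)
    (hκq : κq = S * yk) (ha : a = (1 - t₁ * x) * a') (haσ : aσ = (1 - t₂ * x) * a')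
    (hb : b = (1 - t₁ * y) * (1 + t₂ * y) * β) (hbσ : bσ = (1 - t₂ * y) * (1 + t₁ * y) * β)
    (hb' : b' = β + β) (hgy : gy = (1 + t₁ * y) * (1 + t₂ * y) * β)
    (hy : y = x * R) (hF : F * (1 + R) = F') (lp lq : M) :
    (κp * κq + κp * b * lq + κq * a * lp + a * b * lp * lq * F)
        - (κpσ * κq + κpσ * bσ * lq + κq * aσ * lp + aσ * bσ * lp * lq * F)
      = (t₂ - t₁) * x * (κp' * b' * lq + a' * b' * lp * lq * F' +
        (S ^ 2 * xk * yk + S * (yk * a' * lp - xk * gy * lq) - a' * gy * lp * lq * F)) := by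
  subst hκp hκpσ hκp' hκq ha haσ hb hbσ hb' hgy hF hy
  ring

/-- The identity behind the step in the exceptional case of `s_0`. Here `β` is half of the factor of
`μ` at the second position, and `gy` is the series of the entry `1`, evaluated at `y`. -/
theorem pair_excess_identity_zero {M : Type*} [CommRing M]
    {x y R t₁ t₂ S xk yk κp κpσ κq κqσ κp' a aσ a' γ b bσ b' gy β F F' : M}
    (hκp : κp = t₁ * x * κp') (hκpσ : κpσ = -t₂ * x * κp') (hκp' : κp' = S * xk)
    (hκq : κq = S * yk) (hκqσ : κqσ = S * yk)
    (ha : a = (1 - t₁ * x) * ((1 + t₁ * x) * (1 + t₂ * x) * γ))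
    (haσ : aσ = (1 + t₂ * x) * ((1 - t₁ * x) * (1 - t₂ * x) * γ))
    (ha' : a' = (1 - t₁ * x) * (1 + t₂ * x) * γ)
    (hb : b = (1 + t₁ * y) * (1 + t₂ * y) * β) (hbσ : bσ = (1 - t₁ * y) * (1 - t₂ * y) * β)
    (hb' : b' = β + β) (hgy : gy = (1 - t₁ * y) * (1 + t₂ * y) * β)
    (hy : y = x * R) (hF : F * (1 + R) = F') (lp lq : M) :
    (κp * κq + κp * b * lq + κq * a * lp + a * b * lp * lq * F)
        - (κpσ * κqσ + κpσ * bσ * lq + κqσ * aσ * lp + aσ * bσ * lp * lq * F)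
      = (t₁ + t₂) * x * (κp' * b' * lq + a' * b' * lp * lq * F' +
        (S ^ 2 * xk * yk + S * (yk * a' * lp - xk * gy * lq) - a' * gy * lp * lq * F)) := by
  subst hκp hκpσ hκp' hκq hκqσ ha haσ ha' hb hbσ hb' hgy hF hy
  ring

theorem posSign_succ (p : ℕ) : posSign (p + 1) = -posSign p := by
  by_cases h : Odd p
  · rw [posSign_of_odd h, posSign_of_not_odd (by rw [Nat.odd_add_one]; exact not_not.2 h)]
  · rw [posSign_of_not_odd h, posSign_of_odd (by rw [Nat.odd_add_one]; exact h)]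
    ring

section Exceptional

variable {k : ℕ} [NeZero k] {p : ℕ} {part part' : ℕ → ℕ} {v v' : ℕ → ℤ} {T : Finset ℕ}

/-- The exceptional case in which `s_1` moves the entries `-1` and `2` to `-2` and `1`. -/
theorem pairBlock_step_one (hp1 : 1 ≤ p) (hp : part p = k + 1) (hq : part (p + 1) = k)
    (hp' : part' p = k) (hvp : v p = -2) (hvq : v (p + 1) = 1) (hvp' : v' p = -1)
    (hvq' : v' (p + 1) = 2) (hpT : p ∉ T) (hqT : p + 1 ∉ T)
    (hlp : linkProd (pairTerm v) p T = linkProd (pairTerm v') p T)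
    (hlq : linkProd (pairTerm v) (p + 1) T = linkProd (pairTerm v') (p + 1) T) :
    pairBlock k part v p (p + 1) T
        - MvPowerSeries.map (reflectRat k 1) (pairBlock k part v p (p + 1) T)
      = MvPowerSeries.C (toRat (denom 1)) * uMono p *
        (pairBlock k part' v' p (p + 1) T + pairExcess k v v' p (p + 1) T) := by
  have hpq : p < p + 1 := by omega
  have hwp := wt_ne_zero (show 0 < p by omega)
  have hwq := wt_ne_zero (show 0 < p + 1 by omega)
  obtain ⟨S, hS⟩ : ∃ S, S = entryCorr k p (-1) := ⟨_, rfl⟩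
  have hS1 : entryCorr k (p + 1) 1 = S := by
    rw [hS, entryCorr_one, entryCorr_neg_one, posSign_succ]
    ring
  have hS2 : entryCorr k p (-2) = -tVar ℚ 1 * S := by
    rw [hS, entryCorr_neg_two, entryCorr_neg_one]
    ring
  have hSσ : reflectRat k 1 S = S := by
    rw [hS, entryCorr_neg_one, map_mul, map_mul, reflectRat_half, reflectRat_posSign,
      reflectRat_dDiff]
  have hκq' : corrTerm k part' v' (p + 1) = 0 := by
    rw [corrTerm, entryCorr_of_one_lt k (p + 1) (by omega), map_zero]
  have hδ : (MvPowerSeries.C (toRat (denom 1)) : MvPowerSeries ℕ (PolyBT ℚ))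
      = MvPowerSeries.C (tVar ℚ 2) - MvPowerSeries.C (tVar ℚ 1) := by
    rw [toRat_denom_succ, map_sub]
  have hκp' : corrTerm k part' v' p = MvPowerSeries.C S * uMono p ^ k := by
    rw [corrTerm_eq, hvp', hp', hS]
  have hκp : corrTerm k part v p
      = -MvPowerSeries.C (tVar ℚ 1) * uMono p * corrTerm k part' v' p := by
    rw [corrTerm_eq, hκp', hvp, hS2, hp, map_mul, map_neg]
    ring
  have hκpσ : MvPowerSeries.map (reflectRat k 1) (corrTerm k part v p)
      = -MvPowerSeries.C (tVar ℚ 2) * uMono p * corrTerm k part' v' p := by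
    rw [map_corrTerm, hκp', hvp, hS2, hp, map_mul, map_neg, hSσ, reflectRat_one_tVar_one, map_mul,
      map_neg]
    ring
  have hκq : corrTerm k part v (p + 1) = MvPowerSeries.C S * uMono (p + 1) ^ k := by
    rw [corrTerm_eq, hvq, hS1, hq]
  have hκqσ : MvPowerSeries.map (reflectRat k 1) (corrTerm k part v (p + 1))
      = MvPowerSeries.C S * uMono (p + 1) ^ k := by
    rw [map_corrTerm, hvq, hS1, hSσ, hq]
  have ha : entryTerm k v p
      = (1 - MvPowerSeries.C (tVar ℚ 1) * uMono p) * entryTerm k v' p := by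
    rw [entryTerm, entryTerm, hvp, hvp', entrySer_neg_two_eq, ← evMonoHom_apply hwp,
      ← evMonoHom_apply hwp, map_mul, map_sub, map_mul, map_one, evMonoHom_C, evMonoHom_X, uMono]
  have haσ : MvPowerSeries.map (reflectRat k 1) (entryTerm k v p)
      = (1 - MvPowerSeries.C (tVar ℚ 2) * uMono p) * entryTerm k v' p := by
    rw [map_entryTerm k 1 v hp1, entryTerm, hvp, hvp', entrySer_neg_two_eq, map_mul,
      map_reflectRat_one_entrySer_neg_one, ← evMonoHom_apply hwp, ← evMonoHom_apply hwp]
    simp only [map_mul, map_sub, map_one, PowerSeries.map_C, PowerSeries.map_X, evMonoHom_C,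
      evMonoHom_X, reflectRat_one_tVar_one, uMono]
  have hb : entryTerm k v (p + 1)
      = (1 - MvPowerSeries.C (tVar ℚ 1) * uMono (p + 1)) *
        (1 + MvPowerSeries.C (tVar ℚ 2) * uMono (p + 1)) * evMonoHom hwq (halfSer k) := by
    rw [entryTerm, hvq, entrySer_one_eq, ← evMonoHom_apply hwq]
    simp only [map_mul, map_sub, map_add, map_one, evMonoHom_C, evMonoHom_X, uMono]
  have hbσ : MvPowerSeries.map (reflectRat k 1) (entryTerm k v (p + 1))
      = (1 - MvPowerSeries.C (tVar ℚ 2) * uMono (p + 1)) *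
        (1 + MvPowerSeries.C (tVar ℚ 1) * uMono (p + 1)) * evMonoHom hwq (halfSer k) := by
    rw [map_entryTerm k 1 v (by omega), hvq, entrySer_one_eq, map_mul, map_reflectRat_one_halfSer,
      ← evMonoHom_apply hwq]
    simp only [map_mul, map_sub, map_add, map_one, PowerSeries.map_C, PowerSeries.map_X,
      evMonoHom_C, evMonoHom_X, reflectRat_one_tVar_one, reflectRat_one_tVar_two, uMono]
  have hb' : entryTerm k v' (p + 1) = evMonoHom hwq (halfSer k) + evMonoHom hwq (halfSer k) := by
    rw [entryTerm, hvq', entrySer_two_eq, ← evMonoHom_apply hwq, map_add]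
  have hgy : evMono (wt 0 (p + 1)) (entrySer k (v' p))
      = (1 + MvPowerSeries.C (tVar ℚ 1) * uMono (p + 1)) *
        (1 + MvPowerSeries.C (tVar ℚ 2) * uMono (p + 1)) * evMonoHom hwq (halfSer k) := by
    rw [hvp', entrySer_neg_one_eq, ← evMonoHom_apply hwq]
    simp only [map_mul, map_add, map_one, evMonoHom_C, evMonoHom_X, uMono]
  have hF := pairTerm_mul (v := v) (v' := v') hpq (by omega) (by omega)
  have h := pair_excess_identity_one hκp hκpσ hκp' hκq ha haσ hb hbσ hb' hgy (uMono_eq_mul hpq) hF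
    (linkProd (pairTerm v') p T) (linkProd (pairTerm v') (p + 1) T)
  have hSv : entryCorr k p (v' p) = S := by rw [hvp', hS]
  simp only [pairBlock, pairExcess, map_add, map_mul, map_linkProd_pairTerm k 1 v' hpT,
    map_linkProd_pairTerm k 1 v' hqT, map_pairTerm k 1 v hpq, hκq', hlp, hlq, hκqσ, hSv]
  rw [← hκq, hδ]
  have hg : evMono (wt 0 p) (entrySer k (v' p)) = entryTerm k v' p := rfl
  rw [hg]
  linear_combination h

/-- The exceptional case in which `s_0` moves the entries `1` and `2` to `-2` and `-1`. -/
theorem pairBlock_step_zero (hp1 : 1 ≤ p) (hp : part p = k + 1) (hq : part (p + 1) = k)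
    (hp' : part' p = k) (hvp : v p = -2) (hvq : v (p + 1) = -1) (hvp' : v' p = 1)
    (hvq' : v' (p + 1) = 2) (hpT : p ∉ T) (hqT : p + 1 ∉ T)
    (hlp : linkProd (pairTerm v) p T = linkProd (pairTerm v') p T)
    (hlq : linkProd (pairTerm v) (p + 1) T = linkProd (pairTerm v') (p + 1) T) :
    pairBlock k part v p (p + 1) T
        - MvPowerSeries.map (reflectRat k 0) (pairBlock k part v p (p + 1) T)
      = MvPowerSeries.C (toRat (denom 0)) * uMono p *
        (pairBlock k part' v' p (p + 1) T + pairExcess k v v' p (p + 1) T) := by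
  have hpq : p < p + 1 := by omega
  have hwp := wt_ne_zero (show 0 < p by omega)
  have hwq := wt_ne_zero (show 0 < p + 1 by omega)
  obtain ⟨S, hS⟩ : ∃ S, S = entryCorr k p 1 := ⟨_, rfl⟩
  have hS1 : entryCorr k (p + 1) (-1) = S := by
    rw [hS, entryCorr_one, entryCorr_neg_one, posSign_succ]
    ring
  have hS2 : entryCorr k p (-2) = tVar ℚ 1 * S := by
    rw [hS, entryCorr_neg_two, entryCorr_one]
    ring
  have hSσ : reflectRat k 0 S = S := by
    rw [hS, entryCorr_one, map_neg, map_mul, map_mul, reflectRat_half, reflectRat_posSign,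
      reflectRat_dDiff]
  have hκq' : corrTerm k part' v' (p + 1) = 0 := by
    rw [corrTerm, entryCorr_of_one_lt k (p + 1) (by omega), map_zero]
  have hδ : (MvPowerSeries.C (toRat (denom 0)) : MvPowerSeries ℕ (PolyBT ℚ))
      = MvPowerSeries.C (tVar ℚ 1) + MvPowerSeries.C (tVar ℚ 2) := by
    rw [toRat_denom_zero, map_add]
  have hκp' : corrTerm k part' v' p = MvPowerSeries.C S * uMono p ^ k := by
    rw [corrTerm_eq, hvp', hp', hS]
  have hκp : corrTerm k part v p
      = MvPowerSeries.C (tVar ℚ 1) * uMono p * corrTerm k part' v' p := by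
    rw [corrTerm_eq, hκp', hvp, hS2, hp, map_mul]
    ring
  have hκpσ : MvPowerSeries.map (reflectRat k 0) (corrTerm k part v p)
      = -MvPowerSeries.C (tVar ℚ 2) * uMono p * corrTerm k part' v' p := by
    rw [map_corrTerm, hκp', hvp, hS2, hp, map_mul, hSσ, reflectRat_zero_tVar_one, map_mul,
      map_neg]
    ring
  have hκq : corrTerm k part v (p + 1) = MvPowerSeries.C S * uMono (p + 1) ^ k := by
    rw [corrTerm_eq, hvq, hS1, hq]
  have hκqσ : MvPowerSeries.map (reflectRat k 0) (corrTerm k part v (p + 1))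
      = MvPowerSeries.C S * uMono (p + 1) ^ k := by
    rw [map_corrTerm, hvq, hS1, hSσ, hq]
  have ha : entryTerm k v p = (1 - MvPowerSeries.C (tVar ℚ 1) * uMono p) *
      ((1 + MvPowerSeries.C (tVar ℚ 1) * uMono p) * (1 + MvPowerSeries.C (tVar ℚ 2) * uMono p) *
        evMonoHom hwp (halfSer k)) := by
    rw [entryTerm, hvp, entrySer_neg_two_eq, entrySer_neg_one_eq, ← evMonoHom_apply hwp]
    simp only [map_mul, map_sub, map_add, map_one, evMonoHom_C, evMonoHom_X, uMono]
  have haσ : MvPowerSeries.map (reflectRat k 0) (entryTerm k v p)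
      = (1 + MvPowerSeries.C (tVar ℚ 2) * uMono p) *
      ((1 - MvPowerSeries.C (tVar ℚ 1) * uMono p) * (1 - MvPowerSeries.C (tVar ℚ 2) * uMono p) *
        evMonoHom hwp (halfSer k)) := by
    rw [map_entryTerm k 0 v hp1, hvp, entrySer_neg_two_eq, map_mul,
      map_reflectRat_zero_halfSer_mul, ← evMonoHom_apply hwp]
    simp only [map_mul, map_sub, map_neg, map_one, PowerSeries.map_C, PowerSeries.map_X,
      evMonoHom_C, evMonoHom_X, reflectRat_zero_tVar_one, uMono]
    ring
  have ha' : entryTerm k v' p = (1 - MvPowerSeries.C (tVar ℚ 1) * uMono p) *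
      (1 + MvPowerSeries.C (tVar ℚ 2) * uMono p) * evMonoHom hwp (halfSer k) := by
    rw [entryTerm, hvp', entrySer_one_eq, ← evMonoHom_apply hwp]
    simp only [map_mul, map_sub, map_add, map_one, evMonoHom_C, evMonoHom_X, uMono]
  have hb : entryTerm k v (p + 1)
      = (1 + MvPowerSeries.C (tVar ℚ 1) * uMono (p + 1)) *
        (1 + MvPowerSeries.C (tVar ℚ 2) * uMono (p + 1)) * evMonoHom hwq (halfSer k) := by
    rw [entryTerm, hvq, entrySer_neg_one_eq, ← evMonoHom_apply hwq]
    simp only [map_mul, map_add, map_one, evMonoHom_C, evMonoHom_X, uMono]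
  have hbσ : MvPowerSeries.map (reflectRat k 0) (entryTerm k v (p + 1))
      = (1 - MvPowerSeries.C (tVar ℚ 1) * uMono (p + 1)) *
        (1 - MvPowerSeries.C (tVar ℚ 2) * uMono (p + 1)) * evMonoHom hwq (halfSer k) := by
    rw [map_entryTerm k 0 v (by omega), hvq, map_reflectRat_zero_halfSer_mul,
      ← evMonoHom_apply hwq]
    simp only [map_mul, map_sub, map_one, evMonoHom_C, evMonoHom_X, uMono]
  have hb' : entryTerm k v' (p + 1) = evMonoHom hwq (halfSer k) + evMonoHom hwq (halfSer k) := by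
    rw [entryTerm, hvq', entrySer_two_eq, ← evMonoHom_apply hwq, map_add]
  have hgy : evMono (wt 0 (p + 1)) (entrySer k (v' p))
      = (1 - MvPowerSeries.C (tVar ℚ 1) * uMono (p + 1)) *
        (1 + MvPowerSeries.C (tVar ℚ 2) * uMono (p + 1)) * evMonoHom hwq (halfSer k) := by
    rw [hvp', entrySer_one_eq, ← evMonoHom_apply hwq]
    simp only [map_mul, map_sub, map_add, map_one, evMonoHom_C, evMonoHom_X, uMono]
  have hF := pairTerm_mul (v := v) (v' := v') hpq (by omega) (by omega)
  have h := pair_excess_identity_zero hκp hκpσ hκp' hκq hκqσ ha haσ ha' hb hbσ hb' hgy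
    (uMono_eq_mul hpq) hF (linkProd (pairTerm v') p T) (linkProd (pairTerm v') (p + 1) T)
  have hSv : entryCorr k p (v' p) = S := by rw [hvp', hS]
  simp only [pairBlock, pairExcess, map_add, map_mul, map_linkProd_pairTerm k 0 v' hpT,
    map_linkProd_pairTerm k 0 v' hqT, map_pairTerm k 0 v hpq, hκq', hlp, hlq, hSv]
  rw [hδ]
  have hg : evMono (wt 0 p) (entrySer k (v' p)) = entryTerm k v' p := rfl
  rw [hg]
  linear_combination h

end Exceptional

namespace TypedPartition

/-! ### The divided difference of a double eta polynomial -/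

variable {k : ℕ} [NeZero k] {lam mu : TypedPartition k} {i : ℕ}

/-- The deviation of `∂_i H_λ` from `H_μ` when the entries in positions `p` and `p + 1` move. -/
noncomputable def excess (lam mu : TypedPartition k) (L p : ℕ) : PolyBT ℚ :=
  MvPowerSeries.coeff (partExp L mu.part)
    (∑ T ∈ (((Finset.Icc 1 L).erase p).erase (p + 1)).powerset,
      subsetTerm (((Finset.Icc 1 L).erase p).erase (p + 1)) (corrTerm k mu.part mu.entry)
        (entryTerm k mu.entry) (pairTerm mu.entry) T *
        pairExcess k lam.entry mu.entry p (p + 1) T)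

/-- The reflection moves the entries in the positions `p` and `p + 1`, where it is either `s_1`,
replacing `(-1, 2)` by `(-2, 1)`, or `s_0`, replacing `(1, 2)` by `(-2, -1)`. -/
structure IsExceptional (lam mu : TypedPartition k) (p : ℕ) : Prop where
  one_le : 1 ≤ p
  part_lam : lam.part p = k + 1
  part_mu : mu.part p = k
  part_mu_succ : mu.part (p + 1) = k
  abs_mu : |mu.entry p| = 1
  mu_succ : mu.entry (p + 1) = 2
  lam_add_neg : lam.entry p + lam.entry (p + 1) < 0

theorem coeff_etaSer_step {L p : ℕ} (hL1 : lam.length ≤ L) (hL2 : mu.length ≤ L)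
    (hpL : p ∈ Finset.Icc 1 L) (hp : lam.part p = mu.part p + 1)
    (hpart : ∀ j, 1 ≤ j → j ≠ p → lam.part j = mu.part j) (E : MvPowerSeries ℕ (PolyBT ℚ))
    (h : etaSer k L lam.part lam.entry
        - MvPowerSeries.map (reflectRat k i) (etaSer k L lam.part lam.entry)
      = MvPowerSeries.C (toRat (denom i)) * uMono p * (etaSer k L mu.part mu.entry + E)) :
    lam.doubleEta - reflectRat k i lam.doubleEta
      = toRat (denom i) * (mu.doubleEta + MvPowerSeries.coeff (partExp L mu.part) E) := by
  rw [lam.doubleEta_eq_coeff hL1, mu.doubleEta_eq_coeff hL2, ← MvPowerSeries.coeff_map, ← map_sub,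
    h, partExp_eq_add hpL hp hpart, coeff_C_mul_uMono_mul, map_add]

/-- Consecutive parts `k + 1` and `k` belong to the entries `-2` and `± 1`. -/
theorem entry_of_part_eq {p : ℕ} (hp : 1 ≤ p) (h1 : lam.part p = k + 1)
    (h2 : lam.part (p + 1) = k) : lam.entry p = -2 ∧ |lam.entry (p + 1)| = 1 := by
  have hk := Nat.pos_of_ne_zero (NeZero.ne k)
  have h3 := lam.entry_ne_zero hp
  have h4 : lam.entry p < 0 := by
    by_contra h
    have := lam.part_le_of_entry_pos hp (by omega)
    omega
  have h5 := lam.part_of_entry_neg hp h4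
  refine ⟨by omega, ?_⟩
  have hl : p + 1 ≤ lam.length := by
    by_contra h
    rw [lam.part_eq_zero (j := p + 1) (by omega)] at h2
    omega
  have ht : 0 < lam.type := lam.type_pos_iff.2 (by
    have := lam.part_mem (j := p + 1) (by omega) hl
    rwa [h2] at this)
  have h6 := lam.le_numLarge_iff hp
  have h7 := lam.le_numLarge_iff (j := p + 1) (by omega)
  have hm : p + 1 = lam.mid := by
    rw [mid]
    omega
  rw [hm]
  exact lam.abs_entry_mid ht

/-- The divided difference of `H_λ` is `H_μ`, except possibly in the exceptional cases. -/
theorem doubleEta_step (hsize : lam.size = mu.size + 1)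
    (hweyl : lam.weyl = simpleReflection i * mu.weyl) :
    (lam.doubleEta - reflectRat k i lam.doubleEta = toRat (denom i) * mu.doubleEta ∧
      ∀ p, 1 ≤ p → lam.part p = k + 1 → mu.part p = k → lam.part (p + 1) ≠ k) ∨
    ∃ p, IsExceptional lam mu p ∧ i ≤ 1 ∧ 0 < lam.type ∧ 0 < mu.type ∧
      ∀ L, lam.length ≤ L → mu.length ≤ L → p + 1 ≤ L →
        lam.doubleEta - reflectRat k i lam.doubleEta
          = toRat (denom i) * (mu.doubleEta + excess lam mu L p) := by
  obtain ⟨p, hp1, hp, hpart, hcases⟩ := reflection_cases hsize hweyl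
  have hpl : p ≤ lam.length := by
    by_contra h
    rw [lam.part_eq_zero (j := p) (by omega)] at hp
    omega
  have hv0 : ∀ j, 1 ≤ j → lam.entry j ≠ 0 := fun j hj => lam.entry_ne_zero hj
  rcases hcases with ⟨hstep, hrest⟩ | ⟨q, hpq, hrest, hmoved⟩
  · left
    obtain ⟨L, hL1, hL2⟩ : ∃ L, lam.length ≤ L ∧ mu.length ≤ L :=
      ⟨max lam.length mu.length, by simp⟩
    have hpL : p ∈ Finset.Icc 1 L := Finset.mem_Icc.2 ⟨hp1, by omega⟩
    have h := coeff_etaSer_step hL1 hL2 hpL hp hpart 0 (by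
      rw [add_zero]
      exact etaSer_sub_map_of_single hpL hp hpart hstep hv0 hrest)
    rw [map_zero, add_zero] at h
    refine ⟨h, fun p' hp' h1 h2 h3 => ?_⟩
    obtain rfl : p' = p := by
      by_contra hne
      have := hpart p' hp' hne
      omega
    have h4 := entry_of_part_eq hp' h1 h3
    rw [(hrest (p' + 1) (by omega) (by omega)).1] at h4
    have h5 := mu.abs_entry_ne hp' (show 1 ≤ p' + 1 by omega) (by omega)
    rw [h4.2] at h5
    unfold StepUp at hstep
    rcases abs_cases (mu.entry p') with h6 | h6 <;> omega
  · have hlink : ∀ T : Finset ℕ, (∀ j ∈ T, 1 ≤ j ∧ j ≠ p ∧ j ≠ q) →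
        linkProd (pairTerm lam.entry) p T = linkProd (pairTerm mu.entry) p T ∧
        linkProd (pairTerm lam.entry) q T = linkProd (pairTerm mu.entry) q T := by
      intro T hT
      constructor <;>
      · refine linkProd_pairTerm_congr fun j hj => ?_
        have h1 := hT j hj
        have h2 := hrest j h1.1 h1.2.1 h1.2.2
        have h3 := hv0 j h1.1
        have h4 := h2.2
        rw [isMoved_iff] at h4
        omega
    have hmem : ∀ L : ℕ, ∀ T ⊆ ((Finset.Icc 1 L).erase p).erase q, ∀ j ∈ T,
        1 ≤ j ∧ j ≠ p ∧ j ≠ q := by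
      intro L T hT j hj
      have h1 := hT hj
      rw [Finset.mem_erase, Finset.mem_erase, Finset.mem_Icc] at h1
      exact ⟨h1.2.2.1, h1.2.1, h1.1⟩
    have hpart' : ∀ j, 1 ≤ j → j ≠ p → j ≠ q → lam.part j = mu.part j :=
      fun j hj hjp _ => hpart j hj hjp
    by_cases hi : 2 ≤ i
    · left
      obtain ⟨n, rfl⟩ : ∃ n, i = n + 1 := ⟨i - 1, by omega⟩
      obtain ⟨L, hL1, hL2, hqL⟩ : ∃ L, lam.length ≤ L ∧ mu.length ≤ L ∧ q ≤ L :=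
        ⟨max (max lam.length mu.length) q, by simp⟩
      have hpL : p ∈ Finset.Icc 1 L := Finset.mem_Icc.2 ⟨hp1, by omega⟩
      have h := coeff_etaSer_step hL1 hL2 hpL hp hpart _
        (etaSer_sub_map_of_pair hp1 hpq hqL hpart' hv0 hrest _ (fun _ => 0) fun T hT => by
          have h1 := hmem L T hT
          exact pairBlock_step (n := n) (by omega) hp1 hpq hp (by omega) (by omega) (by omega)
            (by omega) (fun h => (h1 p h).2.1 rfl) (fun h => (h1 q h).2.2 rfl) (hlink T h1).1
            (hlink T h1).2)
      refine ⟨by simpa using h, fun p' hp' h1 h2 h3 => ?_⟩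
      obtain rfl : p' = p := by
        by_contra hne
        have := hpart p' hp' hne
        omega
      have h4 := entry_of_part_eq hp' h1 h3
      omega
    · right
      have hlt := lam.entry_lt hp1 hpq
      -- the two positions are adjacent
      have hq : q = p + 1 := by
        by_contra hne
        have h1 := lam.entry_lt_succ hp1
        have h2 := lam.entry_lt (i := p + 1) (j := q) (by omega) (by omega)
        have h3 := lam.abs_entry_ne (i := p + 1) (j := q) (by omega) (by omega) (by omega)
        have h4 := hv0 (p + 1) (by omega)
        have h5 : lam.entry (p + 1) ≠ -lam.entry q := fun h => h3 (by rw [h, abs_neg])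
        omega
      subst hq
      have hlq : |lam.entry (p + 1)| = 1 := by
        rcases abs_cases (lam.entry (p + 1)) with h | h <;> omega
      have hmp : |mu.entry p| = 1 := by
        rcases abs_cases (mu.entry p) with h | h <;> omega
      have hlt1 := lam.type_pos_of_abs_entry (by omega) hlq
      have hmt1 := mu.type_pos_of_abs_entry hp1 hmp
      have h1 : lam.part (p + 1) = k := by
        rw [lam.eq_mid_of_abs_entry (by omega) hlq, lam.part_mid hlt1]
      have h2 : mu.part p = k := by
        rw [mu.eq_mid_of_abs_entry hp1 hmp, mu.part_mid hmt1]
      have h3 : mu.part (p + 1) = k := by rw [← hpart (p + 1) (by omega) (by omega), h1]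
      refine ⟨p, ⟨hp1, by omega, h2, h3, hmp, by omega, by omega⟩, by omega, hlt1, hmt1, ?_⟩
      intro L hL1 hL2 hqL
      have hpL : p ∈ Finset.Icc 1 L := Finset.mem_Icc.2 ⟨hp1, by omega⟩
      refine coeff_etaSer_step hL1 hL2 hpL hp hpart _
        (etaSer_sub_map_of_pair hp1 hpq hqL hpart' hv0 hrest _ _ fun T hT => ?_)
      have h4 := hmem L T hT
      rcases hmoved with ⟨rfl, h5⟩ | ⟨hi1, h5⟩
      · exact pairBlock_step_zero hp1 (by omega) h1 h2 h5.2.2.1 h5.2.2.2 h5.1 h5.2.1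
          (fun h => (h4 p h).2.1 rfl) (fun h => (h4 _ h).2.2 rfl) (hlink T h4).1 (hlink T h4).2
      · obtain rfl : i = 1 := by omega
        exact pairBlock_step_one hp1 (by omega) h1 h2 (by omega) (by omega) (by omega)
          (by omega) (fun h => (h4 p h).2.1 rfl) (fun h => (h4 _ h).2.2 rfl) (hlink T h4).1
          (hlink T h4).2

end TypedPartition

/-! ### Multivariate series supported on a set of exponents -/

section Twist

variable {A : Type*} [CommRing A]

/-- All exponents of `f` lie in the additive submonoid `P`. -/
def SupportedIn (P : AddSubmonoid (ℕ →₀ ℕ)) (f : MvPowerSeries ℕ A) : Prop :=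
  ∀ m ∉ P, MvPowerSeries.coeff m f = 0

theorem SupportedIn.mul {P : AddSubmonoid (ℕ →₀ ℕ)} {f g : MvPowerSeries ℕ A}
    (hf : SupportedIn P f) (hg : SupportedIn P g) : SupportedIn P (f * g) := by
  classical
  intro m hm
  rw [MvPowerSeries.coeff_mul]
  refine Finset.sum_eq_zero fun x hx => ?_
  rw [Finset.HasAntidiagonal.mem_antidiagonal] at hx
  by_cases h1 : x.1 ∈ P
  · by_cases h2 : x.2 ∈ P
    · exact absurd (hx ▸ P.add_mem h1 h2) hm
    · rw [hg _ h2, mul_zero]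
  · rw [hf _ h1, zero_mul]

theorem supportedIn_one (P : AddSubmonoid (ℕ →₀ ℕ)) :
    SupportedIn P (1 : MvPowerSeries ℕ A) := by
  classical
  intro m hm
  rw [MvPowerSeries.coeff_one, if_neg]
  rintro rfl
  exact hm P.zero_mem

theorem SupportedIn.prod {P : AddSubmonoid (ℕ →₀ ℕ)} {ι : Type*} {s : Finset ι}
    {f : ι → MvPowerSeries ℕ A} (h : ∀ i ∈ s, SupportedIn P (f i)) :
    SupportedIn P (∏ i ∈ s, f i) := by
  classical
  induction s using Finset.induction_on with
  | empty => exact supportedIn_one P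
  | insert a s ha ih =>
    rw [Finset.prod_insert ha]
    exact (h a (Finset.mem_insert_self _ _)).mul
      (ih fun i hi => h i (Finset.mem_insert_of_mem hi))

theorem supportedIn_evMono {P : AddSubmonoid (ℕ →₀ ℕ)} {e : ℕ →₀ ℕ} (he0 : e ≠ 0) (he : e ∈ P)
    (f : PowerSeries A) : SupportedIn P (evMono e f) := by
  intro m hm
  refine coeff_evMono_of_forall_ne he0 f ?_
  rintro n rfl
  exact hm (P.nsmul_mem he n)

theorem supportedIn_monomial {P : AddSubmonoid (ℕ →₀ ℕ)} {e : ℕ →₀ ℕ} (he : e ∈ P) (a : A) :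
    SupportedIn P (MvPowerSeries.monomial e a) := by
  classical
  intro m hm
  rw [MvPowerSeries.coeff_monomial_ne]
  rintro rfl
  exact hm he

theorem SupportedIn.map {P : AddSubmonoid (ℕ →₀ ℕ)} {B : Type*} [CommRing B] (φ : A →+* B)
    {f : MvPowerSeries ℕ A} (hf : SupportedIn P f) : SupportedIn P (MvPowerSeries.map φ f) := by
  intro m hm
  rw [MvPowerSeries.coeff_map, hf m hm, map_zero]

/-- Modulo the variable `y_a`, a series in a monomial divisible by `y_a` is its constant term. -/
theorem eqUpTo_one_of_apply_eq_zero {τ e : ℕ →₀ ℕ} {a : ℕ} (hτ : τ a = 0) (hea : e a ≠ 0)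
    {f : PowerSeries A} (hf : PowerSeries.coeff 0 f = 1) : EqUpTo τ (evMono e f) 1 := by
  classical
  have he : e ≠ 0 := by
    rintro rfl
    exact hea rfl
  intro m hm
  have hm0 : m a = 0 := by
    have := hm a
    omega
  by_cases h : m = 0
  · subst h
    have := coeff_evMono_smul he f 0
    rw [zero_smul] at this
    rw [this, hf]
    simp
  · rw [coeff_evMono_of_forall_ne he, MvPowerSeries.coeff_one, if_neg h]
    rintro n rfl
    rw [Finsupp.smul_apply, smul_eq_mul, Nat.mul_eq_zero] at hm0
    rcases hm0 with hm0 | hm0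
    · rw [hm0, zero_smul] at h
      exact h rfl
    · exact hea hm0

/-! ### Substitutions which make a variable follow its neighbours -/

/-- For a series not involving `y_{p+1}`, the result of the substitution
`y_p ↦ y_p y_{p+1}^α`, `y_{p+2} ↦ y_{p+2} y_{p+1}^β`. -/
noncomputable def twist (p α β : ℕ) (f : MvPowerSeries ℕ A) : MvPowerSeries ℕ A := fun m =>
  if m (p + 1) = α * m p + β * m (p + 2) then MvPowerSeries.coeff (m.erase (p + 1)) f else 0

theorem coeff_twist (p α β : ℕ) (f : MvPowerSeries ℕ A) (m : ℕ →₀ ℕ) :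
    MvPowerSeries.coeff m (twist p α β f) = if m (p + 1) = α * m p + β * m (p + 2)
      then MvPowerSeries.coeff (m.erase (p + 1)) f else 0 := rfl

theorem erase_add_single_of_apply_eq_zero {m : ℕ →₀ ℕ} {q n : ℕ} (h : m q = 0) :
    (m + Finsupp.single q n).erase q = m := by
  ext a
  by_cases ha : a = q
  · subst ha
    rw [Finsupp.erase_same, h]
  · rw [Finsupp.erase_ne ha, Finsupp.add_apply, Finsupp.single_eq_of_ne ha, add_zero]

theorem erase_eq_self_of_apply_eq_zero {m : ℕ →₀ ℕ} {q : ℕ} (h : m q = 0) : m.erase q = m := by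
  have := erase_add_single_of_apply_eq_zero (n := 0) h
  rwa [Finsupp.single_zero, add_zero] at this

theorem add_single_add_eq_of_erase_eq {m a b : ℕ →₀ ℕ} {q i j : ℕ} (h : a + b = m.erase q)
    (hij : i + j = m q) : a + Finsupp.single q i + (b + Finsupp.single q j) = m := by
  ext x
  have hx := DFunLike.congr_fun h x
  simp only [Finsupp.add_apply] at hx ⊢
  by_cases hxq : x = q
  · subst hxq
    rw [Finsupp.erase_same] at hx
    rw [Finsupp.single_eq_same, Finsupp.single_eq_same]
    omega
  · rw [Finsupp.erase_ne hxq] at hx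
    rw [Finsupp.single_eq_of_ne hxq, Finsupp.single_eq_of_ne hxq]
    omega

theorem apply_eq_zero_of_add_eq_erase {m a b : ℕ →₀ ℕ} {q : ℕ} (h : a + b = m.erase q) :
    a q = 0 ∧ b q = 0 := by
  have hx := DFunLike.congr_fun h q
  rw [Finsupp.add_apply, Finsupp.erase_same] at hx
  omega

/-- The exponent of `y_{p+1}` in a twisted series is a linear function of the other exponents, so
twisting is multiplicative on series not involving `y_{p+1}`. As `twist` discards the terms which do
involve it, the formula holds without this assumption. -/
theorem twist_mul (p α β : ℕ) (f g : MvPowerSeries ℕ A) :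
    twist p α β (f * g) = twist p α β f * twist p α β g := by
  classical
  ext m
  rw [coeff_twist, MvPowerSeries.coeff_mul]
  split_ifs with hm
  · rw [MvPowerSeries.coeff_mul]
    obtain ⟨w, hw⟩ : ∃ w : (ℕ →₀ ℕ) → ℕ, w = fun m => α * m p + β * m (p + 2) := ⟨_, rfl⟩
    have hwa : ∀ m, α * m p + β * m (p + 2) = w m := fun m => by rw [hw]
    have hw1 : ∀ a n, w (a + Finsupp.single (p + 1) n) = w a := by
      intro a n
      simp [hw]
    have hw2 : ∀ a, w (a.erase (p + 1)) = w a := by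
      intro a
      simp [hw]
    have hw3 : ∀ a b, w (a + b) = w a + w b := by
      intro a b
      simp only [hw, Finsupp.add_apply]
      ring
    rw [hwa] at hm
    symm
    rw [← Finset.sum_filter_of_ne
      (p := fun x : (ℕ →₀ ℕ) × (ℕ →₀ ℕ) => x.1 (p + 1) = w x.1 ∧ x.2 (p + 1) = w x.2)]
    · refine Finset.sum_bij' (fun x _ => (x.1.erase (p + 1), x.2.erase (p + 1)))
        (fun x _ => (x.1 + Finsupp.single (p + 1) (w x.1), x.2 + Finsupp.single (p + 1) (w x.2)))
        ?_ ?_ ?_ ?_ ?_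
      · intro x hx
        rw [Finset.mem_filter, Finset.HasAntidiagonal.mem_antidiagonal] at hx
        rw [Finset.HasAntidiagonal.mem_antidiagonal, ← hx.1, Finsupp.erase_add]
      · intro x hx
        rw [Finset.HasAntidiagonal.mem_antidiagonal] at hx
        have h0 := apply_eq_zero_of_add_eq_erase hx
        rw [Finset.mem_filter, Finset.HasAntidiagonal.mem_antidiagonal]
        refine ⟨add_single_add_eq_of_erase_eq hx ?_, ?_, ?_⟩
        · rw [hm, ← hw2 m, ← hx, hw3]
        · rw [hw1, Finsupp.add_apply, h0.1, Finsupp.single_eq_same, zero_add]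
        · rw [hw1, Finsupp.add_apply, h0.2, Finsupp.single_eq_same, zero_add]
      · intro x hx
        rw [Finset.mem_filter] at hx
        simp only [hw2, ← hx.2.1, ← hx.2.2, Finsupp.erase_add_single]
      · intro x hx
        rw [Finset.HasAntidiagonal.mem_antidiagonal] at hx
        have h0 := apply_eq_zero_of_add_eq_erase hx
        simp only [erase_add_single_of_apply_eq_zero h0.1,
          erase_add_single_of_apply_eq_zero h0.2]
      · intro x hx
        rw [Finset.mem_filter] at hx
        rw [coeff_twist, coeff_twist, hwa, hwa, if_pos hx.2.1, if_pos hx.2.2]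
    · intro x _ hne
      rw [coeff_twist, coeff_twist, hwa, hwa] at hne
      constructor
      · by_contra h
        rw [if_neg h, zero_mul] at hne
        exact hne rfl
      · by_contra h
        rw [if_neg h, mul_zero] at hne
        exact hne rfl
  · rw [MvPowerSeries.coeff_mul]
    symm
    refine Finset.sum_eq_zero fun x hx => ?_
    rw [Finset.HasAntidiagonal.mem_antidiagonal] at hx
    rw [coeff_twist, coeff_twist]
    split_ifs with h1 h2
    · exfalso
      apply hm
      rw [← hx, Finsupp.add_apply, Finsupp.add_apply, Finsupp.add_apply, h1, h2]
      ring
    · rw [mul_zero]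
    · rw [zero_mul]
    · rw [zero_mul]

theorem twist_one (p α β : ℕ) : twist p α β (1 : MvPowerSeries ℕ A) = 1 := by
  classical
  ext m
  rw [coeff_twist, MvPowerSeries.coeff_one, MvPowerSeries.coeff_one]
  by_cases h0 : m = 0
  · subst h0
    simp
  · rw [if_neg h0]
    split_ifs with h1 h2
    · exfalso
      apply h0
      have hz : ∀ a, a ≠ p + 1 → m a = 0 := by
        intro a ha
        have := DFunLike.congr_fun h2 a
        rwa [Finsupp.erase_ne ha] at this
      ext a
      by_cases ha : a = p + 1
      · rw [ha, h1, hz p (by omega), hz (p + 2) (by omega)]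
        simp
      · exact hz a ha
    · rfl
    · rfl

theorem twist_prod (p α β : ℕ) {ι : Type*} (s : Finset ι) (f : ι → MvPowerSeries ℕ A) :
    twist p α β (∏ i ∈ s, f i) = ∏ i ∈ s, twist p α β (f i) := by
  classical
  induction s using Finset.induction_on with
  | empty => exact twist_one p α β
  | insert a s ha ih => rw [Finset.prod_insert ha, Finset.prod_insert ha, twist_mul, ih]

theorem twist_evMono (p α β : ℕ) {e : ℕ →₀ ℕ} (he : e ≠ 0) (hq : e (p + 1) = 0)
    (f : PowerSeries A) : twist p α β (evMono e f)
      = evMono (e + Finsupp.single (p + 1) (α * e p + β * e (p + 2))) f := by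
  classical
  obtain ⟨e', he'⟩ : ∃ e', e' = e + Finsupp.single (p + 1) (α * e p + β * e (p + 2)) := ⟨_, rfl⟩
  have hp' : e' p = e p := by simp [he']
  have hp2' : e' (p + 2) = e (p + 2) := by simp [he']
  have hq' : e' (p + 1) = α * e p + β * e (p + 2) := by simp [he', hq]
  have her : ∀ n : ℕ, (n • e').erase (p + 1) = n • e := by
    intro n
    ext a
    by_cases ha : a = p + 1
    · subst ha
      simp [hq]
    · rw [Finsupp.erase_ne ha]
      simp [he', Finsupp.single_eq_of_ne ha]
  have he0 : e' ≠ 0 := by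
    intro h
    have h1 := her 1
    rw [h] at h1
    simp only [smul_zero, Finsupp.erase_zero, one_smul] at h1
    exact he h1.symm
  rw [← he']
  ext m
  rw [coeff_twist]
  by_cases h : ∃ n : ℕ, m = n • e'
  · obtain ⟨n, rfl⟩ := h
    rw [if_pos, her, coeff_evMono_smul he, coeff_evMono_smul he0]
    simp only [Finsupp.smul_apply, smul_eq_mul, hp', hp2', hq']
    ring
  · push Not at h
    rw [coeff_evMono_of_forall_ne he0 f h]
    split_ifs with h1
    · refine coeff_evMono_of_forall_ne he f ?_
      intro n hn
      apply h n
      have hz : ∀ a, a ≠ p + 1 → m a = n * e a := by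
        intro a ha
        have := DFunLike.congr_fun hn a
        rwa [Finsupp.erase_ne ha] at this
      ext a
      rw [Finsupp.smul_apply, smul_eq_mul]
      by_cases ha : a = p + 1
      · rw [ha, h1, hz p (by omega), hz (p + 2) (by omega), hq']
        ring
      · rw [hz a ha, he', Finsupp.add_apply, Finsupp.single_eq_of_ne ha, add_zero]
    · rfl

/-! ### Changing the signs of two variables -/

/-- The substitution `y_p ↦ -y_p`, `y_{p+2} ↦ -y_{p+2}`. -/
noncomputable def signChange (p : ℕ) (f : MvPowerSeries ℕ A) : MvPowerSeries ℕ A := fun m =>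
  (-1) ^ (m p + m (p + 2)) * MvPowerSeries.coeff m f

theorem coeff_signChange (p : ℕ) (f : MvPowerSeries ℕ A) (m : ℕ →₀ ℕ) :
    MvPowerSeries.coeff m (signChange p f)
      = (-1) ^ (m p + m (p + 2)) * MvPowerSeries.coeff m f := rfl

theorem signChange_mul (p : ℕ) (f g : MvPowerSeries ℕ A) :
    signChange p (f * g) = signChange p f * signChange p g := by
  classical
  ext m
  rw [coeff_signChange, MvPowerSeries.coeff_mul, MvPowerSeries.coeff_mul, Finset.mul_sum]
  refine Finset.sum_congr rfl fun x hx => ?_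
  rw [Finset.HasAntidiagonal.mem_antidiagonal] at hx
  rw [coeff_signChange, coeff_signChange, ← hx, Finsupp.add_apply, Finsupp.add_apply]
  ring

theorem signChange_one (p : ℕ) : signChange p (1 : MvPowerSeries ℕ A) = 1 := by
  classical
  ext m
  rw [coeff_signChange, MvPowerSeries.coeff_one]
  split_ifs with h
  · subst h
    simp
  · rw [mul_zero]

theorem signChange_prod (p : ℕ) {ι : Type*} (s : Finset ι) (f : ι → MvPowerSeries ℕ A) :
    signChange p (∏ i ∈ s, f i) = ∏ i ∈ s, signChange p (f i) := by
  classical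
  induction s using Finset.induction_on with
  | empty => exact signChange_one p
  | insert a s ha ih => rw [Finset.prod_insert ha, Finset.prod_insert ha, signChange_mul, ih]

theorem signChange_evMono (p : ℕ) {e : ℕ →₀ ℕ} (he : e ≠ 0) (h1 : e p + e (p + 2) = 1)
    (f : PowerSeries A) :
    signChange p (evMono e f) = evMono e (PowerSeries.rescale (-1) f) := by
  ext m
  rw [coeff_signChange]
  by_cases h : ∃ n : ℕ, m = n • e
  · obtain ⟨n, rfl⟩ := h
    rw [coeff_evMono_smul he, coeff_evMono_smul he, PowerSeries.coeff_rescale]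
    congr 2
    rw [Finsupp.smul_apply, Finsupp.smul_apply, smul_eq_mul, smul_eq_mul, ← mul_add, h1, mul_one]
  · push Not at h
    rw [coeff_evMono_of_forall_ne he f h, coeff_evMono_of_forall_ne he _ h, mul_zero]

end Twist

/-! ### The symmetrized product -/

section Symmetrize

variable {A : Type*} [CommRing A]

/-- The series `(1 - X) / (1 + X)`. -/
noncomputable def cayleySer (A : Type*) [CommRing A] : PowerSeries A := (1 - PowerSeries.X) * geo 1

/-- The series `(1 - X) / (1 + X)` is `1 + 2 ∑ (-1)^n X^n`, over `n > 0`; continued by zero to negative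
exponents, its coefficients at `z` and `-z` add up to `2 (-1)^z`. -/
theorem zcoeff_cayleySer_add_neg (z : ℤ) :
    zcoeff (cayleySer A) z + zcoeff (cayleySer A) (-z) = 2 * (-1) ^ z.natAbs := by
  have hc : ∀ n : ℕ, PowerSeries.coeff (n + 1) (cayleySer A) = 2 * (-1) ^ (n + 1) := by
    intro n
    rw [cayleySer, sub_mul, one_mul, map_sub, geo, PowerSeries.coeff_succ_X_mul,
      PowerSeries.coeff_mk, PowerSeries.coeff_mk]
    ring
  have hc0 : PowerSeries.coeff 0 (cayleySer A) = 1 := by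
    simp [cayleySer, geo, sub_mul]
  obtain ⟨n, rfl | rfl⟩ := Int.eq_nat_or_neg z
  · cases n with
    | zero =>
      simp [zcoeff, hc0]
      norm_num
    | succ n =>
      rw [zcoeff_natCast, hc, zcoeff, if_neg (by omega), Int.natAbs_natCast, add_zero]
  · cases n with
    | zero =>
      simp [zcoeff, hc0]
      norm_num
    | succ n =>
      rw [neg_neg, zcoeff_natCast, hc, zcoeff, if_neg (by omega), Int.natAbs_neg,
        Int.natAbs_natCast, zero_add]

/-- In a product of a series in `y_{p+1}` with a twisted series, the exponents other than that of
`y_{p+1}` determine the term of the second factor, hence also that of the first. -/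
theorem coeff_evMono_single_mul_twist (p : ℕ) (f : PowerSeries A) (g : MvPowerSeries ℕ A)
    (m : ℕ →₀ ℕ) :
    MvPowerSeries.coeff m (evMono (Finsupp.single (p + 1) 1) f * twist p 1 1 g)
      = zcoeff f (m (p + 1) - m p - m (p + 2)) * MvPowerSeries.coeff (m.erase (p + 1)) g := by
  classical
  have he : Finsupp.single (p + 1) 1 ≠ 0 := by simp
  rw [MvPowerSeries.coeff_mul]
  -- a contributing exponent of the second factor determines the pair
  have key : ∀ x ∈ Finset.HasAntidiagonal.antidiagonal m,
      MvPowerSeries.coeff x.1 (evMono (Finsupp.single (p + 1) 1) f) *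
        MvPowerSeries.coeff x.2 (twist p 1 1 g) ≠ 0 →
      ∃ n : ℕ, x.1 = n • Finsupp.single (p + 1) 1 ∧
        m (p + 1) = n + (m p + m (p + 2)) := by
    intro x hx hne
    rw [Finset.HasAntidiagonal.mem_antidiagonal] at hx
    have h1 : ∃ n : ℕ, x.1 = n • Finsupp.single (p + 1) 1 := by
      by_contra hcon
      push Not at hcon
      rw [coeff_evMono_of_forall_ne he f hcon, zero_mul] at hne
      exact hne rfl
    obtain ⟨n, hn⟩ := h1
    refine ⟨n, hn, ?_⟩
    rw [coeff_twist] at hne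
    split_ifs at hne with h2
    · rw [← hx]
      simp only [Finsupp.add_apply, h2, hn]
      simp
    · rw [mul_zero] at hne
      exact absurd rfl hne
  by_cases hz : m p + m (p + 2) ≤ m (p + 1)
  · obtain ⟨n, hn⟩ := Nat.exists_eq_add_of_le' hz
    have hsplit : n • Finsupp.single (p + 1) 1 +
        (m.erase (p + 1) + Finsupp.single (p + 1) (m p + m (p + 2))) = m := by
      have := add_single_add_eq_of_erase_eq (m := m) (a := 0) (b := m.erase (p + 1))
        (q := p + 1) (i := n) (j := m p + m (p + 2)) (zero_add _) hn.symm
      rw [zero_add] at this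
      rw [Finsupp.smul_single, smul_eq_mul, mul_one]
      exact this
    rw [Finset.sum_eq_single (n • Finsupp.single (p + 1) 1,
      m.erase (p + 1) + Finsupp.single (p + 1) (m p + m (p + 2)))]
    · rw [coeff_evMono_smul he, coeff_twist, if_pos (by simp),
        erase_add_single_of_apply_eq_zero (by simp),
        show ((m (p + 1) : ℤ) - m p - m (p + 2)) = (n : ℕ) by omega, zcoeff_natCast]
    · intro x hx hne
      by_contra hcon
      obtain ⟨n', h1, h2⟩ := key x hx hcon
      have : n' = n := by omega
      subst this
      rw [Finset.HasAntidiagonal.mem_antidiagonal] at hx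
      apply hne
      refine Prod.ext h1 ?_
      have h3 : n' • Finsupp.single (p + 1) 1 + x.2 = m := by rw [← h1, hx]
      exact add_left_cancel (h3.trans hsplit.symm)
    · intro h
      rw [Finset.HasAntidiagonal.mem_antidiagonal] at h
      exact absurd hsplit h
  · rw [zcoeff, if_neg (by omega), zero_mul]
    refine Finset.sum_eq_zero fun x hx => ?_
    by_contra hcon
    obtain ⟨n', -, h2⟩ := key x hx hcon
    omega

/-- A coefficient of `(1 - y_{p+1}) / (1 + y_{p+1})` times `g` times its twist is, by symmetry, a
coefficient of `g` times its sign change. -/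
theorem coeff_cayley_mul_twist [IsDomain A] [CharZero A] (p k : ℕ) {g : MvPowerSeries ℕ A}
    (hg : ∀ m : ℕ →₀ ℕ, m (p + 1) ≠ 0 → MvPowerSeries.coeff m g = 0) {m : ℕ →₀ ℕ}
    (h1 : m p = 2 * k + m (p + 2)) (h2 : m (p + 1) = k + m (p + 2)) :
    MvPowerSeries.coeff m (evMono (Finsupp.single (p + 1) 1) (cayleySer A) * (g * twist p 1 1 g))
      = (-1) ^ m (p + 1) * MvPowerSeries.coeff (m.erase (p + 1)) (g * signChange p g) := by
  classical
  obtain ⟨B, hB⟩ : ∃ B, B = m.erase (p + 1) := ⟨_, rfl⟩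
  have hBp : B p = m p := by rw [hB, Finsupp.erase_ne (by omega)]
  have hBp2 : B (p + 2) = m (p + 2) := by rw [hB, Finsupp.erase_ne (by omega)]
  obtain ⟨t, ht⟩ : ∃ t : (ℕ →₀ ℕ) × (ℕ →₀ ℕ) → A, t = fun x => MvPowerSeries.coeff x.1 g *
      MvPowerSeries.coeff x.2 g * zcoeff (cayleySer A) (m (p + 1) - x.2 p - x.2 (p + 2)) :=
    ⟨_, rfl⟩
  have e1 : MvPowerSeries.coeff m
      (evMono (Finsupp.single (p + 1) 1) (cayleySer A) * (g * twist p 1 1 g))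
      = ∑ x ∈ Finset.HasAntidiagonal.antidiagonal B, t x := by
    rw [mul_left_comm, MvPowerSeries.coeff_mul]
    simp only [coeff_evMono_single_mul_twist]
    rw [← Finset.sum_filter_of_ne (p := fun x : (ℕ →₀ ℕ) × (ℕ →₀ ℕ) => x.1 (p + 1) = 0)]
    · refine Finset.sum_bij' (fun x _ => (x.1, x.2.erase (p + 1)))
        (fun x _ => (x.1, x.2 + Finsupp.single (p + 1) (m (p + 1)))) ?_ ?_ ?_ ?_ ?_
      · intro x hx
        rw [Finset.mem_filter, Finset.HasAntidiagonal.mem_antidiagonal] at hx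
        rw [Finset.HasAntidiagonal.mem_antidiagonal, hB, ← hx.1, Finsupp.erase_add,
          erase_eq_self_of_apply_eq_zero hx.2]
      · intro x hx
        rw [Finset.HasAntidiagonal.mem_antidiagonal, hB] at hx
        have h0 := apply_eq_zero_of_add_eq_erase hx
        rw [Finset.mem_filter, Finset.HasAntidiagonal.mem_antidiagonal]
        refine ⟨?_, h0.1⟩
        have := add_single_add_eq_of_erase_eq (i := 0) (j := m (p + 1)) hx (zero_add _)
        rwa [Finsupp.single_zero, add_zero] at this
      · intro x hx
        rw [Finset.mem_filter, Finset.HasAntidiagonal.mem_antidiagonal] at hx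
        have h3 : x.2 (p + 1) = m (p + 1) := by
          rw [← hx.1, Finsupp.add_apply, hx.2, zero_add]
        simp only [← h3, Finsupp.erase_add_single]
      · intro x hx
        rw [Finset.HasAntidiagonal.mem_antidiagonal, hB] at hx
        have h0 := apply_eq_zero_of_add_eq_erase hx
        simp only [erase_add_single_of_apply_eq_zero h0.2]
      · intro x hx
        rw [Finset.mem_filter, Finset.HasAntidiagonal.mem_antidiagonal] at hx
        have h3 : x.2 (p + 1) = m (p + 1) := by
          rw [← hx.1, Finsupp.add_apply, hx.2, zero_add]
        simp only [ht]
        rw [Finsupp.erase_ne (show p ≠ p + 1 by omega),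
          Finsupp.erase_ne (show p + 2 ≠ p + 1 by omega), h3]
        ring
    · intro x _ hne
      by_contra h0
      rw [hg _ h0, zero_mul] at hne
      exact hne rfl
  have e2 : ∑ x ∈ Finset.HasAntidiagonal.antidiagonal B, t x
      = ∑ x ∈ Finset.HasAntidiagonal.antidiagonal B, t x.swap := by
    refine Finset.sum_equiv (Equiv.prodComm _ _) (fun x => ?_) fun x _ => ?_
    · rw [Finset.HasAntidiagonal.mem_antidiagonal, Finset.HasAntidiagonal.mem_antidiagonal,
        Equiv.prodComm_apply, Prod.fst_swap, Prod.snd_swap, add_comm]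
    · rw [Equiv.prodComm_apply, Prod.swap_swap]
  have e3 : ∀ x ∈ Finset.HasAntidiagonal.antidiagonal B, t x + t x.swap
      = 2 * ((-1) ^ m (p + 1) *
        (MvPowerSeries.coeff x.1 g * MvPowerSeries.coeff x.2 (signChange p g))) := by
    intro x hx
    rw [Finset.HasAntidiagonal.mem_antidiagonal] at hx
    have h3 : x.1 p + x.2 p = m p := by rw [← hBp, ← hx, Finsupp.add_apply]
    have h4 : x.1 (p + 2) + x.2 (p + 2) = m (p + 2) := by rw [← hBp2, ← hx, Finsupp.add_apply]
    have h5 := zcoeff_cayleySer_add_neg (A := A) (m (p + 1) - x.2 p - x.2 (p + 2))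
    rw [show -((m (p + 1) : ℤ) - x.2 p - x.2 (p + 2)) = m (p + 1) - x.1 p - x.1 (p + 2) by
      omega] at h5
    have h6 : ((-1 : A)) ^ ((m (p + 1) : ℤ) - x.2 p - x.2 (p + 2)).natAbs
        = (-1) ^ m (p + 1) * (-1) ^ (x.2 p + x.2 (p + 2)) := by
      rw [← pow_add]
      refine neg_one_pow_congr ?_
      rw [Int.natAbs_even]
      have : ((m (p + 1) : ℤ) - x.2 p - x.2 (p + 2))
          = ((m (p + 1) + (x.2 p + x.2 (p + 2)) : ℕ) : ℤ) - 2 * ((x.2 p + x.2 (p + 2) : ℕ) : ℤ) := by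
        push_cast
        ring
      rw [this, Int.even_sub, Int.even_coe_nat]
      simp
    rw [h6] at h5
    simp only [ht, coeff_signChange, Prod.fst_swap, Prod.snd_swap]
    linear_combination MvPowerSeries.coeff x.1 g * MvPowerSeries.coeff x.2 g * h5
  have e4 : (2 : A) * ∑ x ∈ Finset.HasAntidiagonal.antidiagonal B, t x
      = 2 * ((-1) ^ m (p + 1) * MvPowerSeries.coeff B (g * signChange p g)) := by
    have e5 := Finset.sum_congr rfl e3
    rw [Finset.sum_add_distrib, ← e2, ← Finset.mul_sum, ← Finset.mul_sum,
      ← MvPowerSeries.coeff_mul] at e5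
    rw [two_mul, e5]
  rw [e1, mul_left_cancel₀ two_ne_zero e4, hB]

end Symmetrize

/-! ### The coefficients of the excess -/

theorem wt_add_single_right {i p : ℕ} (h : i ≤ p) :
    wt i p + Finsupp.single (p + 1) 1 = wt i (p + 1) := by
  ext a
  rw [Finsupp.add_apply, wt_apply, wt_apply, Finsupp.single_apply]
  split_ifs <;> omega

theorem wt_add_single_left {p j : ℕ} (h : p < j) :
    wt (p + 1) j + Finsupp.single (p + 1) 1 = wt p j := by
  ext a
  rw [Finsupp.add_apply, wt_apply, wt_apply, Finsupp.single_apply]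
  split_ifs <;> omega

theorem wt_self_succ (p : ℕ) : wt p (p + 1) = Finsupp.single (p + 1) 1 := by
  ext a
  rw [wt_apply, Finsupp.single_apply]
  split_ifs <;> omega

section Generic

variable {A : Type*} [CommRing A]

/-- The product of the pair factors which join the position `p` to those in `T`, over an arbitrary
ring. -/
noncomputable def linkSer (A : Type*) [CommRing A] (v : ℕ → ℤ) (p : ℕ) (T : Finset ℕ) :
    MvPowerSeries ℕ A :=
  linkProd (fun i j => evMono (wt i j) (raiseSer A (v i + v j))) p T

/-- The series `f(u_p) ∏_j F_j`, in which the variable `y_{p+1}` does not occur; the factor `F_j` is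
`(1 - z) / (1 + z)` at `z = u_p / u_j` for `j < p`, and `1 - u_j / u_{p+1}` for `j > p + 1`. -/
noncomputable def centerSer (f : PowerSeries A) (p : ℕ) (T : Finset ℕ) : MvPowerSeries ℕ A :=
  evMono (wt 0 p) f * ∏ j ∈ T,
    evMono (if j < p then wt j p else wt (p + 1) j) (if j < p then cayleySer A else 1 - PowerSeries.X)

variable {v : ℕ → ℤ} {p : ℕ} {T : Finset ℕ}

/-- The pair factors at the position `q`, if its entry has a negative sum with the preceding entries
and a nonnegative one with the following entries. -/
theorem linkSer_eq {q : ℕ} (hqT : q ∉ T) (hneg : ∀ j ∈ T, j < q → v q + v j < 0)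
    (hpos : ∀ j ∈ T, q < j → 0 ≤ v q + v j) :
    linkSer A v q T = ∏ j ∈ T, evMono (if j < q then wt j q else wt q j)
      (if j < q then cayleySer A else 1 - PowerSeries.X) := by
  refine Finset.prod_congr rfl fun j hj => ?_
  have hne : j ≠ q := fun h => hqT (h ▸ hj)
  change evMono (wt (min q j) (max q j)) (raiseSer A (v (min q j) + v (max q j))) = _
  by_cases h : j < q
  · rw [if_pos h, if_pos h, min_eq_right h.le, max_eq_left h.le, raiseSer, if_pos]
    · rfl
    · have := hneg j hj h
      omega
  · rw [if_neg h, if_neg h, min_eq_left (by omega), max_eq_right (by omega), raiseSer, if_neg]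
    have := hpos j hj (by omega)
    omega

theorem twist_centerSer (α β : ℕ) (hp1 : 1 ≤ p) (hpT : p ∉ T) (hqT : p + 1 ∉ T)
    (f : PowerSeries A) : twist p α β (centerSer f p T)
      = evMono (wt 0 p + Finsupp.single (p + 1) α) f * ∏ j ∈ T,
        evMono (if j < p then wt j p + Finsupp.single (p + 1) α
          else wt (p + 1) j + Finsupp.single (p + 1) β)
          (if j < p then cayleySer A else 1 - PowerSeries.X) := by
  rw [centerSer, twist_mul, twist_prod, twist_evMono _ _ _ (wt_ne_zero (by omega))]
  · congr 1
    · rw [wt_apply, wt_apply, if_pos (by omega), if_neg (by omega), mul_one, mul_zero, add_zero]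
    · refine Finset.prod_congr rfl fun j hj => ?_
      have h1 : j ≠ p := fun h => hpT (h ▸ hj)
      have h2 : j ≠ p + 1 := fun h => hqT (h ▸ hj)
      by_cases h : j < p
      · simp only [if_pos h]
        rw [twist_evMono _ _ _ (wt_ne_zero h), wt_apply, wt_apply, if_pos (by omega),
          if_neg (by omega), mul_one, mul_zero, add_zero]
        rw [wt_apply, if_neg (by omega)]
      · simp only [if_neg h]
        rw [twist_evMono _ _ _ (wt_ne_zero (by omega)), wt_apply, wt_apply, if_neg (by omega),
          if_pos (by omega), mul_one, mul_zero, zero_add]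
        rw [wt_apply, if_neg (by omega)]
  · rw [wt_apply, if_neg (by omega)]

/-- Substituting `y_{p+2} y_{p+1}` for `y_{p+2}` turns `u_j / u_{p+1}` into `u_j / u_p`: the result is the
series at `u_p` with the pair factors of the position `p`. -/
theorem twist_zero_one_centerSer (hp1 : 1 ≤ p) (hpT : p ∉ T) (hqT : p + 1 ∉ T)
    (hneg : ∀ j ∈ T, j < p → v p + v j < 0) (hpos : ∀ j ∈ T, p < j → 0 ≤ v p + v j)
    (f : PowerSeries A) :
    twist p 0 1 (centerSer f p T) = evMono (wt 0 p) f * linkSer A v p T := by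
  rw [twist_centerSer 0 1 hp1 hpT hqT, linkSer_eq hpT hneg hpos, Finsupp.single_zero, add_zero]
  congr 1
  refine Finset.prod_congr rfl fun j hj => ?_
  have h1 : j ≠ p := fun h => hpT (h ▸ hj)
  by_cases h : j < p
  · simp only [if_pos h, add_zero]
  · simp only [if_neg h]
    rw [wt_add_single_left (by omega)]

/-- Substituting `y_p y_{p+1}` for `y_p` turns `u_p` into `u_{p+1}`: the result is the series at `u_{p+1}`
with the pair factors of the position `p + 1`. -/
theorem twist_one_zero_centerSer (hp1 : 1 ≤ p) (hpT : p ∉ T) (hqT : p + 1 ∉ T)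
    (hneg : ∀ j ∈ T, j < p + 1 → v (p + 1) + v j < 0)
    (hpos : ∀ j ∈ T, p + 1 < j → 0 ≤ v (p + 1) + v j) (f : PowerSeries A) :
    twist p 1 0 (centerSer f p T) = evMono (wt 0 (p + 1)) f * linkSer A v (p + 1) T := by
  rw [twist_centerSer 1 0 hp1 hpT hqT, linkSer_eq hqT hneg hpos, Finsupp.single_zero,
    wt_add_single_right (Nat.zero_le _)]
  congr 1
  refine Finset.prod_congr rfl fun j hj => ?_
  have h1 : j ≠ p := fun h => hpT (h ▸ hj)
  by_cases h : j < p
  · simp only [if_pos h, if_pos (show j < p + 1 by omega)]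
    rw [wt_add_single_right h.le]
  · simp only [if_neg h, if_neg (show ¬ j < p + 1 by omega), add_zero]

/-- The part of the generating series at the positions `p` and `p + 1`, without the pair factor which
joins them, is a central series times its twist: the factor at `u_{p+1}` and the pair factors of the
preceding positions with `p + 1` are twisted, and so are those of the following positions with `p`. -/
theorem centerSer_mul_twist (hp1 : 1 ≤ p) (hpT : p ∉ T) (hqT : p + 1 ∉ T)
    (hneg : ∀ j ∈ T, j < p → v p + v j < 0 ∧ v (p + 1) + v j < 0)
    (hpos : ∀ j ∈ T, p < j → 0 ≤ v p + v j ∧ 0 ≤ v (p + 1) + v j) (f : PowerSeries A) :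
    centerSer f p T * twist p 1 1 (centerSer f p T)
      = evMono (wt 0 p) f * evMono (wt 0 (p + 1)) f * linkSer A v p T * linkSer A v (p + 1) T := by
  have hpos' : ∀ j ∈ T, p < j → 0 ≤ v p + v j := fun j hj h => (hpos j hj h).1
  have hneg' : ∀ j ∈ T, j < p + 1 → v (p + 1) + v j < 0 := fun j hj h =>
    (hneg j hj (by
      have h1 : j ≠ p := fun h => hpT (h ▸ hj)
      omega)).2
  rw [twist_centerSer 1 1 hp1 hpT hqT, centerSer,
    linkSer_eq hpT (fun j hj h => (hneg j hj h).1) hpos',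
    linkSer_eq hqT hneg' (fun j hj h => (hpos j hj (by omega)).2),
    wt_add_single_right (Nat.zero_le _)]
  have e : ∀ a b c d : MvPowerSeries ℕ A, a * b * (c * d) = a * c * (b * d) := fun a b c d => by
    ring
  rw [e, mul_assoc (evMono (wt 0 p) f * evMono (wt 0 (p + 1)) f), ← Finset.prod_mul_distrib,
    ← Finset.prod_mul_distrib]
  congr 1
  refine Finset.prod_congr rfl fun j hj => ?_
  have h1 : j ≠ p := fun h => hpT (h ▸ hj)
  have h2 : j ≠ p + 1 := fun h => hqT (h ▸ hj)
  by_cases h : j < p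
  · simp only [if_pos h, if_pos (show j < p + 1 by omega)]
    rw [wt_add_single_right h.le]
  · simp only [if_neg h, if_neg (show ¬ j < p + 1 by omega)]
    rw [wt_add_single_left (by omega), mul_comm]

theorem coeff_centerSer_of_ne (hp1 : 1 ≤ p) (hqT : p + 1 ∉ T) (hpT : p ∉ T) (f : PowerSeries A)
    {m : ℕ →₀ ℕ} (hm : m (p + 1) ≠ 0) : MvPowerSeries.coeff m (centerSer f p T) = 0 := by
  have h : twist p 0 0 (centerSer f p T) = centerSer f p T := by
    rw [twist_centerSer 0 0 hp1 hpT hqT, centerSer]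
    simp only [Finsupp.single_zero, add_zero]
  rw [← h, coeff_twist, if_neg]
  omega

theorem rescale_neg_one_cayleySer :
    cayleySer A * PowerSeries.rescale (-1) (cayleySer A) = 1 := by
  have h1 := geo_mul (1 : A)
  have h2 : PowerSeries.rescale (-1) (geo (1 : A)) = geo (-1) := by
    ext n
    rw [PowerSeries.coeff_rescale, geo, geo, PowerSeries.coeff_mk, PowerSeries.coeff_mk, ← mul_pow]
    norm_num
  have h3 := geo_mul (-1 : A)
  have h4 : PowerSeries.rescale (-1) (PowerSeries.X : PowerSeries A) = -PowerSeries.X := by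
    rw [PowerSeries.rescale_X, map_neg, map_one, neg_one_mul]
  rw [cayleySer, map_mul, map_sub, map_one, h2, h4]
  rw [map_one] at h1
  rw [map_neg, map_one] at h3
  linear_combination (1 - PowerSeries.X) * geo (-1 : A) * h1 + h3

/-- In the product of the central series with its sign change the pair factors of the positions before
`p` cancel. -/
theorem centerSer_mul_signChange (hp1 : 1 ≤ p) (hpT : p ∉ T) (hqT : p + 1 ∉ T)
    (f : PowerSeries A) : centerSer f p T * signChange p (centerSer f p T)
      = evMono (wt 0 p) (f * PowerSeries.rescale (-1) f) * ∏ j ∈ T.filter (fun j => p < j),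
        evMono (wt (p + 1) j) ((1 - PowerSeries.X) * (1 + PowerSeries.X)) := by
  have h0 := wt_ne_zero (show 0 < p by omega)
  rw [centerSer, signChange_mul, signChange_prod, signChange_evMono p h0, evMono_mul h0,
    Finset.prod_filter]
  · have e : ∀ a b c d : MvPowerSeries ℕ A, a * b * (c * d) = a * c * (b * d) := fun a b c d => by
      ring
    rw [e, ← Finset.prod_mul_distrib]
    congr 1
    refine Finset.prod_congr rfl fun j hj => ?_
    have h1 : j ≠ p := fun h => hpT (h ▸ hj)
    have h2 : j ≠ p + 1 := fun h => hqT (h ▸ hj)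
    by_cases h : j < p
    · have h3 := wt_ne_zero h
      simp only [if_pos h]
      rw [if_neg (by omega), signChange_evMono p h3, ← evMono_mul h3, rescale_neg_one_cayleySer,
        evMono_one h3]
      rw [wt_apply, wt_apply, if_pos (by omega), if_neg (by omega)]
    · have h3 := wt_ne_zero (show p + 1 < j by omega)
      simp only [if_neg h]
      rw [if_pos (by omega), signChange_evMono p h3, ← evMono_mul h3, map_sub, map_one,
        PowerSeries.rescale_X, map_neg, map_one, neg_one_mul, sub_neg_eq_add]
      rw [wt_apply, wt_apply, if_neg (by omega), if_pos (by omega)]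
  · rw [wt_apply, wt_apply, if_pos (by omega), if_neg (by omega)]

/-- The coefficient of the symmetrized product, if `f(X) f(-X)` has no terms of degree greater than
`2k`, or there are no positions after `p + 1`. -/
theorem coeff_centerSer_mul_signChange (hp1 : 1 ≤ p) (hpT : p ∉ T) (hqT : p + 1 ∉ T) (k : ℕ)
    (f : PowerSeries A)
    (hf : (∀ s, 2 * k < s → PowerSeries.coeff s (f * PowerSeries.rescale (-1) f) = 0) ∨
      ∀ j ∈ T, j < p) {m : ℕ →₀ ℕ} (hm : m p = 2 * k + m (p + 2)) :
    MvPowerSeries.coeff m (centerSer f p T * signChange p (centerSer f p T))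
      = if m = (2 * k) • wt 0 p then PowerSeries.coeff (2 * k) (f * PowerSeries.rescale (-1) f)
        else 0 := by
  classical
  obtain ⟨Θ, hΘ⟩ : ∃ Θ, Θ = f * PowerSeries.rescale (-1) f := ⟨_, rfl⟩
  obtain ⟨D, hD⟩ : ∃ D : MvPowerSeries ℕ A, D = ∏ j ∈ T.filter (fun j => p < j),
      evMono (wt (p + 1) j) ((1 - PowerSeries.X) * (1 + PowerSeries.X)) := ⟨_, rfl⟩
  have h0 := wt_ne_zero (show 0 < p by omega)
  rw [centerSer_mul_signChange hp1 hpT hqT, ← hD, ← hΘ]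
  rw [← hΘ] at hf
  by_cases hm2 : m (p + 2) = 0
  · have h1 : EqUpTo m D 1 := by
      have h2 : EqUpTo m D (∏ j ∈ T.filter (fun j => p < j), 1) := by
        rw [hD]
        refine EqUpTo.prod fun j hj => ?_
        rw [Finset.mem_filter] at hj
        have h3 : j ≠ p + 1 := fun h => hqT (h ▸ hj.1)
        refine eqUpTo_one_of_apply_eq_zero hm2 ?_ ?_
        · rw [wt_apply, if_pos (by omega)]
          exact one_ne_zero
        · simp [mul_add]
      rwa [Finset.prod_const_one] at h2
    have h2 := ((EqUpTo.refl m (evMono (wt 0 p) Θ)).mul h1) m le_rfl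
    rw [h2, mul_one]
    split_ifs with h3
    · rw [h3, coeff_evMono_smul h0]
    · refine coeff_evMono_of_forall_ne h0 Θ fun n hn => h3 ?_
      have h4 := DFunLike.congr_fun hn p
      rw [Finsupp.smul_apply, wt_apply, if_pos (by omega), smul_eq_mul, mul_one] at h4
      rw [hn]
      congr 1
      omega
  · have hne : ¬ m = (2 * k) • wt 0 p := by
      intro h
      apply hm2
      rw [h, Finsupp.smul_apply, wt_apply, if_neg (by omega), smul_zero]
    rw [if_neg hne]
    rcases hf with hf | hf
    · -- only `u_p` involves the variable `y_p`
      let P : AddSubmonoid (ℕ →₀ ℕ) := AddMonoidHom.mker (Finsupp.applyAddHom p)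
      have hP : ∀ e : ℕ →₀ ℕ, e ∈ P ↔ e p = 0 := fun e => Iff.rfl
      have hDP : SupportedIn P D := by
        rw [hD]
        refine SupportedIn.prod fun j hj => ?_
        rw [Finset.mem_filter] at hj
        have h3 : j ≠ p + 1 := fun h => hqT (h ▸ hj.1)
        refine supportedIn_evMono (wt_ne_zero (by omega)) ?_ _
        rw [hP, wt_apply, if_neg (by omega)]
      rw [MvPowerSeries.coeff_mul]
      refine Finset.sum_eq_zero fun x hx => ?_
      rw [Finset.HasAntidiagonal.mem_antidiagonal] at hx
      by_cases hx2 : x.2 p = 0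
      · have hx1 : x.1 p = m p := by rw [← hx, Finsupp.add_apply, hx2, add_zero]
        by_cases h : ∃ n : ℕ, x.1 = n • wt 0 p
        · obtain ⟨n, hn⟩ := h
          rw [hn, Finsupp.smul_apply, wt_apply, if_pos (by omega), smul_eq_mul, mul_one] at hx1
          rw [hn, coeff_evMono_smul h0, hf n (by omega), zero_mul]
        · push Not at h
          rw [coeff_evMono_of_forall_ne h0 Θ h, zero_mul]
      · rw [hDP x.2 (fun h => hx2 ((hP _).1 h)), mul_zero]
    · have hD1 : D = 1 := by
        rw [hD, Finset.filter_false_of_mem, Finset.prod_empty]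
        intro j hj
        have := hf j hj
        omega
      rw [hD1, mul_one]
      refine coeff_evMono_of_forall_ne h0 Θ fun n hn => hm2 ?_
      rw [hn, Finsupp.smul_apply, wt_apply, if_neg (by omega), smul_zero]

/-- The excess, over an arbitrary ring, for a correction `S` and a series `f`. -/
noncomputable def excessSer (k : ℕ) (S : A) (f : PowerSeries A) (v : ℕ → ℤ) (p : ℕ)
    (T : Finset ℕ) : MvPowerSeries ℕ A :=
  MvPowerSeries.C S ^ 2 * MvPowerSeries.monomial (k • wt 0 p) 1 *
      MvPowerSeries.monomial (k • wt 0 (p + 1)) 1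
    + MvPowerSeries.C S *
      (MvPowerSeries.monomial (k • wt 0 (p + 1)) 1 * evMono (wt 0 p) f * linkSer A v p T
        - MvPowerSeries.monomial (k • wt 0 p) 1 * evMono (wt 0 (p + 1)) f * linkSer A v (p + 1) T)
    - evMono (wt 0 p) f * evMono (wt 0 (p + 1)) f * linkSer A v p T * linkSer A v (p + 1) T *
      evMono (wt p (p + 1)) (cayleySer A)

/-- A coefficient of the excess, at exponents as in `∏ u_i^{μ_i}` with `μ_p = μ_{p+1} = k`. It vanishes
unless the exponent is that of `u_p^k u_{p+1}^k`. -/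
theorem coeff_excessSer [IsDomain A] [CharZero A] (hp1 : 1 ≤ p) (hpT : p ∉ T) (hqT : p + 1 ∉ T)
    (hneg : ∀ j ∈ T, j < p → v p + v j < 0 ∧ v (p + 1) + v j < 0)
    (hpos : ∀ j ∈ T, p < j → 0 ≤ v p + v j ∧ 0 ≤ v (p + 1) + v j) (k : ℕ) (S : A)
    (f : PowerSeries A)
    (hf : (∀ s, 2 * k < s → PowerSeries.coeff s (f * PowerSeries.rescale (-1) f) = 0) ∨
      ∀ j ∈ T, j < p) {m : ℕ →₀ ℕ} (hm : m p = 2 * k + m (p + 2))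
    (hm1 : m (p + 1) = k + m (p + 2)) :
    MvPowerSeries.coeff m (excessSer k S f v p T)
      = if m = k • wt 0 p + k • wt 0 (p + 1) then
          S ^ 2 - (-1) ^ k * PowerSeries.coeff (2 * k) (f * PowerSeries.rescale (-1) f)
        else 0 := by
  classical
  have hwp : ∀ a, (k • wt 0 p) a = if 0 < a ∧ a ≤ p then k else 0 := by
    intro a
    rw [Finsupp.smul_apply, wt_apply, smul_eq_mul]
    split_ifs <;> simp
  have hwq : ∀ a, (k • wt 0 (p + 1)) a = if 0 < a ∧ a ≤ p + 1 then k else 0 := by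
    intro a
    rw [Finsupp.smul_apply, wt_apply, smul_eq_mul]
    split_ifs <;> simp
  -- the terms with one correction cancel
  have hmid : MvPowerSeries.coeff m
      (MvPowerSeries.monomial (k • wt 0 (p + 1)) 1 * evMono (wt 0 p) f * linkSer A v p T)
      = MvPowerSeries.coeff m
        (MvPowerSeries.monomial (k • wt 0 p) 1 * evMono (wt 0 (p + 1)) f *
          linkSer A v (p + 1) T) := by
    rw [mul_assoc, mul_assoc, ← twist_zero_one_centerSer hp1 hpT hqT
      (fun j hj h => (hneg j hj h).1) (fun j hj h => (hpos j hj h).1),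
      ← twist_one_zero_centerSer hp1 hpT hqT
      (fun j hj h => (hneg j hj (by
        have h1 : j ≠ p := fun h => hpT (h ▸ hj)
        omega)).2) (fun j hj h => (hpos j hj (by omega)).2),
      MvPowerSeries.coeff_monomial_mul, MvPowerSeries.coeff_monomial_mul]
    have hle : k • wt 0 (p + 1) ≤ m ↔ k • wt 0 p ≤ m := by
      constructor
      · intro h a
        have := h a
        rw [hwq] at this
        rw [hwp]
        split_ifs at this ⊢ <;> omega
      · intro h a
        by_cases ha : a = p + 1
        · rw [hwq, if_pos (by omega), ha]
          omega
        · have := h a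
          rw [hwp] at this
          rw [hwq]
          split_ifs at this ⊢ <;> omega
    have herase : (m - k • wt 0 (p + 1)).erase (p + 1) = (m - k • wt 0 p).erase (p + 1) := by
      ext a
      by_cases ha : a = p + 1
      · rw [ha, Finsupp.erase_same, Finsupp.erase_same]
      · rw [Finsupp.erase_ne ha, Finsupp.erase_ne ha, Finsupp.tsub_apply, Finsupp.tsub_apply,
          hwp, hwq]
        split_ifs <;> omega
    by_cases h : k • wt 0 p ≤ m
    · rw [if_pos h, if_pos (hle.2 h), one_mul, one_mul, coeff_twist, coeff_twist, if_pos, if_pos]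
      · rw [herase]
      · simp only [Finsupp.tsub_apply, hwp]
        rw [if_neg (by omega), if_pos (by omega), if_neg (by omega)]
        omega
      · simp only [Finsupp.tsub_apply, hwq]
        rw [if_pos (by omega), if_pos (by omega), if_neg (by omega)]
        omega
    · rw [if_neg h, if_neg (fun h' => h (hle.1 h'))]
  have hfirst : MvPowerSeries.coeff m (MvPowerSeries.C S ^ 2 *
      MvPowerSeries.monomial (k • wt 0 p) 1 * MvPowerSeries.monomial (k • wt 0 (p + 1)) 1)
      = if m = k • wt 0 p + k • wt 0 (p + 1) then S ^ 2 else 0 := by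
    rw [mul_assoc, MvPowerSeries.monomial_mul_monomial, ← map_pow, MvPowerSeries.coeff_C_mul,
      MvPowerSeries.coeff_monomial, one_mul, mul_ite, mul_one, mul_zero]
  have hlast := coeff_cayley_mul_twist p k
    (fun m hm => coeff_centerSer_of_ne hp1 hqT hpT f hm) hm hm1
  rw [centerSer_mul_twist hp1 hpT hqT hneg hpos, coeff_centerSer_mul_signChange hp1 hpT hqT k f hf
    (by rw [Finsupp.erase_ne (by omega), Finsupp.erase_ne (by omega)]; exact hm)] at hlast
  have hiff : m.erase (p + 1) = (2 * k) • wt 0 p ↔ m = k • wt 0 p + k • wt 0 (p + 1) := by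
    constructor
    · intro h
      have h2 := DFunLike.congr_fun h (p + 2)
      rw [Finsupp.erase_ne (by omega), Finsupp.smul_apply, wt_apply, if_neg (by omega),
        smul_zero] at h2
      ext a
      rw [Finsupp.add_apply, hwp, hwq]
      by_cases ha : a = p + 1
      · rw [ha, if_neg (by omega), if_pos (by omega)]
        omega
      · have h3 := DFunLike.congr_fun h a
        rw [Finsupp.erase_ne ha, Finsupp.smul_apply, wt_apply, smul_eq_mul] at h3
        split_ifs at h3 ⊢ <;> omega
    · intro h
      ext a
      by_cases ha : a = p + 1
      · rw [ha, Finsupp.erase_same, Finsupp.smul_apply, wt_apply, if_neg (by omega), smul_zero]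
      · rw [Finsupp.erase_ne ha, h, Finsupp.add_apply, hwp, hwq, Finsupp.smul_apply, wt_apply,
          smul_eq_mul]
        split_ifs <;> omega
  rw [excessSer, map_sub, map_add, MvPowerSeries.coeff_C_mul, map_sub, hmid, sub_self, mul_zero,
    add_zero, hfirst, mul_comm _ (evMono (wt p (p + 1)) (cayleySer A)), wt_self_succ, hlast]
  by_cases h : m = k • wt 0 p + k • wt 0 (p + 1)
  · have h2 : m (p + 1) = k := by rw [h, Finsupp.add_apply, hwp, hwq, if_neg (by omega),
      if_pos (by omega), zero_add]
    rw [if_pos h, if_pos h, if_pos (hiff.2 h), h2]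
  · rw [if_neg h, if_neg h, if_neg (fun h' => h (hiff.1 h')), mul_zero, sub_zero]

end Generic

/-! ### Vanishing of the deviation -/

/-- The exponents in which `y_p`, `y_{p+1}` and `y_{p+2}` have the same degree. -/
def tiedExp (p : ℕ) : AddSubmonoid (ℕ →₀ ℕ) where
  carrier := {m | m p = m (p + 1) ∧ m (p + 1) = m (p + 2)}
  zero_mem' := ⟨rfl, rfl⟩
  add_mem' := by
    rintro a b ⟨h1, h2⟩ ⟨h3, h4⟩
    exact ⟨by rw [Finsupp.add_apply, Finsupp.add_apply, h1, h3],
      by rw [Finsupp.add_apply, Finsupp.add_apply, h2, h4]⟩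

theorem mem_tiedExp {p : ℕ} {m : ℕ →₀ ℕ} :
    m ∈ tiedExp p ↔ m p = m (p + 1) ∧ m (p + 1) = m (p + 2) := Iff.rfl

theorem wt_mem_tiedExp {p i j : ℕ} (hip : i ≠ p) (hiq : i ≠ p + 1) (hjp : j ≠ p)
    (hjq : j ≠ p + 1) : wt i j ∈ tiedExp p := by
  rw [mem_tiedExp, wt_apply, wt_apply, wt_apply]
  constructor <;> split_ifs <;> omega

/-- The positions other than `p` and `p + 1` contribute only monomials in which `y_p`, `y_{p+1}` and
`y_{p+2}` have the same degree. -/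
theorem supportedIn_subsetTerm (k : ℕ) (part : ℕ → ℕ) (v : ℕ → ℤ) {p : ℕ} (hp1 : 1 ≤ p)
    {I T : Finset ℕ} (hI : ∀ j ∈ I, 1 ≤ j ∧ j ≠ p ∧ j ≠ p + 1) (hT : T ⊆ I) :
    SupportedIn (tiedExp p) (subsetTerm I (corrTerm k part v) (entryTerm k v) (pairTerm v) T) := by
  refine ((SupportedIn.prod fun j hj => ?_).mul (SupportedIn.prod fun j hj => ?_)).mul
    (SupportedIn.prod fun j hj => SupportedIn.prod fun l hl => ?_)
  · have h := hI j (Finset.mem_sdiff.1 hj).1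
    exact supportedIn_monomial ((tiedExp p).nsmul_mem
      (wt_mem_tiedExp (by omega) (by omega) h.2.1 h.2.2) _) _
  · have h := hI j (hT hj)
    exact supportedIn_evMono (wt_ne_zero (by omega))
      (wt_mem_tiedExp (by omega) (by omega) h.2.1 h.2.2) _
  · split_ifs with hjl
    · have h := hI j (hT hj)
      have h' := hI l (hT hl)
      exact supportedIn_evMono (wt_ne_zero hjl) (wt_mem_tiedExp h.2.1 h.2.2 h'.2.1 h'.2.2) _
    · exact supportedIn_one _

theorem map_linkProd_eq_linkSer {A : Type*} [CommRing A] (φ : PolyBT ℚ →+* A) (v : ℕ → ℤ) {p : ℕ}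
    {T : Finset ℕ} (hp : p ∉ T) :
    MvPowerSeries.map φ (linkProd (pairTerm v) p T) = linkSer A v p T := by
  rw [map_linkProd]
  refine Finset.prod_congr rfl fun j hj => ?_
  have : p ≠ j := fun h => hp (h ▸ hj)
  change MvPowerSeries.map φ (pairTerm v (min p j) (max p j))
    = evMono (wt (min p j) (max p j)) (raiseSer A (v (min p j) + v (max p j)))
  rw [pairTerm, map_evMono φ (wt_ne_zero (by omega)), map_raiseSer]

theorem map_pairExcess {A : Type*} [CommRing A] (φ : PolyBT ℚ →+* A) (k : ℕ) (v v' : ℕ → ℤ) {p : ℕ}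
    (hp1 : 1 ≤ p) {T : Finset ℕ} (hpT : p ∉ T) (hqT : p + 1 ∉ T) (hv : v p + v (p + 1) < 0) :
    MvPowerSeries.map φ (pairExcess k v v' p (p + 1) T)
      = excessSer k (φ (entryCorr k p (v' p))) (PowerSeries.map φ (entrySer k (v' p))) v' p T := by
  have h1 := wt_ne_zero (show 0 < p by omega)
  have h2 := wt_ne_zero (show 0 < p + 1 by omega)
  have h3 := wt_ne_zero (show p < p + 1 by omega)
  simp only [pairExcess, excessSer, map_sub, map_add, map_mul, map_pow, MvPowerSeries.map_C,
    map_linkProd_eq_linkSer φ v' hpT, map_linkProd_eq_linkSer φ v' hqT, uMono_pow,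
    MvPowerSeries.map_monomial, map_one, map_evMono φ h1, map_evMono φ h2, pairTerm,
    map_evMono φ h3, map_raiseSer]
  rw [raiseSer, if_pos hv, cayleySer]

/-- The product of the series of an entry `±1` with its sign change. -/
theorem entrySer_mul_rescale (k : ℕ) {v : ℤ} (hv : |v| = 1) :
    entrySer k v * PowerSeries.rescale (-1) (entrySer k v) = PowerSeries.C (half * half) *
      (cBase ℚ k * PowerSeries.rescale (-1) (cBase ℚ k)) := by
  have hC : ∀ a : PolyBT ℚ, PowerSeries.rescale (-1) (PowerSeries.C a) = PowerSeries.C a := by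
    intro a
    ext1 n
    rw [PowerSeries.coeff_rescale, PowerSeries.coeff_C]
    split_ifs with h
    · rw [h, pow_zero, one_mul]
    · rw [mul_zero]
  rcases abs_eq (by norm_num : (0 : ℤ) ≤ 1) |>.1 hv with rfl | rfl
  · have h1 := geo_mul (tVar ℚ 1)
    have h2 : PowerSeries.rescale (-1) (geo (tVar ℚ 1)) = geo (-tVar ℚ 1) := by
      ext1 n
      rw [PowerSeries.coeff_rescale, geo, geo, PowerSeries.coeff_mk, PowerSeries.coeff_mk,
        ← mul_pow, neg_neg]
      congr 1
      ring
    have h3 := geo_mul (-tVar ℚ 1)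
    have h4 : PowerSeries.rescale (-1) (PowerSeries.X : PowerSeries (PolyBT ℚ))
        = -PowerSeries.X := by
      rw [PowerSeries.rescale_X, map_neg, map_one]
      ring
    rw [map_neg] at h3
    rw [entrySer_one]
    simp only [map_mul, map_sub, map_one, hC, h2, h4]
    linear_combination (PowerSeries.C half * PowerSeries.C half * cBase ℚ k *
      PowerSeries.rescale (-1) (cBase ℚ k)) * (h1 * geo (-tVar ℚ 1) *
        (1 - PowerSeries.C (tVar ℚ 1) * PowerSeries.X) + h3)
  · rw [entrySer_neg_one]
    simp only [map_mul, hC]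
    ring

theorem entryCorr_sq (k p : ℕ) {v : ℤ} (hv : |v| = 1) :
    entryCorr k p v ^ 2 = half * half * dDiff k ^ 2 := by
  have hs : posSign p ^ 2 = 1 := by
    by_cases h : Odd p
    · rw [posSign_of_odd h, one_pow]
    · rw [posSign_of_not_odd h]
      ring
  rcases abs_eq (by norm_num : (0 : ℤ) ≤ 1) |>.1 hv with rfl | rfl
  · rw [entryCorr_one]
    linear_combination half * half * dDiff k ^ 2 * hs
  · rw [entryCorr_neg_one]
    linear_combination half * half * dDiff k ^ 2 * hs

/-- The coefficient `∑ (-1)^j c_i c_j`, over `i + j = s`, of `c(X) c(-X)`. -/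
noncomputable def thetaCoeff (k s : ℕ) : PolyBT ℚ :=
  PowerSeries.coeff s (cBase ℚ k * PowerSeries.rescale (-1) (cBase ℚ k))

theorem coeff_map_entrySer_mul_rescale {A : Type*} [CommRing A] (φ : PolyBT ℚ →+* A) (k s : ℕ)
    {v : ℤ} (hv : |v| = 1) :
    PowerSeries.coeff s (PowerSeries.map φ (entrySer k v) *
      PowerSeries.rescale (-1) (PowerSeries.map φ (entrySer k v)))
      = φ (half * half * thetaCoeff k s) := by
  have h : PowerSeries.rescale (-1) (PowerSeries.map φ (entrySer k v))
      = PowerSeries.map φ (PowerSeries.rescale (-1) (entrySer k v)) := by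
    ext n
    simp [PowerSeries.coeff_rescale]
  rw [h, ← map_mul, PowerSeries.coeff_map, entrySer_mul_rescale k hv, PowerSeries.coeff_C_mul]
  rfl

namespace TypedPartition

variable {k : ℕ} [NeZero k] {lam mu : TypedPartition k} {p : ℕ}

/-- In an exceptional case the entries of `μ` at `p` and `p + 1` are `± 1` and `2`, so the preceding
entries are at most `-3` and the following ones at least `3`. -/
theorem mu_entry_signs (h : IsExceptional lam mu p) {j : ℕ} (hj1 : 1 ≤ j) :
    (j < p → mu.entry p + mu.entry j < 0 ∧ mu.entry (p + 1) + mu.entry j < 0) ∧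
      (p + 1 < j → 0 ≤ mu.entry p + mu.entry j ∧ 0 ≤ mu.entry (p + 1) + mu.entry j) := by
  have h1 := h.one_le
  have h2 := h.abs_mu
  have h3 := h.mu_succ
  have h4 : -1 ≤ mu.entry p ∧ mu.entry p ≤ 1 := abs_le.1 h2.le
  constructor
  · intro hj
    have h5 := mu.entry_lt hj1 hj
    have h6 := mu.abs_entry_ne hj1 h1 (by omega)
    have h7 := mu.abs_entry_ne hj1 (show 1 ≤ p + 1 by omega) (by omega)
    rw [h3] at h7
    rw [h2] at h6
    have h8 := mu.entry_ne_zero hj1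
    rcases abs_cases (mu.entry j) with h9 | h9 <;> norm_num at h7 <;> omega
  · intro hj
    have h5 := mu.entry_lt (show 1 ≤ p + 1 by omega) hj
    omega

/-- A coefficient of the excess for one subset `T` of the other positions, after a base change `φ`
which kills the coefficients of `c(X) c(-X)` of degree greater than `2k`; these do not matter if `T`
has no position after `p + 1`. -/
theorem coeff_map_pairExcess (h : IsExceptional lam mu p) (φ : PolyBT ℚ →+* PolyBT ℚ)
    {T : Finset ℕ} (hT : ∀ j ∈ T, 1 ≤ j ∧ j ≠ p ∧ j ≠ p + 1)
    (hΘ : (∀ s, 2 * k < s → φ (thetaCoeff k s) = 0) ∨ ∀ j ∈ T, j < p) {m : ℕ →₀ ℕ}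
    (hm : m p = 2 * k + m (p + 2)) (hm1 : m (p + 1) = k + m (p + 2)) :
    MvPowerSeries.coeff m (MvPowerSeries.map φ (pairExcess k lam.entry mu.entry p (p + 1) T))
      = if m = k • wt 0 p + k • wt 0 (p + 1) then
          φ (half * half * (dDiff k ^ 2 - (-1) ^ k * thetaCoeff k (2 * k))) else 0 := by
  have hpT : p ∉ T := fun hj => (hT p hj).2.1 rfl
  have hqT : p + 1 ∉ T := fun hj => (hT _ hj).2.2 rfl
  rw [map_pairExcess φ k _ _ h.one_le hpT hqT h.lam_add_neg,
    coeff_excessSer h.one_le hpT hqT (fun j hj => (mu_entry_signs h (hT j hj).1).1)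
      (fun j hj hpj => (mu_entry_signs h (hT j hj).1).2 (by have := (hT j hj).2.2; omega)) k _ _ ?_
      hm hm1]
  · rw [coeff_map_entrySer_mul_rescale φ k _ h.abs_mu, ← map_pow, entryCorr_sq k p h.abs_mu]
    split_ifs
    · simp only [map_mul, map_sub, map_pow, map_neg, map_one]
      ring
    · rfl
  · rcases hΘ with hΘ | hΘ
    · left
      intro s hs
      rw [coeff_map_entrySer_mul_rescale φ k _ h.abs_mu, map_mul, hΘ s hs, mul_zero]
    · exact Or.inr hΘ

/-- The condition `μ_p = μ_{p+1} = k`, in terms of the exponent of `∏ u_i^{μ_i}`. It is not affected by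
the contributions of the other positions, which lie in `tiedExp p`. -/
theorem partExp_centered (h : IsExceptional lam mu p) {L : ℕ} (hL : p + 1 ≤ L) :
    partExp L mu.part p = 2 * k + partExp L mu.part (p + 2) ∧
      partExp L mu.part (p + 1) = k + partExp L mu.part (p + 2) := by
  have h1 := h.one_le
  have h2 : ∑ i ∈ Finset.Icc (p + 1) L, mu.part i = k + ∑ i ∈ Finset.Icc (p + 2) L, mu.part i := by
    have h4 := Finset.add_sum_Ioc_eq_sum_Icc (f := mu.part) hL
    have h5 : Finset.Ioc (p + 1) L = Finset.Icc (p + 2) L := by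
      ext a
      rw [Finset.mem_Ioc, Finset.mem_Icc]
      omega
    rw [h5, h.part_mu_succ] at h4
    exact h4.symm
  have h3 : ∑ i ∈ Finset.Icc p L, mu.part i = k + ∑ i ∈ Finset.Icc (p + 1) L, mu.part i := by
    have h4 := Finset.add_sum_Ioc_eq_sum_Icc (f := mu.part) (show p ≤ L by omega)
    have h5 : Finset.Ioc p L = Finset.Icc (p + 1) L := by
      ext a
      rw [Finset.mem_Ioc, Finset.mem_Icc]
      omega
    rw [h5, h.part_mu] at h4
    exact h4.symm
  rw [partExp_apply, partExp_apply, partExp_apply, if_pos (by omega), if_pos (by omega),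
    if_pos (by omega), h3, h2]
  omega

/-- The deviation vanishes where the quadratic relations hold. -/
theorem map_excess_eq_zero (h : IsExceptional lam mu p) {L : ℕ} (hL : p + 1 ≤ L)
    (φ : PolyBT ℚ →+* PolyBT ℚ) (hΘ : ∀ s, 2 * k < s → φ (thetaCoeff k s) = 0)
    (hd : φ (dDiff k ^ 2 - (-1) ^ k * thetaCoeff k (2 * k)) = 0) :
    φ (excess lam mu L p) = 0 := by
  classical
  rw [excess, ← MvPowerSeries.coeff_map, map_sum, map_sum]
  refine Finset.sum_eq_zero fun T hT => ?_
  rw [Finset.mem_powerset] at hT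
  have hI : ∀ j ∈ ((Finset.Icc 1 L).erase p).erase (p + 1), 1 ≤ j ∧ j ≠ p ∧ j ≠ p + 1 := by
    intro j hj
    rw [Finset.mem_erase, Finset.mem_erase, Finset.mem_Icc] at hj
    exact ⟨hj.2.2.1, hj.2.1, hj.1⟩
  have hc := partExp_centered h hL
  rw [map_mul, MvPowerSeries.coeff_mul]
  refine Finset.sum_eq_zero fun x hx => ?_
  rw [Finset.HasAntidiagonal.mem_antidiagonal] at hx
  by_cases h1 : x.1 ∈ tiedExp p
  · rw [mem_tiedExp] at h1
    rw [← hx] at hc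
    simp only [Finsupp.add_apply] at hc
    rw [coeff_map_pairExcess h φ (fun j hj => hI j (hT hj)) (Or.inl hΘ) (by omega) (by omega),
      map_mul, hd, mul_zero, ite_self, mul_zero]
  · rw [((supportedIn_subsetTerm k mu.part mu.entry h.one_le hI hT).map φ) _ h1, zero_mul]

/-- The deviation for the partitions `(k+1, k)` and `(k, k)`. -/
theorem excess_one_two (h : IsExceptional lam mu 1) :
    excess lam mu 2 1 = half * half * (dDiff k ^ 2 - (-1) ^ k * thetaCoeff k (2 * k)) := by
  have hI : ((Finset.Icc 1 2).erase 1).erase (1 + 1) = ∅ := rfl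
  have hc := partExp_centered h (L := 2) (by omega)
  have h1 := coeff_map_pairExcess h (RingHom.id _) (T := ∅) (by simp) (Or.inr (by simp)) hc.1 hc.2
  rw [MvPowerSeries.map_id, RingHom.id_apply, RingHom.id_apply, if_pos] at h1
  · rw [excess, hI, Finset.powerset_empty, Finset.sum_singleton, ← h1]
    simp [subsetTerm, pairProd]
  · rw [partExp, show Finset.Icc 1 2 = {1, 2} from rfl, Finset.sum_pair (by omega), h.part_mu,
      h.part_mu_succ]

end TypedPartition

/-! ### Integrality -/

section Even

variable (R : Type) [CommRing R]

theorem hNeg_neg_self (n : ℕ) : hNeg R (-(n : ℤ)) n = negT R n := by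
  rcases Nat.eq_zero_or_pos n with rfl | hn
  · simp [hNeg, negT]
  · rw [hNeg, if_neg (by omega), neg_neg, Int.toNat_natCast, eNeg_self]

theorem hNeg_neg_eq_zero {n j : ℕ} (h : n < j) : hNeg R (-(n : ℤ)) j = 0 := by
  rcases Nat.eq_zero_or_pos n with rfl | hn
  · obtain ⟨j, rfl⟩ : ∃ i, j = i + 1 := ⟨j - 1, by omega⟩
    simp [hNeg, MvPolynomial.hsymm]
  · rw [hNeg, if_neg (by omega), neg_neg, Int.toNat_natCast, eNeg, MvPolynomial.esymm,
      Finset.powersetCard_eq_empty.2 (by simpa using h), Finset.sum_empty, map_zero]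

theorem cPoly_of_lt {k : ℕ} {p : ℤ} (h : (k : ℤ) < p) : cPoly R k p = 2 * bPoly R p := by
  rw [cPoly, if_neg (by omega), if_neg (by omega)]

/-- Since `c_p = 2 b_p` for `p > k`, the polynomial `c^{-n}_p` is even for `p > k + n`. -/
theorem even_cUp (k n : ℕ) {p : ℤ} (hp : (k : ℤ) + n < p) : ∃ x, cUp R k (-(n : ℤ)) p = 2 * x := by
  refine ⟨∑ j ∈ Finset.range (p + 1).toNat, MvPolynomial.C (bPoly R (p - j)) * hNeg R (-(n : ℤ)) j,
    ?_⟩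
  rw [cUp, Finset.mul_sum]
  refine Finset.sum_congr rfl fun j _ => ?_
  by_cases hj : n < j
  · rw [hNeg_neg_eq_zero R hj, mul_zero, mul_zero, mul_zero]
  · rw [cPoly_of_lt R (by omega), map_mul, map_ofNat, mul_assoc]

theorem cUp_eq_two_mul_add (k n : ℕ) : ∃ x, cUp R k (-(n : ℤ)) ((k : ℤ) + n)
    = 2 * x + MvPolynomial.C (cPoly R k k) * negT R n := by
  refine ⟨∑ j ∈ Finset.range n, MvPolynomial.C (bPoly R ((k : ℤ) + n - j)) * hNeg R (-(n : ℤ)) j, ?_⟩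
  rw [cUp, show ((k : ℤ) + n + 1).toNat = n + 1 + k by omega, Finset.sum_range_add,
    Finset.sum_range_succ, Finset.sum_eq_zero (s := Finset.range k), add_zero, hNeg_neg_self,
    show (k : ℤ) + n - n = k by ring, Finset.mul_sum]
  · congr 1
    refine Finset.sum_congr rfl fun j hj => ?_
    rw [Finset.mem_range] at hj
    rw [cPoly_of_lt R (by omega), map_mul, map_ofNat, mul_assoc]
  · intro j _
    rw [hNeg_neg_eq_zero R (by omega), mul_zero]

theorem coeff_raiseSer_of_neg {s : ℤ} (hs : s < 0) (n : ℕ) :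
    PowerSeries.coeff (n + 1) (raiseSer R s) = 2 * (-1) ^ (n + 1) := by
  rw [raiseSer, if_pos hs, sub_mul, one_mul, map_sub, PowerSeries.coeff_succ_X_mul, geo,
    PowerSeries.coeff_mk, PowerSeries.coeff_mk]
  ring

end Even

theorem toRat_mem_range (x : PolyBT ℤ) : toRat x ∈ toRat.range := ⟨x, rfl⟩

theorem half_mul_toRat_two_mul (x : PolyBT ℤ) : half * toRat (2 * x) = toRat x := by
  rw [map_mul, map_ofNat]
  linear_combination toRat x * two_mul_half

theorem C_map_mem_range (x : PolyB ℤ) :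
    MvPolynomial.C (MvPolynomial.map (Int.castRingHom ℚ) x) ∈ toRat.range :=
  ⟨MvPolynomial.C x, toRat_C x⟩

theorem C_cPoly_mem_range (k : ℕ) (p : ℤ) : MvPolynomial.C (cPoly ℚ k p) ∈ toRat.range := by
  rw [← map_cPoly]
  exact C_map_mem_range _

theorem cUp_mem_range (k : ℕ) (r p : ℤ) : cUp ℚ k r p ∈ toRat.range :=
  ⟨_, toRat_cUp k r p⟩

theorem half_mul_cUp_mem_range {k n : ℕ} {p : ℤ} (hp : (k : ℤ) + n < p) :
    half * cUp ℚ k (-(n : ℤ)) p ∈ toRat.range := by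
  obtain ⟨x, hx⟩ := even_cUp ℤ k n hp
  exact ⟨x, by rw [← toRat_cUp, hx, half_mul_toRat_two_mul]⟩

theorem half_mul_C_cPoly_mem_range {k : ℕ} {p : ℤ} (hp : (k : ℤ) < p) :
    half * MvPolynomial.C (cPoly ℚ k p) ∈ toRat.range := by
  have h := half_mul_cUp_mem_range (n := 0) (p := p) (k := k) (by simpa using hp)
  rwa [Nat.cast_zero, neg_zero, cUp_zero] at h

theorem half_C_cPoly_add_posSign_mem_range (k i : ℕ) :
    half * MvPolynomial.C (cPoly ℚ k k) + half * posSign i * dDiff k ∈ toRat.range ∧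
      half * MvPolynomial.C (cPoly ℚ k k) - half * posSign i * dDiff k ∈ toRat.range := by
  have h1 : half * MvPolynomial.C (cPoly ℚ k k) - half * dDiff k ∈ toRat.range := by
    rw [half_cPoly_sub, ← map_bPoly]
    exact C_map_mem_range _
  have h2 : half * MvPolynomial.C (cPoly ℚ k k) + half * dDiff k ∈ toRat.range := by
    rw [half_cPoly_add, ← map_bTildePoly]
    exact C_map_mem_range _
  by_cases h : Odd i
  · rw [posSign_of_odd h, mul_one]
    exact ⟨h2, h1⟩
  · rw [posSign_of_not_odd h]
    constructor
    · convert h1 using 1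
      ring
    · convert h2 using 1
      ring

theorem zcoeff_entrySer_one_eq (k : ℕ) (z : ℤ) : zcoeff (entrySer k 1) z
    = cUp ℚ k 1 z - MvPolynomial.C (cPoly ℚ k z) + half * MvPolynomial.C (cPoly ℚ k z) := by
  rw [zcoeff_entrySer_one, aUp_eq, cUp_zero]
  linear_combination (-MvPolynomial.C (cPoly ℚ k z)) * half_add_half

theorem cUp_sub_mem_range (k : ℕ) (z : ℤ) :
    cUp ℚ k 1 z - MvPolynomial.C (cPoly ℚ k z) ∈ toRat.range :=
  sub_mem (cUp_mem_range k 1 z) (C_cPoly_mem_range k z)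

namespace TypedPartition

variable {k : ℕ} [NeZero k] (lam : TypedPartition k)

theorem pairCoeff_mem_range (p : ℕ × ℕ) (n : ℕ) : lam.pairCoeff p n ∈ toRat.range :=
  ⟨PowerSeries.coeff n (raiseSer (PolyBT ℤ) (lam.entry p.1 + lam.entry p.2)), by
    rw [pairCoeff, ← map_raiseSer toRat, PowerSeries.coeff_map]⟩

theorem entry_cases {j : ℕ} (hj : 1 ≤ j) : 2 ≤ lam.entry j ∨
    (lam.entry j = 1 ∧ lam.part j = k) ∨ ∃ n : ℕ, lam.entry j = -((n : ℤ) + 1) ∧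
      lam.part j = k + n := by
  have h0 := lam.entry_ne_zero hj
  by_cases h2 : 2 ≤ lam.entry j
  · exact Or.inl h2
  · right
    by_cases h1 : lam.entry j = 1
    · left
      refine ⟨h1, ?_⟩
      have h3 : |lam.entry j| = 1 := by rw [h1, abs_one]
      rw [lam.eq_mid_of_abs_entry hj h3, lam.part_mid (lam.type_pos_of_abs_entry hj h3)]
    · right
      have h3 := lam.part_of_entry_neg hj (by omega)
      exact ⟨(-lam.entry j - 1).toNat, by omega, by omega⟩

theorem two_mul_entrySer_mem_range {j : ℕ} (hj : 1 ≤ j) (z : ℤ) :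
    2 * zcoeff (entrySer k (lam.entry j)) z ∈ toRat.range := by
  rcases lam.entry_cases hj with h | ⟨h, -⟩ | ⟨n, h, -⟩
  · rw [zcoeff_entrySer_of_one_lt k (by omega)]
    exact mul_mem (ofNat_mem _ 2) (cUp_mem_range _ _ _)
  · rw [h, zcoeff_entrySer_one_eq]
    convert add_mem (mul_mem (ofNat_mem toRat.range 2) (cUp_sub_mem_range k z))
      (C_cPoly_mem_range k z) using 1
    linear_combination MvPolynomial.C (cPoly ℚ k z) * two_mul_half
  · rw [h, zcoeff_entrySer_neg]
    convert cUp_mem_range k (-(n : ℤ)) z using 1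
    linear_combination cUp ℚ k (-(n : ℤ)) z * two_mul_half

theorem entrySer_mem_range {j : ℕ} (hj : 1 ≤ j) {z : ℤ} (hz : lam.part j < z) :
    zcoeff (entrySer k (lam.entry j)) z ∈ toRat.range := by
  rcases lam.entry_cases hj with h | ⟨h, hp⟩ | ⟨n, h, hp⟩
  · rw [zcoeff_entrySer_of_one_lt k (by omega)]
    exact cUp_mem_range _ _ _
  · rw [h, zcoeff_entrySer_one_eq]
    exact add_mem (cUp_sub_mem_range k z) (half_mul_C_cPoly_mem_range (by omega))
  · rw [h, zcoeff_entrySer_neg]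
    exact half_mul_cUp_mem_range (by omega)

theorem evenFactor_mem_range_of_avoids {n : ℕ × ℕ →₀ ℕ} {j : ℕ} (hj : 1 ≤ j) (hav : Avoids n j) :
    lam.evenFactor n j ∈ toRat.range := by
  rw [evenFactor, if_pos hav, lam.raised_of_avoids hav]
  have hs := half_C_cPoly_add_posSign_mem_range k j
  rcases lam.entry_cases hj with h | ⟨h, hp⟩ | ⟨N, h, hp⟩
  · rw [zcoeff_entrySer_of_one_lt k (by omega), entryCorr_of_one_lt k j (by omega), add_zero]
    exact cUp_mem_range _ _ _
  · rw [h, zcoeff_entrySer_one_eq, hp, entryCorr_one, add_assoc, ← sub_eq_add_neg]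
    exact add_mem (cUp_sub_mem_range k k) hs.2
  · rw [h, zcoeff_entrySer_neg, hp, entryCorr_neg, ← toRat_cUp, Nat.cast_add]
    obtain ⟨x, hx⟩ := cUp_eq_two_mul_add ℤ k N
    have hneg : toRat (negT ℤ N) = negT ℚ N := by
      rw [negT, negT, map_prod]
      exact Finset.prod_congr rfl fun a _ => by rw [map_neg, toRat_tVar]
    rw [hx, map_add, mul_add, half_mul_toRat_two_mul, map_mul, toRat_C, map_cPoly, hneg]
    convert add_mem (toRat_mem_range x) (mul_mem hs.1 (hneg ▸ toRat_mem_range (negT ℤ N))) using 1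
    ring

/-- A factor is integral for the raising operators which do not lower its index. -/
theorem evenFactor_mem_range {n : ℕ × ℕ →₀ ℕ} (hn : n.support ⊆ lam.pairs) {j : ℕ} (hj : 1 ≤ j)
    (hin : ∀ i, n (i, j) = 0) : lam.evenFactor n j ∈ toRat.range := by
  by_cases hav : Avoids n j
  · exact lam.evenFactor_mem_range_of_avoids hj hav
  · rw [evenFactor, if_neg hav, add_zero]
    refine lam.entrySer_mem_range hj ?_
    unfold Avoids at hav
    push Not at hav
    obtain ⟨p, hp, h⟩ := hav
    have hpp := lam.mem_pairs_of_ne_zero hn hp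
    have h1 : p.1 = j := by
      by_contra h1
      apply hp
      have := hin p.1
      rwa [← h h1] at this
    have h6 := Finset.single_le_sum (f := fun l => (n (j, l) : ℤ)) (fun _ _ => by positivity)
      (Finset.mem_Icc.2 (show 1 ≤ p.2 ∧ p.2 ≤ lam.length by omega))
    have h7 : n (j, p.2) ≠ 0 := by
      rw [← h1]
      exact hp
    have h8 : lam.raised n j = lam.part j + ∑ l ∈ Finset.Icc 1 lam.length, (n (j, l) : ℤ) := by
      rw [raised]
      congr 1
      refine Finset.sum_congr rfl fun l _ => ?_
      rw [hin, Nat.cast_zero, sub_zero]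
    omega

/-- The factor at `j` is integral after multiplication with the coefficients of the factors
`R_{ij}`, which are even if `(i, j) ∈ C(λ)` and `R_{ij}` occurs. -/
theorem prod_pairCoeff_mul_evenFactor_mem_range {n : ℕ × ℕ →₀ ℕ} (hn : n.support ⊆ lam.pairs)
    {j : ℕ} (hj : 1 ≤ j) :
    (∏ i ∈ (Finset.Icc 1 lam.length).filter (fun i => i < j), lam.pairCoeff (i, j) (n (i, j)))
      * lam.evenFactor n j ∈ toRat.range := by
  classical
  have hprod : ∀ s : Finset ℕ, ∏ i ∈ s, lam.pairCoeff (i, j) (n (i, j)) ∈ toRat.range :=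
    fun s => prod_mem fun i _ => lam.pairCoeff_mem_range _ _
  by_cases hin : ∀ i, n (i, j) = 0
  · exact mul_mem (hprod _) (lam.evenFactor_mem_range hn hj hin)
  · push Not at hin
    obtain ⟨i, hi⟩ := hin
    have hp := lam.mem_pairs_of_ne_zero hn hi
    simp only at hp
    have hav : ¬ Avoids n j := fun h => (h _ hi).2 rfl
    rw [evenFactor, if_neg hav, add_zero]
    by_cases hv : 2 ≤ lam.entry j
    · rw [zcoeff_entrySer_of_one_lt k (by omega)]
      exact mul_mem (hprod _) (cUp_mem_range _ _ _)
    · have hlt := lam.entry_lt hp.1 hp.2.1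
      have h0 := lam.entry_ne_zero hj
      have h0' := lam.entry_ne_zero hp.1
      have hne : lam.entry i ≠ -lam.entry j := fun h =>
        lam.abs_entry_ne hp.1 hj (by omega) (by rw [h, abs_neg])
      have hmem : i ∈ (Finset.Icc 1 lam.length).filter (fun i => i < j) := by
        rw [Finset.mem_filter, Finset.mem_Icc]
        omega
      obtain ⟨a, ha⟩ := Nat.exists_eq_succ_of_ne_zero hi
      rw [← Finset.mul_prod_erase _ _ hmem, pairCoeff, ha, Nat.succ_eq_add_one,
        coeff_raiseSer_of_neg _ (show lam.entry i + lam.entry j < 0 by omega)]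
      convert mul_mem (mul_mem (pow_mem (neg_mem (one_mem toRat.range)) (a + 1))
        (hprod (((Finset.Icc 1 lam.length).filter (fun i => i < j)).erase i)))
        (lam.two_mul_entrySer_mem_range hj (lam.raised n j)) using 1
      ring

theorem evenTerm_mem_range {n : ℕ × ℕ →₀ ℕ} (hn : n.support ⊆ lam.pairs) :
    lam.evenTerm n ∈ toRat.range := by
  rw [evenTerm, pairs, Finset.prod_filter, Finset.prod_product_right, ← Finset.prod_mul_distrib]
  refine prod_mem fun j hj => ?_
  rw [← Finset.prod_filter]
  exact lam.prod_pairCoeff_mul_evenFactor_mem_range hn (Finset.mem_Icc.1 hj).1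

/-- Double eta polynomials have integral coefficients. -/
theorem exists_toRat_eq_doubleEta : ∃ F, toRat F = lam.doubleEta := by
  rw [doubleEta_eq_sum]
  exact sum_mem (S := toRat.range) fun n hn =>
    lam.evenTerm_mem_range (Finset.mem_finsupp_iff.1 hn).1

end TypedPartition

/-! ### The quadratic relations -/

section Relations

theorem neg_one_pow_mul_self {A : Type*} [CommRing A] (n : ℕ) : (-1 : A) ^ n * (-1) ^ n = 1 := by
  rw [← mul_pow, neg_mul_neg, one_mul, one_pow]

/-- The alternating sum `∑ (-1)^b f_a f_b`, over `a + b = 2p`, in terms of its middle term. -/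
theorem sum_antidiagonal_neg_one_pow {A : Type*} [CommRing A] (f : ℕ → A) (p : ℕ) :
    ∑ x ∈ Finset.HasAntidiagonal.antidiagonal (2 * p), (-1) ^ x.2 * (f x.1 * f x.2)
      = (-1) ^ p * (f p * f p + 2 * ∑ i ∈ Finset.Icc 1 p, (-1) ^ i * (f (p + i) * f (p - i))) := by
  have hI : ∑ i ∈ Finset.Icc 1 p, (-1) ^ i * (f (p + i) * f (p - i))
      = ∑ i ∈ Finset.range p, (-1) ^ (i + 1) * (f (p + (i + 1)) * f (p - (i + 1))) := by
    rw [← Finset.Ico_succ_right_eq_Icc, Finset.sum_Ico_eq_sum_range]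
    refine Finset.sum_congr rfl fun i _ => ?_
    rw [add_comm 1 i]
  rw [hI, Finset.Nat.sum_antidiagonal_eq_sum_range_succ_mk, Nat.succ_eq_add_one,
    show 2 * p + 1 = p + 1 + p by ring, Finset.sum_range_add, Finset.sum_range_succ,
    ← Finset.sum_range_reflect _ p]
  dsimp only
  have h1 : ∀ i ∈ Finset.range p, (-1 : A) ^ (2 * p - (p - 1 - i)) *
      (f (p - 1 - i) * f (2 * p - (p - 1 - i)))
      = (-1) ^ p * ((-1) ^ (i + 1) * (f (p + (i + 1)) * f (p - (i + 1)))) := by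
    intro i hi
    rw [Finset.mem_range] at hi
    rw [show 2 * p - (p - 1 - i) = p + (i + 1) by omega, show p - 1 - i = p - (i + 1) by omega,
      pow_add]
    ring
  have h2 : ∀ i ∈ Finset.range p, (-1 : A) ^ (2 * p - (p + 1 + i)) *
      (f (p + 1 + i) * f (2 * p - (p + 1 + i)))
      = (-1) ^ p * ((-1) ^ (i + 1) * (f (p + (i + 1)) * f (p - (i + 1)))) := by
    intro i hi
    rw [Finset.mem_range] at hi
    have h3 : (-1 : A) ^ p = (-1) ^ (p - (i + 1)) * (-1) ^ (i + 1) := by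
      rw [← pow_add]
      congr 1
      omega
    rw [show 2 * p - (p + 1 + i) = p - (i + 1) by omega, show p + 1 + i = p + (i + 1) by ring, h3]
    linear_combination (-((-1 : A) ^ (p - (i + 1)) * (f (p + (i + 1)) * f (p - (i + 1))))) *
      neg_one_pow_mul_self (A := A) (i + 1)
  rw [Finset.sum_congr rfl h1, Finset.sum_congr rfl h2, ← Finset.mul_sum,
    show 2 * p - p = p by omega]
  ring

theorem sum_antidiagonal_neg_one_pow_of_odd (f : ℕ → PolyB ℤ) {s : ℕ} (hs : Odd s) :
    ∑ x ∈ Finset.HasAntidiagonal.antidiagonal s, (-1) ^ x.2 * (f x.1 * f x.2) = 0 := by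
  have h : ∑ x ∈ Finset.HasAntidiagonal.antidiagonal s, (-1) ^ x.2 * (f x.1 * f x.2)
      = -∑ x ∈ Finset.HasAntidiagonal.antidiagonal s, (-1) ^ x.2 * (f x.1 * f x.2) := by
    refine Finset.Nat.sum_antidiagonal_swap.symm.trans ?_
    rw [← Finset.sum_neg_distrib]
    refine Finset.sum_congr rfl fun x hx => ?_
    rw [Finset.HasAntidiagonal.mem_antidiagonal] at hx
    have h1 : (-1 : PolyB ℤ) ^ x.1 = -(-1) ^ x.2 := by
      rw [← hx, Nat.odd_add] at hs
      by_cases h2 : Odd x.1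
      · rw [h2.neg_one_pow, (hs.1 h2).neg_one_pow]
      · have h3 : ¬ Even x.2 := fun h => h2 (hs.2 h)
        rw [(Nat.not_odd_iff_even.1 h2).neg_one_pow, (Nat.not_even_iff_odd.1 h3).neg_one_pow,
          neg_neg]
    rw [Prod.fst_swap, Prod.snd_swap, h1]
    ring
  exact self_eq_neg.1 h

/-- The coefficient of `X^s` in `c(X) c(-X)`, over the integers. -/
noncomputable def thetaInt (k s : ℕ) : PolyB ℤ :=
  ∑ x ∈ Finset.HasAntidiagonal.antidiagonal s, (-1) ^ x.2 * (cPoly ℤ k (x.1 : ℕ) * cPoly ℤ k (x.2 : ℕ))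

theorem thetaCoeff_eq (k s : ℕ) : thetaCoeff k s = toRat (MvPolynomial.C (thetaInt k s)) := by
  rw [thetaCoeff, PowerSeries.coeff_mul, thetaInt, map_sum, map_sum]
  refine Finset.sum_congr rfl fun x _ => ?_
  rw [PowerSeries.coeff_rescale, cBase, PowerSeries.coeff_mk, PowerSeries.coeff_mk, map_mul,
    map_mul, map_mul, map_mul, map_pow, map_pow, map_neg, map_neg, map_one, map_one, toRat_C,
    toRat_C, map_cPoly, map_cPoly]
  ring

/-- The coefficients of `c(X) c(-X)` of even degree `2p > 2k` are multiples of the defining relations. -/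
theorem thetaInt_of_lt {k p : ℕ} (hp : k < p) :
    thetaInt k (2 * p) = (-1) ^ p * (4 * relLarge k p) := by
  have h : 2 * ∑ i ∈ Finset.Icc 1 p, (-1) ^ i * (cPoly ℤ k (p + i : ℕ) * cPoly ℤ k (p - i : ℕ))
      = 4 * ∑ i ∈ Finset.Icc 1 p, (-1) ^ i * (bPoly ℤ (p + i) * cPoly ℤ k (p - i)) := by
    rw [Finset.mul_sum, Finset.mul_sum]
    refine Finset.sum_congr rfl fun i hi => ?_
    rw [Finset.mem_Icc] at hi
    rw [cPoly_of_lt ℤ (show (k : ℤ) < (p + i : ℕ) by omega), Nat.cast_sub hi.2, Nat.cast_add]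
    ring
  rw [thetaInt, sum_antidiagonal_neg_one_pow (fun a => cPoly ℤ k (a : ℕ)), h, relLarge, cPoly_of_lt ℤ (show (k : ℤ) < (p : ℕ) by omega)]
  ring

/-- The coefficient of `c(X) c(-X)` in degree `2k`: the middle term `c_k²` is
`(b̃_k - b_k)² + 4 b_k b̃_k`. -/
theorem thetaInt_two_mul (k : ℕ) : thetaInt k (2 * k)
    = (-1) ^ k * ((bTildePoly ℤ - bPoly ℤ k) ^ 2 + 4 * relMiddle k) := by
  have h : 2 * ∑ i ∈ Finset.Icc 1 k, (-1) ^ i * (cPoly ℤ k (k + i : ℕ) * cPoly ℤ k (k - i : ℕ))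
      = 4 * ∑ i ∈ Finset.Icc 1 k, (-1) ^ i * (bPoly ℤ (k + i) * bPoly ℤ (k - i)) := by
    rw [Finset.mul_sum, Finset.mul_sum]
    refine Finset.sum_congr rfl fun i hi => ?_
    rw [Finset.mem_Icc] at hi
    have h : cPoly ℤ k ((k - i : ℕ) : ℤ) = bPoly ℤ (k - i) := by
      rw [cPoly, if_pos (by omega), Nat.cast_sub hi.2]
    rw [cPoly_of_lt ℤ (show (k : ℤ) < (k + i : ℕ) by omega), h, Nat.cast_add]
    ring
  have hc : cPoly ℤ k (k : ℕ) = bPoly ℤ k + bTildePoly ℤ := by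
    rw [cPoly, if_neg (lt_irrefl _), if_pos rfl]
  rw [thetaInt, sum_antidiagonal_neg_one_pow (fun a => cPoly ℤ k (a : ℕ)), h, relMiddle, hc]
  ring

end Relations

/-! ### Elimination of variables in `B^{(k)}` -/

/-- The relation with leading term `(-1)^p b_{2p}`, for `p ≥ k`. -/
noncomputable def quadRel (k p : ℕ) : PolyB ℤ := if p = k then relMiddle k else relLarge k p

theorem quadRel_mem {k p : ℕ} (h : k ≤ p) : quadRel k p ∈ idealJ k := by
  rw [quadRel]
  split_ifs with hp
  · exact Ideal.subset_span (Or.inr rfl)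
  · exact Ideal.subset_span (Or.inl ⟨p, by omega, rfl⟩)

theorem map_cPoly_congr {A : Type*} [CommRing A] {g g' : PolyB ℤ →+* A}
    (hT : g (bTildePoly ℤ) = g' (bTildePoly ℤ)) (k m : ℕ)
    (hk : g (bPoly ℤ k) = g' (bPoly ℤ k)) (hm : g (bPoly ℤ m) = g' (bPoly ℤ m)) :
    g (cPoly ℤ k m) = g' (cPoly ℤ k m) := by
  rw [cPoly]
  split_ifs
  · exact hm
  · rw [map_add, map_add, hk, hT]
  · rw [map_mul, map_mul, hm, map_ofNat, map_ofNat]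

/-- Apart from its leading term, the relation involves only `b̃_k` and the `b_m` with `m < 2p`. -/
theorem map_quadRel_sub {A : Type*} [CommRing A] {k p : ℕ} (hk : 0 < k) (hp : k ≤ p)
    {g g' : PolyB ℤ →+* A} (hT : g (bTildePoly ℤ) = g' (bTildePoly ℤ))
    (hb : ∀ m : ℕ, m < 2 * p → g (bPoly ℤ m) = g' (bPoly ℤ m)) :
    g (quadRel k p) - (-1) ^ p * g (bPoly ℤ (2 * p : ℕ))
      = g' (quadRel k p) - (-1) ^ p * g' (bPoly ℤ (2 * p : ℕ)) := by
  obtain ⟨q, rfl⟩ : ∃ q, p = q + 1 := ⟨p - 1, by omega⟩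
  have hb' : ∀ m : ℤ, 0 ≤ m → m < 2 * (q + 1 : ℕ) → g (bPoly ℤ m) = g' (bPoly ℤ m) := by
    intro m h0 h1
    obtain ⟨n, rfl⟩ := Int.eq_ofNat_of_zero_le h0
    exact hb n (by omega)
  have h0 : bPoly ℤ 0 = 1 := rfl
  have hlast : ((q + 1 : ℕ) : ℤ) + (q + 1 : ℕ) = (2 * (q + 1) : ℕ) := by push_cast; ring
  rw [quadRel]
  split_ifs with hpk
  · rw [← hpk, relMiddle, Finset.sum_Icc_succ_top (by omega), hlast, sub_self, h0, mul_one]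
    simp only [map_add, map_mul, map_sum, map_pow, map_neg, map_one]
    rw [hT, hb' _ (by omega) (by omega), Finset.sum_congr rfl fun i hi => ?_]
    · ring
    · rw [Finset.mem_Icc] at hi
      rw [hb' _ (by omega) (by omega), hb' (((q + 1 : ℕ) : ℤ) - i) (by omega) (by omega)]
  · have hc : cPoly ℤ k 0 = 1 := by rw [cPoly, if_pos (by omega), h0]
    rw [relLarge, Finset.sum_Icc_succ_top (by omega), hlast, sub_self, hc, mul_one]
    simp only [map_add, map_mul, map_sum, map_pow, map_neg, map_one]
    rw [hb' _ (by omega) (by omega), Finset.sum_congr rfl fun i hi => ?_]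
    · ring
    · rw [Finset.mem_Icc] at hi
      rw [hb' _ (by omega) (by omega), show ((q + 1 : ℕ) : ℤ) - i = (q + 1 - i : ℕ) by omega,
        map_cPoly_congr hT _ _ (hb _ (by omega)) (hb _ (by omega))]

/-- The homomorphism with `b_m ↦ f m` and `b̃_k ↦ b̃_k`. -/
noncomputable def substB (f : ℕ → PolyB ℤ) : PolyB ℤ →+* PolyB ℤ :=
  MvPolynomial.eval₂Hom (Int.castRingHom (PolyB ℤ)) fun
    | Gen.bTilde => bTildePoly ℤ
    | Gen.b n => f (n + 1)

theorem substB_bTildePoly (f : ℕ → PolyB ℤ) : substB f (bTildePoly ℤ) = bTildePoly ℤ := by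
  rw [substB, bTildePoly, MvPolynomial.coe_eval₂Hom, MvPolynomial.eval₂_X]

theorem substB_bPoly (f : ℕ → PolyB ℤ) (n : ℕ) : substB f (bPoly ℤ (n + 1 : ℕ)) = f (n + 1) := by
  change substB f (MvPolynomial.X (Gen.b n)) = _
  rw [substB, MvPolynomial.coe_eval₂Hom, MvPolynomial.eval₂_X]

theorem substB_bPoly_zero (f : ℕ → PolyB ℤ) : substB f (bPoly ℤ (0 : ℕ)) = 1 := by
  change substB f 1 = 1
  rw [map_one]

open Classical in
/-- The expression of `b_n` modulo `J^{(k)}` in terms of `b̃_k` and those `b_m` for which `m` is odd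
or less than `2k`: the relation with leading term `±b_n` is solved for `b_n`. -/
noncomputable def elimB (k : ℕ) (n : ℕ) : PolyB ℤ :=
  if Even n ∧ 2 * k ≤ n then
    (-1) ^ (n / 2 + 1) * substB (fun m => if _h : m < n then elimB k m else 0) (quadRel k (n / 2))
  else bPoly ℤ n
termination_by n

/-- The elimination of the variables `b_{2p}` with `p ≥ k`. -/
noncomputable def elimHom (k : ℕ) : PolyB ℤ →+* PolyB ℤ := substB (elimB k)

theorem elimHom_quadRel {k p : ℕ} (hk : 0 < k) (hp : k ≤ p) : elimHom k (quadRel k p) = 0 := by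
  obtain ⟨q, hq⟩ : ∃ q, 2 * p = q + 1 := ⟨2 * p - 1, by omega⟩
  have h1 : elimHom k (bPoly ℤ (2 * p : ℕ)) = elimB k (2 * p) := by
    rw [hq, elimHom, substB_bPoly]
  have h2 := elimB.eq_def k (2 * p)
  rw [if_pos ⟨even_two_mul p, by omega⟩, Nat.mul_div_cancel_left p (by omega)] at h2
  obtain ⟨f, hf⟩ : ∃ f : ℕ → PolyB ℤ, f = fun m => if _h : m < 2 * p then elimB k m else 0 :=
    ⟨_, rfl⟩
  rw [← hf] at h2
  have h3 := map_quadRel_sub hk hp (g := elimHom k) (g' := substB f)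
    (by rw [elimHom, substB_bTildePoly, substB_bTildePoly]) (by
      intro m hm
      rw [elimHom]
      rcases m with _ | m
      · rw [substB_bPoly_zero, substB_bPoly_zero]
      · rw [substB_bPoly, substB_bPoly, hf]
        simp only [hm, dif_pos])
  have h4 : substB f (bPoly ℤ (2 * p : ℕ)) = 0 := by
    rw [hq, substB_bPoly, ← hq, hf]
    simp
  rw [h1, h2, h4, pow_succ] at h3
  linear_combination h3 - substB f (quadRel k p) * neg_one_pow_mul_self (A := PolyB ℤ) p

/-- The elimination does not change the class in `B^{(k)}`. -/
theorem mk_elimHom {k : ℕ} (hk : 0 < k) (x : PolyB ℤ) :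
    Ideal.Quotient.mk (idealJ k) (elimHom k x) = Ideal.Quotient.mk (idealJ k) x := by
  have hT : (Ideal.Quotient.mk (idealJ k)).comp (elimHom k) (bTildePoly ℤ)
      = Ideal.Quotient.mk (idealJ k) (bTildePoly ℤ) := by
    rw [RingHom.comp_apply, elimHom, substB_bTildePoly]
  have hb : ∀ n : ℕ, (Ideal.Quotient.mk (idealJ k)).comp (elimHom k) (bPoly ℤ n)
      = Ideal.Quotient.mk (idealJ k) (bPoly ℤ n) := by
    intro n
    induction n using Nat.strong_induction_on with
    | _ n ih =>
      by_cases hn : Even n ∧ 2 * k ≤ n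
      · obtain ⟨p, hp⟩ := hn.1
        obtain rfl : n = 2 * p := by omega
        have h := map_quadRel_sub hk (show k ≤ p by omega) hT ih
        rw [RingHom.comp_apply (Ideal.Quotient.mk (idealJ k)) _ (quadRel k p), elimHom_quadRel hk (by omega), map_zero,
          Ideal.Quotient.eq_zero_iff_mem.2 (quadRel_mem (show k ≤ p by omega))] at h
        rw [RingHom.comp_apply] at h ⊢
        linear_combination (-(-1) ^ p) * h -
          (Ideal.Quotient.mk (idealJ k) (elimHom k (bPoly ℤ (2 * p : ℕ)))
            - Ideal.Quotient.mk (idealJ k) (bPoly ℤ (2 * p : ℕ))) *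
          neg_one_pow_mul_self (A := RingB k) p
      · rw [RingHom.comp_apply, elimHom]
        rcases n with _ | n
        · rw [substB_bPoly_zero]
          rfl
        · rw [substB_bPoly, elimB, if_neg hn]
  have h : (Ideal.Quotient.mk (idealJ k)).comp (elimHom k) = Ideal.Quotient.mk (idealJ k) := by
    refine MvPolynomial.ringHom_ext (fun z => ?_) fun g => ?_
    · simp
    · cases g with
      | bTilde => exact hT
      | b n => exact hb (n + 1)
  exact congrArg (fun f => f x) h

/-- The elimination, with rational coefficients. -/
noncomputable def elimRat (k : ℕ) : PolyBT ℚ →+* PolyBT ℚ :=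
  MvPolynomial.map (MvPolynomial.eval₂Hom MvPolynomial.C fun g =>
    MvPolynomial.map (Int.castRingHom ℚ) (elimHom k (MvPolynomial.X g)))

theorem elimRat_toRat (k : ℕ) (F : PolyBT ℤ) :
    elimRat k (toRat F) = toRat (MvPolynomial.map (elimHom k) F) := by
  rw [elimRat, toRat, MvPolynomial.map_map, MvPolynomial.map_map]
  congr 1
  congr 1
  refine MvPolynomial.ringHom_ext (fun z => ?_) fun g => ?_
  · simp
  · simp

/-- Equality in `B^{(k)}[t]` can be tested after elimination, over the rational numbers. -/
theorem toRingBT_eq_of_elimRat {k : ℕ} (hk : 0 < k) {F G : PolyBT ℤ}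
    (h : elimRat k (toRat F) = elimRat k (toRat G)) : toRingBT k F = toRingBT k G := by
  rw [elimRat_toRat, elimRat_toRat] at h
  have h1 := toRat_injective h
  have h2 : ∀ F : PolyBT ℤ, toRingBT k F = toRingBT k (MvPolynomial.map (elimHom k) F) := by
    intro F
    rw [toRingBT, MvPolynomial.map_map]
    congr 1
    congr 1
    exact RingHom.ext fun x => (mk_elimHom hk x).symm
  rw [h2 F, h2 G, h1]

theorem elimRat_toRat_C (k : ℕ) (x : PolyB ℤ) :
    elimRat k (toRat (MvPolynomial.C x)) = toRat (MvPolynomial.C (elimHom k x)) := by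
  rw [elimRat_toRat, MvPolynomial.map_C]

theorem elimRat_thetaCoeff {k : ℕ} (hk : 0 < k) {s : ℕ} (hs : 2 * k < s) :
    elimRat k (thetaCoeff k s) = 0 := by
  rw [thetaCoeff_eq, elimRat_toRat_C]
  rcases Nat.even_or_odd s with h | h
  · obtain ⟨p, hp⟩ := h
    obtain rfl : s = 2 * p := by omega
    have h1 := elimHom_quadRel hk (show k ≤ p by omega)
    rw [quadRel, if_neg (by omega)] at h1
    have h2 : elimHom k (thetaInt k (2 * p)) = 0 := by
      rw [thetaInt_of_lt (by omega), map_mul, map_mul, h1, mul_zero, mul_zero]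
    rw [h2, map_zero, map_zero]
  · rw [thetaInt, sum_antidiagonal_neg_one_pow_of_odd (fun a => cPoly ℤ k (a : ℕ)) h, map_zero,
      map_zero, map_zero]

theorem dDiff_sq_sub (k : ℕ) : dDiff k ^ 2 - (-1) ^ k * thetaCoeff k (2 * k)
    = toRat (MvPolynomial.C (-4 * relMiddle k)) := by
  have hd : dDiff k = toRat (MvPolynomial.C (bTildePoly ℤ - bPoly ℤ k)) := by
    rw [toRat_C, map_sub, map_bTildePoly, map_bPoly, dDiff]
  have hs : (-1 : PolyBT ℚ) ^ k = toRat (MvPolynomial.C ((-1) ^ k)) := by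
    rw [map_pow, map_pow, map_neg, map_neg, map_one, map_one]
  rw [hd, hs, thetaCoeff_eq, thetaInt_two_mul, ← map_pow, ← map_pow, ← map_mul, ← map_mul,
    ← map_sub, ← map_sub]
  congr 2
  linear_combination (-((bTildePoly ℤ - bPoly ℤ k) ^ 2 + 4 * relMiddle k)) *
    neg_one_pow_mul_self (A := PolyB ℤ) k

theorem elimRat_dDiff_sq_sub {k : ℕ} (hk : 0 < k) :
    elimRat k (dDiff k ^ 2 - (-1) ^ k * thetaCoeff k (2 * k)) = 0 := by
  have h1 := elimHom_quadRel hk (le_refl k)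
  rw [quadRel, if_pos rfl] at h1
  rw [dDiff_sq_sub, elimRat_toRat_C, map_mul (elimHom k), h1, mul_zero, map_zero, map_zero]

theorem half_mul_half_dDiff_sq_sub (k : ℕ) :
    half * half * (dDiff k ^ 2 - (-1) ^ k * thetaCoeff k (2 * k))
      = -toRat (MvPolynomial.C (relMiddle k)) := by
  have h : (4 : PolyBT ℚ) * (half * half) = 1 := by
    linear_combination (2 * half + 1) * two_mul_half
  rw [dDiff_sq_sub, map_mul, map_mul, map_neg, map_neg, map_ofNat, map_ofNat]
  linear_combination (-toRat (MvPolynomial.C (relMiddle k))) * h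

theorem relMiddle_ne_zero {k : ℕ} (hk : 0 < k) : relMiddle k ≠ 0 := by
  intro h
  -- the value at `b_k = b̃_k = 1`, where the variables `b_m` with `m > k` vanish
  have h1 := congrArg (MvPolynomial.eval (fun g : Gen => match g with
    | Gen.bTilde => (1 : ℤ)
    | Gen.b n => if n + 1 = k then 1 else 0)) h
  obtain ⟨n, rfl⟩ : ∃ n, k = n + 1 := ⟨k - 1, by omega⟩
  have hb : ∀ m : ℕ, bPoly ℤ (m + 1 : ℕ) = MvPolynomial.X (Gen.b m) := fun m => rfl
  rw [relMiddle, map_add, map_sum, Finset.sum_eq_zero, hb, bTildePoly, map_mul,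
    MvPolynomial.eval_X, MvPolynomial.eval_X, map_zero] at h1
  · simp at h1
  · intro i hi
    rw [Finset.mem_Icc] at hi
    rw [show ((n + 1 : ℕ) : ℤ) + i = ((n + i) + 1 : ℕ) by omega, hb, map_mul, map_mul,
      MvPolynomial.eval_X]
    simp only [show ¬ n + i + 1 = n + 1 by omega, if_false, zero_mul, mul_zero]

theorem denom_ne_zero (i : ℕ) : denom i ≠ 0 := by
  intro h
  have h1 := congrArg (MvPolynomial.eval (fun n : ℕ => ((n : PolyB ℤ) + 1))) h
  rw [denom] at h1
  split_ifs at h1 with hi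
  · simp only [tVar, map_add, MvPolynomial.eval_X, map_zero] at h1
    norm_num at h1
  · obtain ⟨n, rfl⟩ : ∃ n, i = n + 1 := ⟨i - 1, by omega⟩
    simp [tVar] at h1

/-- A divided difference over the integers, computed over the rational numbers. -/
theorem toRat_dividedDiff {k i : ℕ} {F : PolyBT ℤ} {H E : PolyBT ℚ} (hF : toRat F = H)
    (h : H - reflectRat k i H = toRat (denom i) * E) : toRat (dividedDiff k i F) = E := by
  have h0 : toRat (denom i) ≠ 0 := fun h0 =>
    denom_ne_zero i (toRat_injective (by rw [h0, map_zero]))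
  refine mul_left_cancel₀ h0 ?_
  rw [← map_mul, denom_mul_dividedDiff, map_sub, toRat_reflect, hF, h]

namespace TypedPartition

theorem eq_one_of_parts_eq {k p : ℕ} {lam : TypedPartition k} (hlam : lam.parts = [k + 1, k]) (hp : 1 ≤ p)
    (h : lam.part p = k + 1) : p = 1 := by
  rw [part, hlam] at h
  match p, hp with
  | 1, _ => rfl
  | 2, _ => simp at h
  | p + 3, _ => simp at h

end TypedPartition

end DoubleEta

theorem mainTheorem3 (k : ℕ) [NeZero k] (lam mu : DoubleEta.TypedPartition k) (i : ℕ)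
    (hsize : lam.size = mu.size + 1)
    (hweyl : lam.weyl = DoubleEta.simpleReflection i * mu.weyl) :
    ∃ F G : DoubleEta.PolyBT ℤ,
      DoubleEta.toRat F = lam.doubleEta ∧ DoubleEta.toRat G = mu.doubleEta ∧
      DoubleEta.toRingBT k (DoubleEta.dividedDiff k i F) = DoubleEta.toRingBT k G ∧
      (¬ (i ≤ 1 ∧ 0 < lam.type ∧ 0 < mu.type) → DoubleEta.dividedDiff k i F = G) ∧
      (lam.parts = [k + 1, k] → mu.parts = [k, k] →
        DoubleEta.dividedDiff k i F ≠ G ∧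
        DoubleEta.dividedDiff k i F - G ∈
          Ideal.span {(MvPolynomial.C (DoubleEta.relMiddle k) : DoubleEta.PolyBT ℤ)}) := by
  have hk : 0 < k := Nat.pos_of_ne_zero (NeZero.ne k)
  obtain ⟨F, hF⟩ := lam.exists_toRat_eq_doubleEta
  obtain ⟨G, hG⟩ := mu.exists_toRat_eq_doubleEta
  refine ⟨F, G, hF, hG, ?_⟩
  rcases DoubleEta.TypedPartition.doubleEta_step hsize hweyl with
    ⟨h, hne⟩ | ⟨p, hex, hi, hlt, hmt, h⟩
  · have hFG : DoubleEta.dividedDiff k i F = G :=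
      DoubleEta.toRat_injective ((DoubleEta.toRat_dividedDiff hF h).trans hG.symm)
    -- the parts `(k+1, k)` and `(k, k)` occur only in an exceptional case
    refine ⟨by rw [hFG], fun _ => hFG, fun h1 h2 => absurd ?_ (hne 1 le_rfl ?_ ?_)⟩
    · simp [DoubleEta.TypedPartition.part, h1]
    · simp [DoubleEta.TypedPartition.part, h1]
    · simp [DoubleEta.TypedPartition.part, h2]
  · refine ⟨?_, fun hni => absurd ⟨hi, hlt, hmt⟩ hni, fun h1 h2 => ?_⟩
    · obtain ⟨L, hL1, hL2, hL3⟩ : ∃ L, lam.length ≤ L ∧ mu.length ≤ L ∧ p + 1 ≤ L :=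
        ⟨max (max lam.length mu.length) (p + 1), by simp⟩
      refine DoubleEta.toRingBT_eq_of_elimRat hk ?_
      rw [DoubleEta.toRat_dividedDiff hF (h L hL1 hL2 hL3), hG, map_add,
        DoubleEta.TypedPartition.map_excess_eq_zero hex hL3 _
          (fun s hs => DoubleEta.elimRat_thetaCoeff hk hs) (DoubleEta.elimRat_dDiff_sq_sub hk),
        add_zero]
    · obtain rfl := DoubleEta.TypedPartition.eq_one_of_parts_eq h1 hex.one_le hex.part_lam
      have h3 := DoubleEta.toRat_dividedDiff hF (h 2 (by simp [DoubleEta.TypedPartition.length, h1])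
        (by simp [DoubleEta.TypedPartition.length, h2]) le_rfl)
      rw [DoubleEta.TypedPartition.excess_one_two hex, DoubleEta.half_mul_half_dDiff_sq_sub, ← hG,
        ← map_neg, ← map_add] at h3
      rw [DoubleEta.toRat_injective h3]
      refine ⟨fun h4 => DoubleEta.relMiddle_ne_zero hk ?_, ?_⟩
      · exact MvPolynomial.C_injective _ _ (by rw [map_zero]; exact neg_eq_zero.1 (add_eq_left.1 h4))
      · rw [add_sub_cancel_left]
        exact neg_mem (Ideal.subset_span rfl)
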